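/- For a prime $\pi$ of $\mathbb Z[i]$ of odd norm $N\pi$ and $\alpha\in\mathbb Z[i]$, let $\left(\frac{\alpha}{\pi}\right)_4$ be $0$ if $\pi\mid\alpha$, and otherwise the unique element of $\{1,i,-1,-i\}$ congruent to $\alpha^{(N\pi-1)/4}$ modulo $\pi$. For $\gamma\in\mathbb Z[i]$ of odd norm, with factorization $\gamma=\varepsilon\pi_1\cdots\pi_s$ ($\varepsilon$ a unit, $\pi_j$ primes), let $\left(\frac{\alpha}{\gamma}\right)_4=\prod_{j}\left(\frac{\alpha}{\pi_j}\right)_4$ be the quartic Jacobi symbol. For $u,x\in\mathbb Z[i]$ with $x$ prime to $\gamma$, let $\left(\frac{u/x}{\gamma}\right)_4=\left(\frac{z}{\gamma}\right)_4$ for any $z\in\mathbb Z[i]$ with $xz\equiv u\pmod\gamma$. **Theorem 4.5.** Let $p\equiv 1\pmod 4$ be a prime and let $a,b,c,d,x,y\in\mathbb Z$ be such that $p=c^2+d^2=x^2+(a^2+b^2)y^2\ne a^2+b^2$, $a\neq 0$, $2\mid a$, $(a,b)=1$, $c\equiv 1\pmod 4$, $d=2^rd_0$ and $y=2^ty_0$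 with integers $r,t\ge 0$ and $d_0\equiv y_0\equiv 1\pmod 4$. Assume $(c,x+d)=1$ or $(d_0,x+c)=1$. Let $m\in\mathbb Z$. (Then $x$ is prime to $b+ai$, the numbers $d$ and $x$ are prime to $p$, and all exponents of $-1$ below are integers in the respective cases. Fractions in congruences are read modulo $p$, and $2\,\|\,a$ means $2\mid a$ and $4\nmid a$.) (i) If $p\equiv 1\pmod 8$, then $\left(\frac{(ac+bd)/x}{b+ai}\right)_4=i^m$ if and only if $$(a^2+b^2)^{\frac{p-1}8}\equiv\begin{cases}(-1)^{\frac d4+\frac x4}\left(\frac cd\right)^m \pmod p&\text{if } 4\mid a,\ 2\mid x,\\(-1)^{\frac d4+\frac y4}\left(\frac cd\right)^m\pmod p&\text{if } 4\mid a,\ 2\nmid x,\\(-1)^{\frac{b+1}2+\frac d4+\frac{x-2}4}\left(\frac cd\right)^{m-1}\pmod p&\text{if } 2\,\|\,a,\ 2\mid x,\\(-1)^{\frac{b-1}2+\frac d4+\frac y4+\frac{x-1}2}\left(\frac cd\right)^{m-1}\pmod p&\text{if } 2\,\|\,a,\ 2\nmid x.\end{cases}$$ (ii) If $p\equiv 5\pmod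 8$ and $\left(\frac{(ac+bd)/x}{b+ai}\right)_4=i^m$, then $$(a^2+b^2)^{\frac{p-5}8}\equiv\begin{cases}(-1)^{\frac{x-2}4}\left(\frac cd\right)^{m-1}\frac yx\pmod p&\text{if } 4\mid a,\ 2\mid x,\\(-1)^{\frac{x+1}2}\left(\frac cd\right)^{m-1}\frac yx\pmod p&\text{if } 4\mid a,\ 2\nmid x,\\(-1)^{\frac x4+\frac{b+1}2}\left(\frac cd\right)^m\frac yx\pmod p&\text{if } 2\,\|\,a,\ 2\mid x,\\(-1)^{\frac{b-1}2}\left(\frac cd\right)^m\frac yx\pmod p&\text{if } 2\,\|\,a,\ 2\nmid x.\end{cases}$$ -/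

import Mathlib

/-- The quartic residue symbol `(α / π)₄` for a prime `π` of `ℤ[i]` of odd norm `N`: it is `0` if
`π ∣ α`, and otherwise the unique `i ^ k` in `{1, i, -1, -i}` with
`α ^ ((N - 1) / 4) ≡ i ^ k (mod π)`. -/
noncomputable def quarticResidueSymbol (α π : GaussianInt) : GaussianInt :=
  open scoped Classical in
  if π ∣ α then 0
  else if π ∣ α ^ ((π.norm.natAbs - 1) / 4) - 1 then 1
  else if π ∣ α ^ ((π.norm.natAbs - 1) / 4) - ⟨0, 1⟩ then ⟨0, 1⟩
  else if π ∣ α ^ ((π.norm.natAbs - 1) / 4) + 1 then -1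
  else -⟨0, 1⟩

/-- The quartic Jacobi symbol `(α / γ)₄` for `γ` in `ℤ[i]` of odd norm: the product of the quartic
residue symbols `(α / π)₄` over the prime factors `π` of `γ`, with multiplicity. The symbol
`(α / π)₄` depends only on the ideal `(π)`, so the choice of the prime factors up to units is
immaterial; if `γ` is a unit, the symbol is `1`. -/
noncomputable def quarticJacobiSymbol (α γ : GaussianInt) : GaussianInt :=
  ((UniqueFactorizationMonoid.factors γ).map (quarticResidueSymbol α)).prod

/-- `QuarticSymbolFracEq u x γ ζ` says that the quartic Jacobi symbol `((u / x) / γ)₄` of the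
fraction `u / x`, whose denominator `x` is prime to `γ`, has the value `ζ`. As usual, `u / x` is
read modulo `γ`: the symbol is the one of any `z` in `ℤ[i]` with `x z ≡ u (mod γ)`. -/
def QuarticSymbolFracEq (u x γ : GaussianInt) (ζ : ℂ) : Prop :=
  IsCoprime x γ ∧ ∃ z : GaussianInt, γ ∣ x * z - u ∧
    GaussianInt.toComplex (quarticJacobiSymbol z γ) = ζ

/-! Put π = c + di, of norm p, and β = b + ai, of norm q = a² + b². Modulo π the relation p = x² +
qy² says q ≡ (ix/y)². Hence q^((p-1)/8) is the quartic symbol of ix/y modulo π when p ≡ 1 (mod 8);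
when p ≡ 5 (mod 8) a factor (ix/y)⁻¹ is left over and produces the y/x in the statement. Since c/d ≡
i⁻¹ (mod π), the remaining factors are powers of the image of i. On the other side ac + bd ≡ a·π̄
(mod β) and ππ̄ = p ≡ x² (mod β), so (ac + bd)/x ≡ ax/π (mod β). With logarithms in `ZMod 4`
(`qlog`), both parts amount to evaluating the symbol of a modulo β (`qlog_im`) and `symbolSum`,
which joins the symbol of ix/y modulo π to that of x/π modulo β.

For `symbolSum`, let κ = π + εx with ε = i or ε = 1, and E = x + d or E = x + c accordingly. Then κ²
= 2εEπ - ε²qy² and Nκ = 2xE + qy². So π ≡ κ modulo x, κ² ≡ 2εEπ modulo y and modulo β, and 2xE ≡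
-qy² modulo κ. Combined with reciprocity, these congruences make the unknown symbols cancel
(`qlog_comparison`). There remain symbols of units, of 2 and of the even part ω of κ, and the symbol
of κ modulo the odd part of E, which is easy because κ ≡ c or κ ≡ di modulo E. Either coprimality
hypothesis makes E prime to the odd part of κ for one choice of ε.

The only reciprocity needed is between a rational and a Gaussian integer (`rationalReciprocity`). It
comes from the quartic Gauss sum, whose fourth power is π³π̄, by applying Frobenius in
characteristic l. The symbol of one rational integer modulo another is trivial
(`qlog_intCast_intCast`), and `qlog_I`, `qlog_one_add_I` and `qlog_two` are the supplements.

What is left is 2-adic: factor κ = ωκ' with κ' of odd real and even imaginary part, and compute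
modulo 4 according to p mod 8, q mod 8 and the parity of x. The delicate case is ε = 1, p ≡ 1 (mod
8), x ≡ 3 (mod 4), where the powers of 2 in x + c and in d have to be compared. -/

namespace GaussianInt

/-! ### The imaginary unit and logarithms of its powers -/

/-- The imaginary unit of `ℤ[i]`. -/
def I : GaussianInt := ⟨0, 1⟩

lemma I_mul_I : I * I = -1 := by
  ext <;> simp [I]

lemma I_sq : I ^ 2 = -1 := by
  rw [sq, I_mul_I]

lemma I_pow_four : I ^ 4 = 1 := by
  rw [show (4 : ℕ) = 2 * 2 from rfl, pow_mul, I_sq]; ring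

lemma I_pow_three : I ^ 3 = -I := by
  rw [pow_succ, I_sq]; ring

lemma I_pow_mod (k : ℕ) : I ^ k = I ^ (k % 4) := by
  conv_lhs => rw [← Nat.div_add_mod k 4, pow_add, pow_mul, I_pow_four, one_pow, one_mul]

lemma isUnit_I : IsUnit I := IsUnit.of_mul_eq_one (-I) (by rw [mul_neg, I_mul_I, neg_neg])

lemma star_I : star I = -I := by
  ext <;> simp [I]

lemma norm_I : I.norm = 1 := by
  simp [I, Zsqrtd.norm]

/-- The exponent `k` of a power `i ^ k` of the imaginary unit. -/
noncomputable def unitLog (z : GaussianInt) : ZMod 4 :=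
  open scoped Classical in
  if z = 1 then 0 else if z = I then 1 else if z = -1 then 2 else if z = -I then 3 else 0

lemma unitLog_I_pow (k : ℕ) : unitLog (I ^ k) = k := by
  have key : ∀ j : ℕ, j < 4 → unitLog (I ^ j) = ((j : ℕ) : ZMod 4) := by
    intro j hj
    interval_cases j
    · simp [unitLog]
    · have h1 : I ≠ 1 := by simp [I, Zsqrtd.ext_iff]
      simp [unitLog, h1]
    · have h1 : (-1 : GaussianInt) ≠ 1 := by simp [Zsqrtd.ext_iff]
      have h2 : (-1 : GaussianInt) ≠ I := by simp [I, Zsqrtd.ext_iff]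
      simp [unitLog, I_sq, h1, h2]
    · have h1 : -I ≠ 1 := by simp [I, Zsqrtd.ext_iff]
      have h2 : -I ≠ I := by simp [I, Zsqrtd.ext_iff]
      have h3 : I ≠ 1 := by simp [I, Zsqrtd.ext_iff]
      simp [unitLog, I_pow_three, h1, h2, h3]
  rw [I_pow_mod, key _ (Nat.mod_lt _ (by norm_num)), ZMod.natCast_mod]

lemma I_pow_congr {j k : ℕ} (h : (j : ZMod 4) = k) : I ^ j = I ^ k := by
  rw [I_pow_mod j, I_pow_mod k, (ZMod.natCast_eq_natCast_iff' _ _ _).mp h]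

/-! ### Norms -/

lemma norm_eq_sq (z : GaussianInt) : z.norm = z.re ^ 2 + z.im ^ 2 := by
  rw [Zsqrtd.norm_def]; ring

lemma odd_norm_mul {γ δ : GaussianInt} : Odd (γ * δ).norm ↔ Odd γ.norm ∧ Odd δ.norm := by
  rw [Zsqrtd.norm_mul, Int.odd_mul]

lemma ne_zero_of_odd {γ : GaussianInt} (h : Odd γ.norm) : γ ≠ 0 := by
  rintro rfl; simp at h

lemma norm_mod_four {γ : GaussianInt} (h : Odd γ.norm) : γ.norm % 4 = 1 := by
  rw [norm_eq_sq] at *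
  rw [Int.odd_iff] at h
  have h1 : γ.re ^ 2 % 4 = 0 ∨ γ.re ^ 2 % 4 = 1 := by
    rcases Int.even_or_odd' γ.re with ⟨k, hk | hk⟩ <;> rw [hk]
    · left; ring_nf; omega
    · right; ring_nf; omega
  have h2 : γ.im ^ 2 % 4 = 0 ∨ γ.im ^ 2 % 4 = 1 := by
    rcases Int.even_or_odd' γ.im with ⟨k, hk | hk⟩ <;> rw [hk]
    · left; ring_nf; omega
    · right; ring_nf; omega
  omega

lemma odd_norm_of_dvd {γ δ : GaussianInt} (h : δ ∣ γ) (hγ : Odd γ.norm) : Odd δ.norm := by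
  obtain ⟨z, rfl⟩ := h
  exact (odd_norm_mul.mp hγ).1

lemma norm_dvd_norm {γ δ : GaussianInt} (h : δ ∣ γ) : δ.norm ∣ γ.norm := by
  obtain ⟨z, rfl⟩ := h
  exact ⟨z.norm, Zsqrtd.norm_mul _ _⟩

lemma isUnit_of_norm_eq_one {γ : GaussianInt} (h : γ.norm = 1) : IsUnit γ :=
  (Zsqrtd.norm_eq_one_iff' (by norm_num) γ).mp h

lemma isUnit_of_dvd_two_pow {π : GaussianInt} (h : Odd π.norm) {n : ℕ} (h2 : π ∣ 2 ^ n) :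
    IsUnit π := by
  have h3 : π.norm ∣ 2 ^ (2 * n) := by
    have := norm_dvd_norm h2
    have h4 : ((2 : GaussianInt) ^ n).norm = 2 ^ (2 * n) := by
      have : (2 : GaussianInt) ^ n = ((2 ^ n : ℤ) : GaussianInt) := by push_cast; rfl
      rw [this, Zsqrtd.norm_intCast]; ring
    rwa [h4] at this
  have h5 : IsCoprime π.norm (2 ^ (2 * n)) := by
    apply IsCoprime.pow_right
    rw [Int.isCoprime_iff_gcd_eq_one, Int.gcd_comm]
    have := (Nat.coprime_two_left (n := π.norm.natAbs)).mpr (Int.natAbs_odd.mpr h)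
    exact this
  have h6 : IsUnit π.norm := h5.isUnit_of_dvd' dvd_rfl h3
  exact (Zsqrtd.isUnit_iff_norm_isUnit π).mpr h6

/-- The identification of `ℤ[i]` with `ℤ²`. -/
def equivFun : GaussianInt ≃ₗ[ℤ] (Fin 2 → ℤ) where
  toFun z := ![z.re, z.im]
  invFun v := ⟨v 0, v 1⟩
  map_add' x y := by ext i; fin_cases i <;> simp
  map_smul' n x := by ext i; fin_cases i <;> simp
  left_inv z := by ext <;> simp
  right_inv v := by ext i; fin_cases i <;> simp

/-- The `ℤ`-basis `1, i` of `ℤ[i]`. -/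
noncomputable def basisOneI : Module.Basis (Fin 2) ℤ GaussianInt := .ofEquivFun equivFun

/-- The determinant of multiplication by z counts residues modulo z, so this gives the size of the
residue field. -/
lemma algebraNorm_eq (z : GaussianInt) : Algebra.norm ℤ z = z.norm := by
  rw [Algebra.norm_eq_matrix_det basisOneI, Matrix.det_fin_two]
  have h0 : basisOneI 0 = 1 := by
    apply equivFun.injective; ext i; fin_cases i <;> simp [basisOneI, equivFun]
  have h1 : basisOneI 1 = I := by
    apply equivFun.injective; ext i; fin_cases i <;> simp [basisOneI, equivFun, I]
  have hr : ∀ w : GaussianInt, ⇑(basisOneI.repr w) = ![w.re, w.im] := fun w => rfl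
  simp only [Algebra.leftMulMatrix_eq_repr_mul, h0, h1, hr]
  simp [I, Zsqrtd.norm]

instance : Module.Free ℤ GaussianInt := Module.Free.of_basis basisOneI

instance : Module.Finite ℤ GaussianInt := Module.Finite.of_basis basisOneI

lemma card_quotient (π : GaussianInt) :
    Nat.card (GaussianInt ⧸ Ideal.span {π}) = π.norm.natAbs := by
  rw [← algebraNorm_eq, ← Ideal.absNorm_span_singleton]
  rfl

lemma finite_quotient {π : GaussianInt} (h : π ≠ 0) :
    Finite (GaussianInt ⧸ Ideal.span {π}) := by
  apply Nat.finite_of_card_ne_zero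
  rw [card_quotient]
  simpa [Zsqrtd.norm_eq_zero_iff (d := -1) (by norm_num)] using h

/-- Fermat's little theorem in the residue field, which has Nπ elements. -/
lemma prime_dvd_pow_norm_sub_one {π α : GaussianInt} (hπ : Prime π) (h : ¬ π ∣ α) :
    π ∣ α ^ (π.norm.natAbs - 1) - 1 := by
  have : (Ideal.span {π}).IsPrime := (Ideal.span_singleton_prime hπ.ne_zero).mpr hπ
  have hm : (Ideal.span {π}).IsMaximal :=
    Ideal.IsPrime.isMaximal this (by simpa using hπ.ne_zero)
  let _ := Ideal.Quotient.field (Ideal.span {π})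
  have := finite_quotient hπ.ne_zero
  let _ := Fintype.ofFinite (GaussianInt ⧸ Ideal.span {π})
  have h1 : (Ideal.Quotient.mk (Ideal.span {π}) α) ≠ 0 := by
    rwa [Ne, Ideal.Quotient.eq_zero_iff_mem, Ideal.mem_span_singleton]
  have h2 := FiniteField.pow_card_sub_one_eq_one _ h1
  rw [← Nat.card_eq_fintype_card, card_quotient] at h2
  rw [← Ideal.mem_span_singleton, ← Ideal.Quotient.eq_zero_iff_mem]
  simp [h2]

/-! ### The quartic residue symbol for a prime modulus -/

/-- The difference of two distinct powers of i divides 2, and a prime of odd norm does not. -/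
lemma eq_of_dvd_I_pow_sub {π : GaussianInt} (hπ : Prime π) (ho : Odd π.norm) {j k : ℕ}
    (h : π ∣ I ^ j - I ^ k) : (j : ZMod 4) = k := by
  have key : ∀ l < 4, π ∣ I ^ l - 1 → l = 0 := by
    intro l hl hd
    by_contra hne
    refine hπ.not_isUnit (isUnit_of_dvd_two_pow (n := 1) ho (hd.trans ?_))
    interval_cases l
    · exact absurd rfl hne
    · exact ⟨-1 - I, by linear_combination I_mul_I⟩
    · exact ⟨-1, by rw [I_sq]; ring⟩
    · exact ⟨-1 + I, by rw [I_pow_three]; linear_combination I_mul_I⟩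
  have hu : I ^ (j + 3 * k) - 1 = (I ^ j - I ^ k) * I ^ (3 * k) := by
    have : (I ^ 4) ^ k = 1 := by rw [I_pow_four, one_pow]
    rw [sub_mul, ← pow_add, ← pow_add, show k + 3 * k = 4 * k by ring, pow_mul, this]
  have h1 : π ∣ I ^ ((j + 3 * k) % 4) - 1 := by
    rw [← I_pow_mod, hu]; exact h.mul_right _
  have h2 := key _ (Nat.mod_lt _ (by norm_num)) h1
  rw [ZMod.natCast_eq_natCast_iff']
  omega

lemma norm_natAbs_sub_one {γ : GaussianInt} (h : Odd γ.norm) :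
    γ.norm.natAbs - 1 = (γ.norm.natAbs - 1) / 4 * 4 := by
  have := norm_mod_four h
  have := GaussianInt.abs_natCast_norm γ
  omega

/-- By Fermat π divides A⁴ - 1, which splits over the powers of i. In particular the last branch of
the definition of the symbol is a genuine congruence and not a default. -/
lemma exists_residueSymbol {π α : GaussianInt} (hπ : Prime π) (ho : Odd π.norm) (h : ¬ π ∣ α) :
    ∃ k : ℕ, quarticResidueSymbol α π = I ^ k ∧ π ∣ α ^ ((π.norm.natAbs - 1) / 4) - I ^ k := by
  have h1 := prime_dvd_pow_norm_sub_one hπ h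
  rw [norm_natAbs_sub_one ho, pow_mul] at h1
  unfold quarticResidueSymbol
  set A := α ^ ((π.norm.natAbs - 1) / 4)
  open scoped Classical in
  change ∃ k : ℕ, (if π ∣ α then 0 else if π ∣ A - 1 then 1 else if π ∣ A - I then I else
    if π ∣ A + 1 then -1 else -I) = I ^ k ∧ _
  have h2 : A ^ 4 - 1 = (A - 1) * ((A - I) * ((A + 1) * (A + I))) := by
    linear_combination (A ^ 2 - 1) * I_sq
  rw [if_neg h]
  split_ifs with h3 h4 h5
  · exact ⟨0, by simp, by simpa using h3⟩
  · exact ⟨1, by simp, by simpa using h4⟩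
  · exact ⟨2, by simp [I_sq], by simpa [I_sq] using h5⟩
  · refine ⟨3, by rw [I_pow_three], ?_⟩
    rw [I_pow_three, sub_neg_eq_add]
    rw [h2] at h1
    rcases hπ.dvd_or_dvd h1 with h6 | h6
    · exact absurd h6 h3
    rcases hπ.dvd_or_dvd h6 with h6 | h6
    · exact absurd h6 h4
    rcases hπ.dvd_or_dvd h6 with h6 | h6
    · exact absurd h6 h5
    exact h6

lemma residueSymbol_eq_of_dvd {π α : GaussianInt} (hπ : Prime π) (ho : Odd π.norm) (h : ¬ π ∣ α)
    {k : ℕ} (hk : π ∣ α ^ ((π.norm.natAbs - 1) / 4) - I ^ k) :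
    quarticResidueSymbol α π = I ^ k := by
  obtain ⟨j, hj, hd⟩ := exists_residueSymbol hπ ho h
  rw [hj]
  apply I_pow_congr
  apply eq_of_dvd_I_pow_sub hπ ho
  have := dvd_sub hk hd
  rwa [sub_sub_sub_cancel_left] at this

lemma residueSymbol_eq_zero {π α : GaussianInt} (h : π ∣ α) : quarticResidueSymbol α π = 0 := by
  simp [quarticResidueSymbol, h]

lemma residueSymbol_mul {π : GaussianInt} (hπ : Prime π) (ho : Odd π.norm) (α β : GaussianInt) :
    quarticResidueSymbol (α * β) π = quarticResidueSymbol α π * quarticResidueSymbol β π := by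
  by_cases hα : π ∣ α
  · rw [residueSymbol_eq_zero hα, residueSymbol_eq_zero (hα.mul_right _), zero_mul]
  by_cases hβ : π ∣ β
  · rw [residueSymbol_eq_zero hβ, residueSymbol_eq_zero (hβ.mul_left _), mul_zero]
  obtain ⟨j, hj, hjd⟩ := exists_residueSymbol hπ ho hα
  obtain ⟨k, hk, hkd⟩ := exists_residueSymbol hπ ho hβ
  rw [hj, hk, ← pow_add]
  apply residueSymbol_eq_of_dvd hπ ho
  · exact fun h => (hπ.dvd_or_dvd h).elim hα hβ
  · rw [mul_pow, pow_add]
    set A := α ^ ((π.norm.natAbs - 1) / 4)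
    set B := β ^ ((π.norm.natAbs - 1) / 4)
    have : A * B - I ^ j * I ^ k = (A - I ^ j) * B + I ^ j * (B - I ^ k) := by ring
    rw [this]
    exact dvd_add (hjd.mul_right _) (hkd.mul_left _)

lemma dvd_iff_of_dvd_sub {π α β : GaussianInt} (h : π ∣ α - β) : π ∣ α ↔ π ∣ β :=
  ⟨fun h1 => by simpa using dvd_sub h1 h, fun h1 => by simpa using dvd_add h h1⟩

lemma residueSymbol_congr {π α β : GaussianInt} (h : π ∣ α - β) :
    quarticResidueSymbol α π = quarticResidueSymbol β π := by
  have h1 := dvd_iff_of_dvd_sub h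
  have h2 : ∀ z : GaussianInt, π ∣ α ^ ((π.norm.natAbs - 1) / 4) - z ↔
      π ∣ β ^ ((π.norm.natAbs - 1) / 4) - z := by
    intro z
    apply dvd_iff_of_dvd_sub
    rw [sub_sub_sub_cancel_right]
    exact h.trans (sub_dvd_pow_sub_pow _ _ _)
  have h3 := h2 (-1)
  rw [sub_neg_eq_add, sub_neg_eq_add] at h3
  unfold quarticResidueSymbol
  rw [propext h1, propext (h2 1), propext (h2 ⟨0, 1⟩), propext h3]

lemma residueSymbol_associated {π π' : GaussianInt} (h : Associated π π') (α : GaussianInt) :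
    quarticResidueSymbol α π = quarticResidueSymbol α π' := by
  have h1 : π.norm = π'.norm := Zsqrtd.norm_eq_of_associated (by norm_num) h
  have h2 : ∀ z : GaussianInt, (π ∣ z) = (π' ∣ z) := fun z => propext h.dvd_iff_dvd_left
  unfold quarticResidueSymbol
  rw [h1, h2, h2, h2, h2]

/-! ### The quartic Jacobi symbol -/

lemma prod_map_residueSymbol_of_rel (α : GaussianInt) {s t : Multiset GaussianInt}
    (h : Multiset.Rel Associated s t) :
    (s.map (quarticResidueSymbol α)).prod = (t.map (quarticResidueSymbol α)).prod := by
  induction h with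
  | zero => rfl
  | cons h _ ih => simp [ih, residueSymbol_associated h]

lemma jacobi_mul_right (α : GaussianInt) {γ δ : GaussianInt} (hγ : γ ≠ 0) (hδ : δ ≠ 0) :
    quarticJacobiSymbol α (γ * δ) = quarticJacobiSymbol α γ * quarticJacobiSymbol α δ := by
  unfold quarticJacobiSymbol
  rw [prod_map_residueSymbol_of_rel α (UniqueFactorizationMonoid.factors_mul hγ hδ),
    Multiset.map_add, Multiset.prod_add]

lemma jacobi_associated {γ γ' : GaussianInt} (h : Associated γ γ') (α : GaussianInt) :
    quarticJacobiSymbol α γ = quarticJacobiSymbol α γ' := by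
  unfold quarticJacobiSymbol
  exact prod_map_residueSymbol_of_rel α (UniqueFactorizationMonoid.factors_rel_of_associated h)

lemma jacobi_unit (α : GaussianInt) {γ : GaussianInt} (h : IsUnit γ) :
    quarticJacobiSymbol α γ = 1 := by
  simp [quarticJacobiSymbol, UniqueFactorizationMonoid.factors_of_isUnit h]

lemma jacobi_prime (α : GaussianInt) {π : GaussianInt} (h : Prime π) :
    quarticJacobiSymbol α π = quarticResidueSymbol α π := by
  obtain ⟨b, hb, hf⟩ :=
    UniqueFactorizationMonoid.factors_eq_singleton_of_irreducible h.irreducible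
  simp [quarticJacobiSymbol, hf, residueSymbol_associated hb]

/-- Induction on the prime factorization of an element of odd norm. -/
lemma odd_induction {P : GaussianInt → Prop} (hu : ∀ γ, IsUnit γ → P γ)
    (hp : ∀ π γ, Prime π → Odd π.norm → Odd γ.norm → P γ → P (π * γ))
    {γ : GaussianInt} (h : Odd γ.norm) : P γ := by
  revert h
  refine UniqueFactorizationMonoid.induction_on_prime γ ?_ ?_ ?_
  · intro h; simp at h
  · intro x hx _; exact hu x hx
  · intro a p _ hpr ih h
    have h1 := odd_norm_mul.mp h
    exact hp p a hpr h1.1 h1.2 (ih h1.2)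

lemma jacobi_mul_left (α β : GaussianInt) {γ : GaussianInt} (h : Odd γ.norm) :
    quarticJacobiSymbol (α * β) γ = quarticJacobiSymbol α γ * quarticJacobiSymbol β γ := by
  refine odd_induction (P := fun γ => quarticJacobiSymbol (α * β) γ =
    quarticJacobiSymbol α γ * quarticJacobiSymbol β γ) ?_ ?_ h
  · intro γ hγ; simp [jacobi_unit _ hγ]
  · intro π γ hπ ho hγ ih
    have h0 := ne_zero_of_odd hγ
    simp only [jacobi_mul_right _ hπ.ne_zero h0, ih, jacobi_prime _ hπ, residueSymbol_mul hπ ho]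
    ring

lemma jacobi_congr {α β γ : GaussianInt} (h : Odd γ.norm) (hd : γ ∣ α - β) :
    quarticJacobiSymbol α γ = quarticJacobiSymbol β γ := by
  revert hd
  refine odd_induction (P := fun γ => γ ∣ α - β → quarticJacobiSymbol α γ =
    quarticJacobiSymbol β γ) ?_ ?_ h
  · intro γ hγ _; simp [jacobi_unit _ hγ]
  · intro π γ hπ ho hγ ih hd
    have h0 := ne_zero_of_odd hγ
    simp only [jacobi_mul_right _ hπ.ne_zero h0, jacobi_prime _ hπ,
      ih ((dvd_mul_left _ _).trans hd), residueSymbol_congr ((dvd_mul_right _ _).trans hd)]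

lemma exists_jacobi_eq_I_pow {α γ : GaussianInt} (h : Odd γ.norm) (hc : IsCoprime α γ) :
    ∃ k : ℕ, quarticJacobiSymbol α γ = I ^ k := by
  revert hc
  refine odd_induction (P := fun γ => IsCoprime α γ → ∃ k : ℕ, quarticJacobiSymbol α γ = I ^ k)
    ?_ ?_ h
  · intro γ hγ _; exact ⟨0, by simp [jacobi_unit _ hγ]⟩
  · intro π γ hπ ho hγ ih hc
    obtain ⟨k, hk⟩ := ih hc.of_mul_right_right
    have h1 : ¬ π ∣ α := fun hd => hπ.not_isUnit
      (hc.of_mul_right_left.isUnit_of_dvd' hd dvd_rfl)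
    obtain ⟨j, hj, -⟩ := exists_residueSymbol hπ ho h1
    exact ⟨j + k, by rw [jacobi_mul_right _ hπ.ne_zero (ne_zero_of_odd hγ), jacobi_prime _ hπ,
      hj, hk, pow_add]⟩

/-- The logarithm of the quartic Jacobi symbol: for `α` prime to `γ` the symbol is
`i ^ qlog α γ`. -/
noncomputable def qlog (α γ : GaussianInt) : ZMod 4 := unitLog (quarticJacobiSymbol α γ)

lemma jacobi_eq_I_pow_qlog {α γ : GaussianInt} (h : Odd γ.norm) (hc : IsCoprime α γ) :
    quarticJacobiSymbol α γ = I ^ (qlog α γ).val := by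
  obtain ⟨k, hk⟩ := exists_jacobi_eq_I_pow h hc
  rw [qlog, hk, unitLog_I_pow]
  apply I_pow_congr
  simp

lemma qlog_eq_of_jacobi {α γ : GaussianInt} {k : ℕ} (h : quarticJacobiSymbol α γ = I ^ k) :
    qlog α γ = k := by
  rw [qlog, h, unitLog_I_pow]

lemma qlog_mul_left {α β γ : GaussianInt} (h : Odd γ.norm) (hα : IsCoprime α γ)
    (hβ : IsCoprime β γ) : qlog (α * β) γ = qlog α γ + qlog β γ := by
  have : quarticJacobiSymbol (α * β) γ = I ^ ((qlog α γ).val + (qlog β γ).val) := by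
    rw [jacobi_mul_left _ _ h, jacobi_eq_I_pow_qlog h hα, jacobi_eq_I_pow_qlog h hβ, pow_add]
  rw [qlog_eq_of_jacobi this]
  simp

lemma qlog_mul_right {α γ δ : GaussianInt} (hγ : Odd γ.norm) (hδ : Odd δ.norm)
    (hc : IsCoprime α (γ * δ)) : qlog α (γ * δ) = qlog α γ + qlog α δ := by
  have : quarticJacobiSymbol α (γ * δ) = I ^ ((qlog α γ).val + (qlog α δ).val) := by
    rw [jacobi_mul_right _ (ne_zero_of_odd hγ) (ne_zero_of_odd hδ),
      jacobi_eq_I_pow_qlog hγ hc.of_mul_right_left,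
      jacobi_eq_I_pow_qlog hδ hc.of_mul_right_right, pow_add]
  rw [qlog_eq_of_jacobi this]
  simp

lemma qlog_congr {α β γ : GaussianInt} (h : Odd γ.norm) (hd : γ ∣ α - β) :
    qlog α γ = qlog β γ := by
  rw [qlog, jacobi_congr h hd, qlog]

lemma qlog_associated {γ γ' : GaussianInt} (h : Associated γ γ') (α : GaussianInt) :
    qlog α γ = qlog α γ' := by
  rw [qlog, jacobi_associated h, qlog]

lemma qlog_unit_right (α : GaussianInt) {γ : GaussianInt} (h : IsUnit γ) : qlog α γ = 0 := by
  rw [qlog_eq_of_jacobi (k := 0) (by simp [jacobi_unit _ h])]; simp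

lemma qlog_one_left (γ : GaussianInt) (h : Odd γ.norm) : qlog 1 γ = 0 := by
  have := qlog_mul_left (α := 1) (β := 1) h isCoprime_one_left isCoprime_one_left
  rw [mul_one] at this
  linear_combination -this

lemma qlog_pow_left {α γ : GaussianInt} (h : Odd γ.norm) (hα : IsCoprime α γ) (n : ℕ) :
    qlog (α ^ n) γ = n * qlog α γ := by
  induction n with
  | zero => simp [qlog_one_left γ h]
  | succ n ih => rw [pow_succ, qlog_mul_left h hα.pow_left hα, ih]; push_cast; ring

lemma not_dvd_of_isCoprime {π α : GaussianInt} (hπ : Prime π) (h : IsCoprime α π) : ¬ π ∣ α :=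
  fun hd => hπ.not_isUnit (h.isUnit_of_dvd' hd dvd_rfl)

lemma dvd_pow_sub_I_pow_qlog {α π : GaussianInt} (hπ : Prime π) (ho : Odd π.norm)
    (hc : IsCoprime α π) :
    π ∣ α ^ ((π.norm.natAbs - 1) / 4) - I ^ (qlog α π).val := by
  obtain ⟨k, hk, hd⟩ := exists_residueSymbol hπ ho (not_dvd_of_isCoprime hπ hc)
  rwa [← jacobi_eq_I_pow_qlog ho hc, jacobi_prime _ hπ, hk]

lemma qlog_eq_of_dvd {α π : GaussianInt} (hπ : Prime π) (ho : Odd π.norm) (h : ¬ π ∣ α) {k : ℕ}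
    (hk : π ∣ α ^ ((π.norm.natAbs - 1) / 4) - I ^ k) : qlog α π = k :=
  qlog_eq_of_jacobi (by rw [jacobi_prime _ hπ, residueSymbol_eq_of_dvd hπ ho h hk])

lemma isCoprime_of_isUnit {x : GaussianInt} (h : IsUnit x) (y : GaussianInt) : IsCoprime x y := by
  obtain ⟨u, rfl⟩ := h
  exact ⟨↑u⁻¹, 0, by simp⟩

lemma isCoprime_I (γ : GaussianInt) : IsCoprime I γ := isCoprime_of_isUnit isUnit_I γ

/-- The error term is 4jk. Thus (N - 1)/4 is additive modulo 4, as the logarithm of a symbol in its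
modulus must be. -/
lemma mul_sub_one_div_four {m n : ℤ} (hm : m % 4 = 1) (hn : n % 4 = 1) :
    (((m * n - 1) / 4 : ℤ) : ZMod 4) = ((m - 1) / 4 : ℤ) + ((n - 1) / 4 : ℤ) := by
  obtain ⟨j, rfl⟩ : ∃ j, m = 4 * j + 1 := ⟨m / 4, by omega⟩
  obtain ⟨k, rfl⟩ : ∃ k, n = 4 * k + 1 := ⟨n / 4, by omega⟩
  rw [show ((4 * j + 1) * (4 * k + 1) - 1) / 4 = 4 * (j * k) + j + k by
    rw [show (4 * j + 1) * (4 * k + 1) - 1 = (4 * (j * k) + j + k) * 4 by ring]; omega,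
    show (4 * j + 1 - 1) / 4 = j by omega, show (4 * k + 1 - 1) / 4 = k by omega]
  push_cast
  rw [show (4 : ZMod 4) = 0 from rfl]
  ring

lemma qlog_I {γ : GaussianInt} (h : Odd γ.norm) : qlog I γ = ((γ.norm - 1) / 4 : ℤ) := by
  refine odd_induction (P := fun γ => qlog I γ = ((γ.norm - 1) / 4 : ℤ)) ?_ ?_ h
  · intro γ hγ
    rw [qlog_unit_right _ hγ, (Zsqrtd.norm_eq_one_iff' (by norm_num) γ).mpr hγ]
    simp
  · intro π γ hπ ho hγ ih
    rw [qlog_mul_right ho hγ (isCoprime_I _), ih, Zsqrtd.norm_mul,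
      mul_sub_one_div_four (norm_mod_four ho) (norm_mod_four hγ)]
    congr 1
    have h1 : ¬ π ∣ I := not_dvd_of_isCoprime hπ (isCoprime_I _)
    -- For α = i the power defining the symbol is already a power of i.
    rw [qlog_eq_of_dvd hπ ho h1 (k := (π.norm.natAbs - 1) / 4) (by simp)]
    have := GaussianInt.abs_natCast_norm π
    have := norm_mod_four ho
    rw [show ((π.norm - 1) / 4 : ℤ) = (((π.norm.natAbs - 1) / 4 : ℕ) : ℤ) by omega,
      Int.cast_natCast]

/-! ### Conjugation -/

lemma star_dvd_star {x y : GaussianInt} : star x ∣ star y ↔ x ∣ y := by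
  constructor
  · rintro ⟨z, hz⟩
    exact ⟨star z, by rw [← star_star y, hz, star_mul, star_star, mul_comm]⟩
  · rintro ⟨z, rfl⟩
    exact ⟨star z, by rw [star_mul, mul_comm]⟩

lemma prime_star {π : GaussianInt} (h : Prime π) : Prime (star π) :=
  (MulEquiv.prime_iff (starMulAut (R := GaussianInt)) (p := π)).mpr h

lemma isCoprime_star {x y : GaussianInt} (h : IsCoprime x y) : IsCoprime (star x) (star y) := by
  obtain ⟨a, b, hab⟩ := h
  exact ⟨star a, star b, by rw [← star_mul', ← star_mul', ← star_add, hab, star_one]⟩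

lemma odd_norm_star {γ : GaussianInt} : Odd (star γ).norm ↔ Odd γ.norm := by
  rw [Zsqrtd.norm_conj]

/-- Conjugate the defining congruence; the conjugate of i^k is i^(-k), written i^(3k) to keep
natural exponents. -/
lemma qlog_star {α γ : GaussianInt} (h : Odd γ.norm) (hc : IsCoprime α γ) :
    qlog (star α) (star γ) = -qlog α γ := by
  revert hc
  refine odd_induction (P := fun γ => IsCoprime α γ → qlog (star α) (star γ) = -qlog α γ) ?_ ?_ h
  · intro γ hγ _
    rw [qlog_unit_right _ hγ, qlog_unit_right _ hγ.star, neg_zero]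
  · intro π γ hπ ho hγ ih hc
    have hs := isCoprime_star hc
    rw [star_mul'] at hs ⊢
    rw [qlog_mul_right ho hγ hc, qlog_mul_right (odd_norm_star.mpr ho) (odd_norm_star.mpr hγ) hs,
      ih hc.of_mul_right_right, neg_add]
    congr 1
    have h1 := dvd_pow_sub_I_pow_qlog hπ ho hc.of_mul_right_left
    rw [← star_dvd_star] at h1
    have h2 : star (I ^ (qlog α π).val) = I ^ (3 * (qlog α π).val) := by
      rw [star_pow, star_I, ← I_pow_three, ← pow_mul]
    rw [star_sub, star_pow, h2, ← Zsqrtd.norm_conj] at h1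
    rw [qlog_eq_of_dvd (prime_star hπ) (odd_norm_star.mpr ho)
      (not_dvd_of_isCoprime (prime_star hπ) hs.of_mul_right_left) h1]
    push_cast
    rw [ZMod.natCast_zmod_val, show (3 : ZMod 4) = -1 from rfl]
    ring

/-! ### The quartic character of `ℤ/p` attached to a prime of norm `p` -/

section QuarticChar

variable {p : ℕ} {π : GaussianInt}

lemma natCast_dvd_of_norm_eq (hn : π.norm = p) : π ∣ (p : GaussianInt) := by
  refine ⟨star π, ?_⟩
  rw [← Zsqrtd.norm_eq_mul_conj, hn, Int.cast_natCast]

lemma prime_mod_four (hn : π.norm = p) (ho : Odd π.norm) : p % 4 = 1 := by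
  have := norm_mod_four ho
  rw [hn] at this
  omega

variable [Fact p.Prime]

lemma prime_of_norm_eq (hn : π.norm = p) : Prime π := by
  rw [← UniqueFactorizationMonoid.irreducible_iff_prime]
  have hp : Prime (π.norm) := by rw [hn]; exact Nat.prime_iff_prime_int.mp Fact.out
  refine ⟨fun h => hp.not_isUnit ((Zsqrtd.isUnit_iff_norm_isUnit π).mp h), ?_⟩
  intro x y hxy
  rw [hxy, Zsqrtd.norm_mul] at hp
  rcases hp.irreducible.isUnit_or_isUnit rfl with h | h
  · left; exact (Zsqrtd.isUnit_iff_norm_isUnit x).mpr h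
  · right; exact (Zsqrtd.isUnit_iff_norm_isUnit y).mpr h

lemma dvd_intCast_iff (hn : π.norm = p) (n : ℤ) : π ∣ (n : GaussianInt) ↔ (p : ℤ) ∣ n := by
  have hp : Prime (p : ℤ) := Nat.prime_iff_prime_int.mp Fact.out
  constructor
  · intro h
    have := norm_dvd_norm h
    rw [hn, Zsqrtd.norm_intCast] at this
    exact (hp.dvd_or_dvd this).elim id id
  · rintro ⟨k, rfl⟩
    push_cast
    exact (natCast_dvd_of_norm_eq hn).mul_right _

lemma dvd_intCast_iff_zmod (hn : π.norm = p) (n : ℤ) :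
    π ∣ (n : GaussianInt) ↔ (n : ZMod p) = 0 := by
  rw [dvd_intCast_iff hn, ZMod.intCast_zmod_eq_zero_iff_dvd]

/-- The quartic residue symbol modulo a prime `π` of norm `p`, as a character of `ℤ/p`. -/
noncomputable def quarticChar (hn : π.norm = p) (ho : Odd π.norm) : MulChar (ZMod p) GaussianInt where
  toFun t := quarticResidueSymbol ((t.val : ℤ) : GaussianInt) π
  map_one' := by
    have h1 : 1 < p := (Fact.out : p.Prime).one_lt
    have hπ := prime_of_norm_eq hn
    have : Fact (1 < p) := ⟨h1⟩
    have h2 := residueSymbol_eq_of_dvd (k := 0) hπ ho (α := 1)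
      (not_dvd_of_isCoprime hπ isCoprime_one_left) (by simp)
    simpa [ZMod.val_one] using h2
  map_mul' a b := by
    rw [← residueSymbol_mul (prime_of_norm_eq hn) ho]
    apply residueSymbol_congr
    rw [← Int.cast_mul, ← Int.cast_sub, dvd_intCast_iff_zmod hn]
    simp
  map_nonunit' a ha := by
    have : a = 0 := by
      by_contra h
      exact ha (isUnit_iff_ne_zero.mpr h)
    rw [this]
    apply residueSymbol_eq_zero
    simp

variable (hn : π.norm = p) (ho : Odd π.norm)

lemma quarticChar_intCast (n : ℤ) :
    quarticChar hn ho (n : ZMod p) = quarticResidueSymbol (n : GaussianInt) π := by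
  change quarticResidueSymbol _ π = _
  apply residueSymbol_congr
  rw [← Int.cast_sub, dvd_intCast_iff_zmod hn]
  simp

lemma quarticChar_eq_qlog {n : ℤ} (h : ¬ (p : ℤ) ∣ n) :
    quarticChar hn ho (n : ZMod p) = I ^ (qlog n π).val := by
  have hπ := prime_of_norm_eq hn
  rw [quarticChar_intCast, ← jacobi_prime _ hπ, jacobi_eq_I_pow_qlog ho]
  rw [← dvd_intCast_iff hn] at h
  exact ((hπ.irreducible.coprime_iff_not_dvd).mpr h).symm

lemma dvd_pow_sub_quarticChar (n : ℤ) :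
    π ∣ (n : GaussianInt) ^ ((p - 1) / 4) - quarticChar hn ho (n : ZMod p) := by
  have hπ := prime_of_norm_eq hn
  rw [quarticChar_intCast]
  by_cases h : π ∣ (n : GaussianInt)
  · rw [residueSymbol_eq_zero h, sub_zero]
    refine dvd_pow h ?_
    have := prime_mod_four hn ho
    have := (Fact.out : p.Prime).one_lt
    omega
  · obtain ⟨k, hk, hd⟩ := exists_residueSymbol hπ ho h
    rw [hk]
    rwa [hn, Int.natAbs_natCast] at hd

lemma quarticChar_pow_four : quarticChar hn ho ^ 4 = 1 := by
  apply MulChar.ext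
  intro a
  rw [MulChar.pow_apply' _ (by norm_num), MulChar.one_apply_coe]
  have h1 : (((a : ZMod p).val : ℤ) : ZMod p) = a := by simp
  have h2 : ¬ (p : ℤ) ∣ ((a : ZMod p).val : ℤ) := by
    rw [← ZMod.intCast_zmod_eq_zero_iff_dvd, h1]
    exact a.ne_zero
  rw [← h1, quarticChar_eq_qlog hn ho h2, ← pow_mul, mul_comm, pow_mul, I_pow_four, one_pow]

/-- Take a generator of the unit group: were its symbol ±1, its (p-1)/2-th power would be 1. This
makes the square of the character nontrivial. -/
lemma exists_quarticChar_sq : ∃ t : ZMod p, quarticChar hn ho t ^ 2 = -1 := by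
  have hπ := prime_of_norm_eq hn
  obtain ⟨g, hg⟩ := IsCyclic.exists_generator (α := (ZMod p)ˣ)
  have hog := orderOf_eq_card_of_forall_mem_zpowers hg
  rw [Nat.card_eq_fintype_card, ZMod.card_units] at hog
  refine ⟨g, ?_⟩
  have h1 : (((g : ZMod p).val : ℤ) : ZMod p) = g := by simp
  have h2 : ¬ (p : ℤ) ∣ ((g : ZMod p).val : ℤ) := by
    rw [← ZMod.intCast_zmod_eq_zero_iff_dvd, h1]
    exact g.ne_zero
  have h3 := quarticChar_eq_qlog hn ho h2
  have h4 := dvd_pow_sub_quarticChar hn ho ((g : ZMod p).val : ℤ)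
  rw [h1] at h3 h4
  rw [h3] at h4 ⊢
  set k := (qlog (((g : ZMod p).val : ℤ) : GaussianInt) π).val
  rw [← pow_mul, mul_comm, pow_mul, I_sq]
  rcases Nat.even_or_odd k with hk | hk
  · exfalso
    obtain ⟨j, hj⟩ := hk
    have h5 : π ∣ ((((g : ZMod p).val : ℤ) ^ ((p - 1) / 2) - 1 : ℤ) : GaussianInt) := by
      have h6 : I ^ k * I ^ k = 1 := by
        rw [← pow_add, hj, show j + j + (j + j) = 4 * j by ring, pow_mul, I_pow_four, one_pow]
      have h7 : (p - 1) / 2 = (p - 1) / 4 + (p - 1) / 4 := by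
        have := prime_mod_four hn ho
        omega
      have h8 : ((((g : ZMod p).val : ℤ) ^ ((p - 1) / 2) - 1 : ℤ) : GaussianInt) =
          ((((g : ZMod p).val : ℤ) : GaussianInt) ^ ((p - 1) / 4) - I ^ k) *
          ((((g : ZMod p).val : ℤ) : GaussianInt) ^ ((p - 1) / 4) + I ^ k) := by
        push_cast
        rw [h7, pow_add]
        linear_combination h6
      rw [h8]
      exact h4.mul_right _
    rw [dvd_intCast_iff_zmod hn] at h5
    push_cast at h5
    simp only [ZMod.natCast_val, ZMod.cast_id', id_eq, sub_eq_zero] at h5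
    have h6 : g ^ ((p - 1) / 2) = 1 := by
      ext; simpa using h5
    have h7 := Nat.le_of_dvd ?_ (orderOf_dvd_of_pow_eq_one h6)
    · have := prime_mod_four hn ho
      have := (Fact.out : p.Prime).one_lt
      omega
    · have := prime_mod_four hn ho
      have := (Fact.out : p.Prime).one_lt
      omega
  · exact hk.neg_one_pow

/-- The quartic Jacobi sum over `ℤ/p`. -/
noncomputable def quarticJacobiSum (hn : π.norm = p) (ho : Odd π.norm) : GaussianInt :=
  jacobiSum (quarticChar hn ho) (quarticChar hn ho)

/-- The binomial expansion contains only exponents up to 2m < p - 1, and those power sums vanish in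
ℤ/p. -/
lemma sum_pow_mul_one_sub_pow {m : ℕ} (hm : 2 * m < p - 1) :
    ∑ t : ZMod p, t ^ m * (1 - t) ^ m = 0 := by
  have : ∀ t : ZMod p, t ^ m * (1 - t) ^ m =
      ∑ j ∈ Finset.range (m + 1), (-1) ^ (m - j) * (m.choose j : ZMod p) * t ^ (m + (m - j)) := by
    intro t
    rw [sub_eq_add_neg, add_pow, Finset.mul_sum]
    refine Finset.sum_congr rfl fun j _ => ?_
    rw [neg_pow t, one_pow, pow_add]; ring
  simp_rw [this]
  rw [Finset.sum_comm]
  refine Finset.sum_eq_zero fun j _ => ?_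
  rw [← Finset.mul_sum, FiniteField.sum_pow_lt_card_sub_one, mul_zero]
  rw [ZMod.card]
  omega

/-- Modulo π the character is t ↦ t^((p-1)/4), so the Jacobi sum reduces to a power sum of degree
below p - 1. -/
lemma dvd_quarticJacobiSum : π ∣ quarticJacobiSum hn ho := by
  have h4 := prime_mod_four hn ho
  have h1 := (Fact.out : p.Prime).one_lt
  set m := (p - 1) / 4 with hm
  have h2 : π ∣ ((∑ t : ZMod p, (t.val : ℤ) ^ m * (1 - (t.val : ℤ)) ^ m : ℤ) : GaussianInt) := by
    rw [dvd_intCast_iff_zmod hn]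
    push_cast
    simp only [ZMod.natCast_val, ZMod.cast_id', id_eq]
    exact sum_pow_mul_one_sub_pow (by omega)
  have h3 : π ∣ ((∑ t : ZMod p, (t.val : ℤ) ^ m * (1 - (t.val : ℤ)) ^ m : ℤ) : GaussianInt) -
      quarticJacobiSum hn ho := by
    rw [quarticJacobiSum, jacobiSum]
    push_cast
    rw [← Finset.sum_sub_distrib]
    refine Finset.dvd_sum fun t _ => ?_
    have h5 := dvd_pow_sub_quarticChar hn ho (t.val : ℤ)
    have h6 := dvd_pow_sub_quarticChar hn ho (1 - (t.val : ℤ))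
    push_cast at h5 h6
    simp only [ZMod.natCast_val, ZMod.cast_id', id_eq] at h5 h6
    have h7 := dvd_add (h5.mul_right ((1 - (t.val : GaussianInt)) ^ m))
      (h6.mul_left (quarticChar hn ho t))
    convert h7 using 1
    simp only [ZMod.natCast_val]
    ring
  exact (dvd_iff_of_dvd_sub h3).mp h2

lemma isPrimitiveRoot_I : IsPrimitiveRoot I 4 := by
  rw [IsPrimitiveRoot.iff_def]
  refine ⟨I_pow_four, fun l hl => ?_⟩
  have h := unitLog_I_pow l
  rw [hl] at h
  have h0 := unitLog_I_pow 0
  rw [pow_zero, h] at h0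
  exact (ZMod.natCast_eq_zero_iff l 4).mp (by simpa using h0)

/-- The Jacobi sum is ≡ -1 modulo (i - 1)² = -2i. -/
lemma even_im_quarticJacobiSum : Even (quarticJacobiSum hn ho).im := by
  obtain ⟨z, -, hz⟩ := exists_jacobiSum_eq_neg_one_add (n := 4) (by norm_num)
    (quarticChar_pow_four hn ho) (quarticChar_pow_four hn ho)
    (by rw [ZMod.card]; have := prime_mod_four hn ho; omega) isPrimitiveRoot_I
  rw [quarticJacobiSum, hz, show (I - 1) ^ 2 = -2 * I by linear_combination I_mul_I]
  refine ⟨-z.re, ?_⟩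
  simp [I]
  ring

/-- The square of the character takes the value -1, which differs from 1 in K. Needed over ℂ for the
norm of the Jacobi sum and in characteristic l for Frobenius. -/
lemma quarticChar_complex_ne_one {K : Type*} [Field K] (h2 : (2 : K) ≠ 0)
    (φ : GaussianInt →+* K) : (quarticChar hn ho).ringHomComp φ ≠ 1 ∧
      (quarticChar hn ho).ringHomComp φ * (quarticChar hn ho).ringHomComp φ ≠ 1 := by
  obtain ⟨t, ht⟩ := exists_quarticChar_sq hn ho
  have key : (quarticChar hn ho).ringHomComp φ * (quarticChar hn ho).ringHomComp φ ≠ 1 := by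
    intro h
    have ht0 : IsUnit t := by
      rw [isUnit_iff_ne_zero]
      rintro rfl
      rw [MulChar.map_zero] at ht
      simp at ht
    have h3 := DFunLike.congr_fun h t
    rw [MulChar.mul_apply, MulChar.ringHomComp_apply, ← map_mul, ← sq, ht,
      MulChar.one_apply ht0, map_neg, map_one] at h3
    apply h2
    linear_combination -h3
  exact ⟨fun h => key (by rw [h, one_mul]), key⟩

/-- Over ℂ the inverse character is the complex conjugate, so J(χ,χ)·J(χ⁻¹,χ⁻¹) = p is a statement
on norms. -/
lemma norm_quarticJacobiSum : (quarticJacobiSum hn ho).norm = p := by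
  have h4 := prime_mod_four hn ho
  set χ := (quarticChar hn ho).ringHomComp toComplex with hχ
  obtain ⟨h1, h2⟩ := quarticChar_complex_ne_one hn ho (two_ne_zero : (2 : ℂ) ≠ 0) toComplex
  have h3 : ringChar ℂ ≠ ringChar (ZMod p) := by
    rw [ringChar.eq_zero, ZMod.ringChar_zmod_n]
    exact (Fact.out : p.Prime).ne_zero.symm
  have h5 := jacobiSum_mul_jacobiSum_inv h3 h1 h1 h2
  have h6 : jacobiSum χ⁻¹ χ⁻¹ = star (jacobiSum χ χ) := by
    rw [← MulChar.star_eq_inv]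
    simp [jacobiSum, MulChar.star_apply, star_sum]
  rw [h6, jacobiSum_ringHomComp, ZMod.card] at h5
  have h7 : (star (toComplex (jacobiSum (quarticChar hn ho) (quarticChar hn ho)))) =
      toComplex (star (quarticJacobiSum hn ho)) := by
    rw [toComplex_star]; rfl
  rw [h7, ← map_mul] at h5
  change toComplex (quarticJacobiSum hn ho * star (quarticJacobiSum hn ho)) = _ at h5
  rw [← Zsqrtd.norm_eq_mul_conj, map_intCast] at h5
  exact_mod_cast h5

/-- π divides the Jacobi sum and the norms agree, so the quotient δ is a unit. Both elements have
even imaginary part and π has odd real part, which forces δ = ±1; squaring removes the sign. -/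
lemma quarticJacobiSum_sq (him : Even π.im) : quarticJacobiSum hn ho ^ 2 = π ^ 2 := by
  obtain ⟨δ, hδ⟩ := dvd_quarticJacobiSum hn ho
  have h1 := norm_quarticJacobiSum hn ho
  rw [hδ, Zsqrtd.norm_mul, hn] at h1
  have hp : (p : ℤ) ≠ 0 := by exact_mod_cast (Fact.out : p.Prime).ne_zero
  have h2 : δ.norm = 1 := by
    have : (p : ℤ) * δ.norm = p * 1 := by rw [h1, mul_one]
    exact mul_left_cancel₀ hp this
  have h3 := even_im_quarticJacobiSum hn ho
  rw [hδ] at h3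
  rw [norm_eq_sq] at h2
  have hre : Odd π.re := by
    rw [norm_eq_sq] at ho
    have := Int.even_pow.mpr ⟨him, two_ne_zero⟩
    have h5 : Odd (π.re ^ 2) := by
      rcases Int.even_or_odd (π.re ^ 2) with h | h
      · exact absurd (h.add this) (Int.not_even_iff_odd.mpr ho)
      · exact h
    exact (Int.odd_pow.mp h5).resolve_right two_ne_zero
  have h4 : Even δ.im := by
    rw [Zsqrtd.im_mul] at h3
    have h5 : Even (π.re * δ.im) := by
      have := h3.sub (him.mul_right δ.re)
      simpa using this
    exact (Int.even_mul.mp h5).resolve_left (Int.not_even_iff_odd.mpr hre)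
  have h5 : δ.im = 0 := by
    obtain ⟨k, hk⟩ := h4
    have : δ.im ^ 2 ≤ 1 := by nlinarith [sq_nonneg δ.re]
    have h6 : k = 0 := by
      rw [hk] at this
      have : k ^ 2 < 1 := by nlinarith
      nlinarith [sq_nonneg k, pow_eq_zero_iff (two_ne_zero) |>.mp (le_antisymm (by omega) (sq_nonneg k))]
    rw [hk, h6]; rfl
  have h6 : δ ^ 2 = 1 := by
    rw [h5] at h2
    ext
    · simp [sq, h5]; nlinarith
    · simp [sq, h5]
  rw [hδ, mul_pow, h6, mul_one]

end QuarticChar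

/-! ### Gauss sums and rational reciprocity for primes -/

section GaussSum

variable {p : ℕ} [Fact p.Prime] {π : GaussianInt} (hn : π.norm = p) (ho : Odd π.norm)
  {K : Type*} [Field K] (φ : GaussianInt →+* K)

/-- G(χ)² = J(χ,χ)·G(χ²), and G(χ²)² = p because χ²(-1) = 1. Now use J² = π² and p = ππ̄. -/
lemma quarticGaussSum_pow_four (h2 : (2 : K) ≠ 0) (him : Even π.im) {ψ : AddChar (ZMod p) K}
    (hψ : ψ.IsPrimitive) :
    gaussSum ((quarticChar hn ho).ringHomComp φ) ψ ^ 4 = φ π ^ 3 * φ (star π) := by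
  obtain ⟨h1, h3⟩ := quarticChar_complex_ne_one hn ho h2 φ
  set χ := (quarticChar hn ho).ringHomComp φ with hχ
  have h4 := jacobiSum_mul_nontrivial h3 ψ
  have hχ4 : χ ^ 4 = 1 := by
    rw [hχ, MulChar.ringHomComp_pow, quarticChar_pow_four, MulChar.ringHomComp_one]
  have hquad : (χ * χ).IsQuadratic := by
    intro a
    by_cases ha : IsUnit a
    · right
      have : (χ a) ^ 4 = 1 := by
        rw [← MulChar.pow_apply' _ (by norm_num), hχ4, MulChar.one_apply ha]
      rw [MulChar.mul_apply, ← sq, ← sq_eq_one_iff, ← pow_mul, this]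
    · left; exact MulChar.map_nonunit _ ha
  have h5 := gaussSum_sq h3 hquad hψ
  have h6 : (χ * χ) (-1) = 1 := by
    rw [MulChar.mul_apply, ← map_mul, neg_mul_neg, one_mul, map_one]
  rw [h6, one_mul, ZMod.card] at h5
  rw [jacobiSum_ringHomComp] at h4
  have h7 : φ (jacobiSum (quarticChar hn ho) (quarticChar hn ho)) ^ 2 = φ π ^ 2 := by
    rw [← map_pow, ← map_pow, ← quarticJacobiSum_sq hn ho him]; rfl
  have h8 : (p : K) = φ π * φ (star π) := by
    rw [← map_mul, ← Zsqrtd.norm_eq_mul_conj, hn, map_intCast, Int.cast_natCast]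
  rw [h8] at h5
  calc gaussSum χ ψ ^ 4 = (gaussSum χ ψ * gaussSum χ ψ) ^ 2 := by ring
    _ = gaussSum (χ * χ) ψ ^ 2 * φ (jacobiSum (quarticChar hn ho) (quarticChar hn ho)) ^ 2 := by
      rw [← h4, mul_pow]
    _ = _ := by rw [h5, h7]; ring

lemma exists_primitive_addChar [IsAlgClosed K] (hp : (p : K) ≠ 0) :
    ∃ ψ : AddChar (ZMod p) K, ψ.IsPrimitive := by
  have : NeZero (p : K) := ⟨hp⟩
  obtain ⟨ζ, hζ⟩ := HasEnoughRootsOfUnity.exists_primitiveRoot K p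
  exact ⟨_, AddChar.zmodChar_primitive_of_primitive_root p hζ⟩

/-- Here χ^l = χ, so Frobenius sends the Gauss sum G to its twist χ(l)⁻¹G; cancel G, which is
nonzero in characteristic l ≠ p. -/
lemma quarticChar_mul_pow_of_mod_one [IsAlgClosed K] {l : ℕ} [Fact l.Prime] [CharP K l]
    (hl : l % 4 = 1) (hlp : l ≠ p) (him : Even π.im) :
    φ (quarticChar hn ho (l : ZMod p)) * (φ π ^ 3 * φ (star π)) ^ ((l - 1) / 4) = 1 := by
  have hp : (p : K) ≠ 0 := by
    rw [Ne, CharP.cast_eq_zero_iff K l, Nat.prime_dvd_prime_iff_eq Fact.out Fact.out]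
    exact hlp
  have h2 : (2 : K) ≠ 0 := by
    rw [show (2 : K) = ((2 : ℕ) : K) by simp, Ne, CharP.cast_eq_zero_iff K l,
      Nat.prime_dvd_prime_iff_eq Fact.out Nat.prime_two]
    rintro rfl; omega
  obtain ⟨ψ, hψ⟩ := exists_primitive_addChar (K := K) hp
  rw [← quarticGaussSum_pow_four hn ho φ h2 him hψ, ← pow_mul]
  set χ := (quarticChar hn ho).ringHomComp φ with hχ
  have hχ4 : χ ^ 4 = 1 := by
    rw [hχ, MulChar.ringHomComp_pow, quarticChar_pow_four, MulChar.ringHomComp_one]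
  have hχl : χ ^ l = χ := by
    conv_lhs => rw [← Nat.div_add_mod l 4, hl, pow_add, pow_mul, hχ4, one_pow, one_mul, pow_one]
  have hg : gaussSum χ ψ ≠ 0 := gaussSum_ne_zero_of_nontrivial (by rwa [ZMod.card])
    (quarticChar_complex_ne_one hn ho h2 φ).1 hψ
  have hlu : IsUnit (l : ZMod p) := by
    rw [isUnit_iff_ne_zero, Ne, ZMod.natCast_eq_zero_iff, Nat.prime_dvd_prime_iff_eq Fact.out Fact.out]
    exact hlp.symm
  have hfrob := gaussSum_frob l χ ψ
  rw [hχl, AddChar.pow_mulShift] at hfrob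
  have hshift := gaussSum_mulShift χ ψ hlu.unit
  rw [hlu.unit_spec, ← hfrob] at hshift
  have h3 : 4 * ((l - 1) / 4) + 1 = l := by
    have := (Fact.out : l.Prime).one_lt
    omega
  apply mul_right_cancel₀ hg
  rw [one_mul, mul_assoc, ← pow_succ, h3]
  exact hshift

/-- Here χ^l = χ⁻¹, so G^l is a multiple of the Gauss sum of χ⁻¹, whose product with G is p up to
the sign χ(-1). This is why the exponent is l + 1 and the argument is -l. -/
lemma pow_eq_quarticChar_of_mod_three [IsAlgClosed K] {l : ℕ} [Fact l.Prime] [CharP K l]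
    (hl : l % 4 = 3) (hlp : l ≠ p) (him : Even π.im) :
    (φ π ^ 3 * φ (star π)) ^ ((l + 1) / 4) =
      φ (quarticChar hn ho (-(l : ZMod p))) * (φ π * φ (star π)) := by
  have hp : (p : K) ≠ 0 := by
    rw [Ne, CharP.cast_eq_zero_iff K l, Nat.prime_dvd_prime_iff_eq Fact.out Fact.out]
    exact hlp
  have h2 : (2 : K) ≠ 0 := by
    rw [show (2 : K) = ((2 : ℕ) : K) by simp, Ne, CharP.cast_eq_zero_iff K l,
      Nat.prime_dvd_prime_iff_eq Fact.out Nat.prime_two]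
    rintro rfl; omega
  obtain ⟨ψ, hψ⟩ := exists_primitive_addChar (K := K) hp
  rw [← quarticGaussSum_pow_four hn ho φ h2 him hψ, ← pow_mul]
  have hne := (quarticChar_complex_ne_one hn ho h2 φ).1
  rw [← MulChar.ringHomComp_apply]
  set χ := (quarticChar hn ho).ringHomComp φ with hχ
  have hχ4 : χ ^ 4 = 1 := by
    rw [hχ, MulChar.ringHomComp_pow, quarticChar_pow_four, MulChar.ringHomComp_one]
  have hχl : χ ^ l = χ⁻¹ := by
    apply eq_inv_of_mul_eq_one_left
    rw [← pow_succ, show l + 1 = 4 * (l / 4 + 1) by omega, pow_mul, hχ4, one_pow]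
  have hlu : IsUnit (l : ZMod p) := by
    rw [isUnit_iff_ne_zero, Ne, ZMod.natCast_eq_zero_iff, Nat.prime_dvd_prime_iff_eq Fact.out Fact.out]
    exact hlp.symm
  have hfrob := gaussSum_frob l χ ψ
  rw [hχl, AddChar.pow_mulShift] at hfrob
  have hshift := gaussSum_mulShift χ⁻¹ ψ hlu.unit
  rw [hlu.unit_spec, ← hfrob] at hshift
  have hprod := gaussSum_mul_gaussSum_eq_card hne hψ
  have hinv := mul_gaussSum_inv_eq_gaussSum χ⁻¹ ψ
  have hm1 : χ (-1) * χ⁻¹ (-1) = 1 := by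
    rw [← MulChar.mul_apply, mul_inv_cancel, MulChar.one_apply isUnit_one.neg]
  have hl1 : χ l * χ⁻¹ l = 1 := by
    rw [← MulChar.mul_apply, mul_inv_cancel, MulChar.one_apply hlu]
  have h8 : (p : K) = φ π * φ (star π) := by
    rw [← map_mul, ← Zsqrtd.norm_eq_mul_conj, hn, map_intCast, Int.cast_natCast]
  rw [ZMod.card, h8] at hprod
  rw [show 4 * ((l + 1) / 4) = l + 1 by omega, pow_succ, neg_eq_neg_one_mul, map_mul, ← hprod]
  set G := gaussSum χ ψ
  set G' := gaussSum χ⁻¹ ψ⁻¹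
  have e1 : χ⁻¹ l * G ^ l = χ⁻¹ (-1) * G' := by rw [hshift, hinv]
  have e2 : G ^ l = χ l * (χ⁻¹ (-1) * G') := by rw [← e1, ← mul_assoc, hl1, one_mul]
  have e3 : χ⁻¹ (-1) = χ (-1) := by
    have h9 : χ (-1) * χ (-1) = 1 := by rw [← map_mul, neg_mul_neg, one_mul, map_one]
    have h10 : χ (-1) ≠ 0 := fun h => by rw [h, zero_mul] at h9; exact zero_ne_one h9
    exact mul_left_cancel₀ h10 (hm1.trans h9.symm)
  rw [e2, e3]; ring

end GaussSum

/-! ### Residue fields -/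

section ResidueField

variable (π : GaussianInt)

/-- Reduction modulo a prime, with values in an algebraic closure of the residue field. -/
lemma exists_reduction {π : GaussianInt} (hπ : Prime π) {l : ℕ} [Fact l.Prime]
    (hl : π ∣ (l : GaussianInt)) :
    ∃ (K : Type) (_ : Field K) (_ : IsAlgClosed K) (_ : CharP K l) (φ : GaussianInt →+* K),
      ∀ z, φ z = 0 ↔ π ∣ z := by
  have h1 : (Ideal.span {π}).IsPrime := (Ideal.span_singleton_prime hπ.ne_zero).mpr hπ
  have hm : (Ideal.span {π}).IsMaximal :=
    Ideal.IsPrime.isMaximal h1 (by simpa using hπ.ne_zero)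
  let _ := Ideal.Quotient.field (Ideal.span {π})
  let φ : GaussianInt →+* AlgebraicClosure (GaussianInt ⧸ Ideal.span {π}) :=
    (algebraMap _ _).comp (Ideal.Quotient.mk (Ideal.span {π}))
  have hφ : ∀ z, φ z = 0 ↔ π ∣ z := by
    intro z
    rw [RingHom.comp_apply, FaithfulSMul.algebraMap_eq_zero_iff,
      Ideal.Quotient.eq_zero_iff_mem, Ideal.mem_span_singleton]
  have hc : CharP (AlgebraicClosure (GaussianInt ⧸ Ideal.span {π})) l := by
    apply ringChar.of_eq
    have h0 : ((l : ℕ) : AlgebraicClosure (GaussianInt ⧸ Ideal.span {π})) = 0 := by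
      rw [← map_natCast φ, hφ]; exact hl
    exact ((Nat.dvd_prime Fact.out).mp (ringChar.dvd h0)).resolve_left CharP.ringChar_ne_one
  exact ⟨_, inferInstance, inferInstance, hc, φ, hφ⟩

end ResidueField

/-! ### Reciprocity between a Gaussian prime of prime norm and a rational prime -/

lemma isCoprime_of_not_dvd {π α : GaussianInt} (hπ : Prime π) (h : ¬ π ∣ α) : IsCoprime α π :=
  (hπ.irreducible.coprime_iff_not_dvd.mpr h).symm

lemma not_dvd_of_norm_prime_ne {p l : ℕ} [Fact p.Prime] [Fact l.Prime] {π : GaussianInt}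
    (hn : π.norm = p) (hlp : l ≠ p) {z : GaussianInt} (hz : z ∣ (l : GaussianInt))
    (hzu : ¬ IsUnit z) : ¬ z ∣ π := by
  intro h
  have h1 : z ∣ (p : GaussianInt) := h.trans (natCast_dvd_of_norm_eq hn)
  have h2 : IsCoprime (l : ℤ) (p : ℤ) := by
    rw [Nat.isCoprime_iff_coprime, Nat.coprime_primes Fact.out Fact.out]; exact hlp
  obtain ⟨u, v, huv⟩ := h2
  apply hzu
  apply isUnit_of_dvd_one
  have h3 : ((u * l + v * p : ℤ) : GaussianInt) = 1 := by rw [huv]; simp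
  rw [← h3]; push_cast
  exact dvd_add (hz.mul_left _) (h1.mul_left _)

/-- Rational reciprocity between a prime of prime norm and an inert rational prime. -/
lemma qlog_neg_inert_eq {p l : ℕ} [Fact p.Prime] [Fact l.Prime] {π : GaussianInt}
    (hn : π.norm = p) (ho : Odd π.norm) (him : Even π.im) (hl : l % 4 = 3) (hlp : l ≠ p) :
    qlog ((-(l : ℤ) : ℤ) : GaussianInt) π = qlog π (l : GaussianInt) := by
  have hlP : Prime (l : GaussianInt) := prime_of_nat_prime_of_mod_four_eq_three l hl
  obtain ⟨K, _, _, _, φ, hφ⟩ := exists_reduction hlP (dvd_refl _)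
  have hol : Odd (l : GaussianInt).norm := by
    rw [Zsqrtd.norm_natCast]
    have : Odd (l : ℤ) := by rw [Int.odd_iff]; omega
    exact this.mul this
  have key := pow_eq_quarticChar_of_mod_three hn ho φ (l := l) hl hlp him
  -- Since i^l = -i, Frobenius modulo an inert l is conjugation; thus π³π̄ becomes π^(3+l).
  have hstar : φ (star π) = φ π ^ l := by
    have h1 : π = ((π.re : ℤ) : GaussianInt) + (π.im : ℤ) * I := by ext <;> simp [I]
    have h2 : star π = ((π.re : ℤ) : GaussianInt) - (π.im : ℤ) * I := by ext <;> simp [I]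
    have h3 : I ^ l = -I := by rw [I_pow_mod, hl, I_pow_three]
    have hint : ∀ n : ℤ, (n : K) ^ l = n := by
      intro n
      have : ((n : ZMod l) ^ l) = n := ZMod.pow_card _
      have h5 := congrArg (ZMod.castHom (dvd_refl l) K) this
      rwa [map_pow, map_intCast] at h5
    rw [h2]
    conv_rhs => rw [h1]
    rw [map_add, map_sub, map_mul, add_pow_char, mul_pow, map_intCast, map_intCast, hint, hint,
      ← map_pow, h3, map_neg]
    ring
  have hπl : ¬ (l : GaussianInt) ∣ π := not_dvd_of_norm_prime_ne hn hlp dvd_rfl hlP.not_isUnit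
  have hφπ : φ π ≠ 0 := fun h => hπl ((hφ π).mp h)
  have hnl : ¬ (p : ℤ) ∣ -(l : ℤ) := by
    rw [dvd_neg, Int.natCast_dvd_natCast, Nat.prime_dvd_prime_iff_eq Fact.out Fact.out]
    exact hlp.symm
  have hq := quarticChar_eq_qlog hn ho hnl
  push_cast at hq
  rw [hq, hstar] at key
  have hd := dvd_pow_sub_I_pow_qlog hlP hol (isCoprime_of_not_dvd hlP hπl)
  rw [← hφ, map_sub, map_pow, sub_eq_zero, Zsqrtd.norm_natCast] at hd
  -- The exponent (l² - 1)/4 defines the symbol modulo l, and the extra l + 1 comes from the factor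
  -- ππ̄ = π^(l+1) on the right.
  have hN : (((l : ℤ) * l).natAbs - 1) / 4 + (l + 1) = (3 + l) * ((l + 1) / 4) := by
    rw [show ((l : ℤ) * l).natAbs = l * l by simp [Int.natAbs_mul]]
    obtain ⟨j, rfl⟩ : ∃ j, l = 4 * j + 3 := ⟨l / 4, by omega⟩
    rw [show (4 * j + 3 + 1) / 4 = j + 1 by omega,
      show (4 * j + 3) * (4 * j + 3) - 1 = 4 * (4 * j * j + 6 * j + 2) by
        rw [Nat.sub_eq_iff_eq_add (by nlinarith)]; ring,
      Nat.mul_div_cancel_left _ (by norm_num)]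
    ring
  have e1 : φ π ^ ((((l : ℤ) * l).natAbs - 1) / 4) * φ π ^ (l + 1) =
      φ (I ^ (qlog (-(l : GaussianInt)) π).val) * φ π ^ (l + 1) := by
    rw [← pow_add, hN, pow_mul, pow_add, key]; ring
  have e2 := mul_right_cancel₀ (pow_ne_zero _ hφπ) e1
  rw [hd] at e2
  have e3 : (l : GaussianInt) ∣ I ^ (qlog π (l : GaussianInt)).val -
      I ^ (qlog (-(l : GaussianInt)) π).val := by
    rw [← hφ, map_sub, e2, sub_self]
  have e4 := eq_of_dvd_I_pow_sub hlP hol e3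
  push_cast
  simpa using e4.symm

/-- Rational reciprocity between a prime of prime norm and a split rational prime. -/
lemma qlog_split_eq {p l : ℕ} [Fact p.Prime] [Fact l.Prime] {π : GaussianInt}
    (hn : π.norm = p) (ho : Odd π.norm) (him : Even π.im) (hl : l % 4 = 1) (hlp : l ≠ p) :
    qlog (l : GaussianInt) π = qlog π (l : GaussianInt) := by
  obtain ⟨a, b, hab⟩ := Nat.Prime.sq_add_sq (p := l) (by omega)
  set ρ : GaussianInt := ⟨a, b⟩ with hρ
  have hρn : ρ.norm = l := by
    rw [norm_eq_sq, hρ]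
    simp only
    exact_mod_cast hab
  have hρP := prime_of_norm_eq hρn
  have hoρ : Odd ρ.norm := by rw [hρn, Int.odd_iff]; omega
  have hlρ : (l : GaussianInt) = ρ * star ρ := by
    rw [← Zsqrtd.norm_eq_mul_conj, hρn, Int.cast_natCast]
  have hρd : ρ ∣ (l : GaussianInt) := natCast_dvd_of_norm_eq hρn
  obtain ⟨K, _, _, _, φ, hφ⟩ := exists_reduction hρP hρd
  have key := quarticChar_mul_pow_of_mod_one hn ho φ (l := l) hl hlp him
  have hρπ : ¬ ρ ∣ π := not_dvd_of_norm_prime_ne hn hlp hρd hρP.not_isUnit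
  have hρπ' : ¬ ρ ∣ star π := not_dvd_of_norm_prime_ne (π := star π)
    (by rw [Zsqrtd.norm_conj, hn]) hlp hρd hρP.not_isUnit
  have hc1 := isCoprime_of_not_dvd hρP hρπ
  have hc2 := isCoprime_of_not_dvd hρP hρπ'
  have hnl : ¬ (p : ℤ) ∣ (l : ℤ) := by
    rw [Int.natCast_dvd_natCast, Nat.prime_dvd_prime_iff_eq Fact.out Fact.out]
    exact hlp.symm
  have hq := quarticChar_eq_qlog hn ho hnl
  push_cast at hq
  have hd1 := dvd_pow_sub_I_pow_qlog hρP hoρ hc1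
  have hd2 := dvd_pow_sub_I_pow_qlog hρP hoρ hc2
  rw [← hφ, map_sub, map_pow, sub_eq_zero, hρn, Int.natAbs_natCast] at hd1 hd2
  rw [hq, mul_pow, ← pow_mul, mul_comm 3, pow_mul, hd1, hd2, ← map_pow, ← map_mul, ← map_mul,
    ← pow_mul, ← pow_add, ← pow_add] at key
  have e3 : ρ ∣ I ^ ((qlog (l : GaussianInt) π).val + ((qlog π ρ).val * 3 + (qlog (star π) ρ).val))
      - I ^ 0 := by
    rw [← hφ, map_sub, key]; simp
  have e4 := eq_of_dvd_I_pow_sub hρP hoρ e3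
  push_cast at e4
  rw [ZMod.natCast_zmod_val, ZMod.natCast_zmod_val, ZMod.natCast_zmod_val] at e4
  -- Conjugation turns the π̄-factor modulo ρ into a symbol of π modulo ρ̄; as 3 = -1, the two terms
  -- combine to the symbol modulo l = ρρ̄.
  have e5 : qlog (star π) ρ = -qlog π (star ρ) := by
    have h1 := isCoprime_star hc2
    rw [star_star] at h1
    have h2 := qlog_star (odd_norm_star.mpr hoρ) h1
    rwa [star_star] at h2
  have hc3 : IsCoprime π (star ρ) := by
    have h1 := isCoprime_star hc2
    rwa [star_star] at h1
  rw [hlρ, qlog_mul_right hoρ (odd_norm_star.mpr hoρ) (hc1.mul_right hc3), ← hlρ]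
  rw [e5, show (3 : ZMod 4) = -1 from rfl] at e4
  linear_combination e4

/-! ### Rational moduli -/

lemma isCoprime_intCast {m n : ℤ} :
    IsCoprime (m : GaussianInt) (n : GaussianInt) ↔ IsCoprime m n := by
  constructor
  · rintro ⟨u, v, h⟩
    refine ⟨u.re, v.re, ?_⟩
    have := congrArg Zsqrtd.re h
    simpa using this
  · rintro ⟨u, v, h⟩
    exact ⟨u, v, by exact_mod_cast congrArg (Int.cast (R := GaussianInt)) h⟩

lemma odd_norm_intCast {n : ℤ} : Odd (n : GaussianInt).norm ↔ Odd n := by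
  rw [Zsqrtd.norm_intCast, Int.odd_mul, and_self]

lemma odd_int_induction {P : ℤ → Prop} (h1 : P 1) (hneg : ∀ n, Odd n → P n → P (-n))
    (hp : ∀ (l : ℕ) (n : ℤ), l.Prime → Odd (l : ℤ) → Odd n → P n → P (l * n))
    {n : ℤ} (h : Odd n) : P n := by
  have key : ∀ k : ℕ, Odd (k : ℤ) → P k := by
    intro k
    induction k using Nat.recOnMul with
    | zero => intro h; simp at h
    | one => intro _; simpa using h1
    | prime l hl =>
      intro ho
      have := hp l 1 hl ho odd_one h1
      rwa [mul_one] at this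
    | mul a b iha ihb =>
      -- `hp` multiplies by one prime at a time; here it is strengthened to any odd natural number.
      have : ∀ a : ℕ, Odd (a : ℤ) → ∀ m : ℤ, Odd m → P m → P (a * m) := by
        intro a
        induction a using Nat.recOnMul with
        | zero => intro h; simp at h
        | one => intro _ m _ hm; simpa using hm
        | prime l hl => intro ho m hom hm; exact hp l m hl ho hom hm
        | mul a b iha ihb =>
          intro ho m hom hm
          push_cast at ho ⊢
          rw [Int.odd_mul] at ho
          rw [mul_assoc]
          exact iha ho.1 _ (ho.2.mul hom) (ihb ho.2 m hom hm)
      intro ho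
      push_cast at ho ⊢
      rw [Int.odd_mul] at ho
      exact this a ho.1 b ho.2 (ihb ho.2)
  rcases Int.natAbs_eq n with hn | hn
  · rw [hn]; apply key; rwa [← hn]
  · rw [hn]
    have : Odd (n.natAbs : ℤ) := by rw [hn, odd_neg] at h; exact h
    exact hneg _ this (key _ this)

lemma associated_neg_intCast (n : ℤ) :
    Associated ((-n : ℤ) : GaussianInt) (n : GaussianInt) := by
  push_cast
  exact (Associated.refl _).neg_left

lemma exists_split {l : ℕ} [Fact l.Prime] (hl : l % 4 = 1) :
    ∃ ρ : GaussianInt, ρ.norm = l ∧ Prime ρ ∧ Odd ρ.norm ∧ (l : GaussianInt) = ρ * star ρ := by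
  obtain ⟨a, b, hab⟩ := Nat.Prime.sq_add_sq (p := l) (by omega)
  have hρn : (⟨a, b⟩ : GaussianInt).norm = l := by
    rw [norm_eq_sq]
    simp only
    exact_mod_cast hab
  refine ⟨⟨a, b⟩, hρn, prime_of_norm_eq hρn, by rw [hρn, Int.odd_iff]; omega, ?_⟩
  rw [← Zsqrtd.norm_eq_mul_conj, hρn, Int.cast_natCast]

/-- The symbol of α modulo ρ̄ is minus that of ᾱ modulo ρ. For rational α the two terms cancel. -/
lemma qlog_self_add_star {ρ α : GaussianInt} (ho : Odd ρ.norm)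
    (hc : IsCoprime α (ρ * star ρ)) :
    qlog α (ρ * star ρ) = qlog α ρ - qlog (star α) ρ := by
  rw [qlog_mul_right ho (odd_norm_star.mpr ho) hc]
  have h1 := isCoprime_star hc.of_mul_right_right
  rw [star_star] at h1
  have := qlog_star ho h1
  rw [star_star] at this
  rw [this]; ring

lemma star_intCast (n : ℤ) : star (n : GaussianInt) = n := by
  ext <;> simp

lemma odd_prime_mod_four {l : ℕ} (h : Odd (l : ℤ)) : l % 4 = 1 ∨ l % 4 = 3 := by
  rw [Int.odd_iff] at h; omega

/-- A rational integer is a quartic residue modulo every coprime odd rational integer. -/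
lemma qlog_intCast_intCast {m n : ℤ} (hn : Odd n) (hc : IsCoprime m n) :
    qlog (m : GaussianInt) (n : GaussianInt) = 0 := by
  revert hc
  refine odd_int_induction (P := fun n => IsCoprime m n → qlog (m : GaussianInt) n = 0)
    ?_ ?_ ?_ hn
  · intro _; exact qlog_unit_right _ (by simp)
  · intro n _ ih hc
    rw [qlog_associated (associated_neg_intCast n)]
    exact ih (by simpa using hc.neg_right)
  · intro l n hl hol hon ih hc
    have : Fact l.Prime := ⟨hl⟩
    have hc' := isCoprime_intCast.mpr hc
    push_cast at hc' ⊢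
    have hol' : Odd (l : GaussianInt).norm := by
      have := odd_norm_intCast.mpr hol
      rwa [Int.cast_natCast] at this
    rw [qlog_mul_right hol' (odd_norm_intCast.mpr hon) hc', ih hc.of_mul_right_right, add_zero]
    rcases odd_prime_mod_four hol with h1 | h3
    · obtain ⟨ρ, -, -, hoρ, hρ⟩ := exists_split h1
      rw [hρ, qlog_self_add_star hoρ (hρ ▸ hc'.of_mul_right_left), star_intCast, sub_self]
    · have hlP : Prime (l : GaussianInt) := prime_of_nat_prime_of_mod_four_eq_three l h3
      have := qlog_eq_of_dvd hlP hol' (not_dvd_of_isCoprime hlP hc'.of_mul_right_left) (k := 0) ?_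
      · simpa using this
      have h5 : (m : ZMod l) ≠ 0 := by
        rw [Ne, ZMod.intCast_zmod_eq_zero_iff_dvd]
        intro hd
        have := hc.of_mul_right_left.isUnit_of_dvd' hd dvd_rfl
        exact (Nat.prime_iff_prime_int.mp hl).not_isUnit this
      have h6 : (l : GaussianInt).norm.natAbs = l * l := by
        rw [Zsqrtd.norm_natCast, Int.natAbs_mul, Int.natAbs_natCast]
      -- As 4 ∣ l + 1, the exponent is a multiple of l - 1, and Fermat for the rational m applies.
      have h7 : (l * l - 1) / 4 = (l - 1) * ((l + 1) / 4) := by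
        obtain ⟨j, rfl⟩ : ∃ j, l = 4 * j + 3 := ⟨l / 4, by omega⟩
        rw [show (4 * j + 3 + 1) / 4 = j + 1 by omega,
          show (4 * j + 3) * (4 * j + 3) - 1 = 4 * (4 * j * j + 6 * j + 2) by
            rw [Nat.sub_eq_iff_eq_add (by nlinarith)]; ring,
          Nat.mul_div_cancel_left _ (by norm_num), show 4 * j + 3 - 1 = 4 * j + 2 by omega]
        ring
      have h8 : (l : ℤ) ∣ m ^ ((l - 1) * ((l + 1) / 4)) - 1 := by
        rw [← ZMod.intCast_zmod_eq_zero_iff_dvd]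
        push_cast
        rw [pow_mul, ZMod.pow_card_sub_one_eq_one h5, one_pow, sub_self]
      have h9 := (Zsqrtd.intCast_dvd_intCast (d := -1) _ _).mpr h8
      rw [h6, h7, pow_zero]
      simpa using h9

lemma four_eq_zero : (4 : ZMod 4) = 0 := rfl

lemma qlog_neg_one {γ : GaussianInt} (h : Odd γ.norm) :
    qlog (-1) γ = 2 * ((γ.norm - 1) / 4 : ℤ) := by
  rw [← I_mul_I, qlog_mul_left h (isCoprime_I _) (isCoprime_I _), qlog_I h]; ring

lemma qlog_I_intCast {n : ℤ} (h : Odd n) : qlog I n = ((n ^ 2 - 1) / 4 : ℤ) := by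
  rw [qlog_I (odd_norm_intCast.mpr h), Zsqrtd.norm_intCast, sq]

lemma sq_sub_one_div_four {n : ℤ} (h : Odd n) : ∃ k, n ^ 2 = 8 * k + 1 := by
  obtain ⟨j, rfl⟩ := h
  obtain ⟨k, hk⟩ := Int.even_mul_succ_self j
  exact ⟨k, by linear_combination 4 * hk⟩

lemma isUnit_cases {u : GaussianInt} (h : IsUnit u) : u = 1 ∨ u = -1 ∨ u = I ∨ u = -I := by
  have h1 := (Zsqrtd.norm_eq_one_iff' (by norm_num) u).mpr h
  rw [norm_eq_sq] at h1
  have h2 : u.re ≤ 1 := by nlinarith [sq_nonneg u.im]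
  have h3 : -1 ≤ u.re := by nlinarith [sq_nonneg u.im]
  have h4 : u.im ≤ 1 := by nlinarith [sq_nonneg u.re]
  have h5 : -1 ≤ u.im := by nlinarith [sq_nonneg u.re]
  simp only [Zsqrtd.ext_iff, I, Zsqrtd.re_one, Zsqrtd.im_one, Zsqrtd.re_neg, Zsqrtd.im_neg]
  generalize u.re = r at *
  generalize u.im = s at *
  interval_cases r <;> interval_cases s <;> simp_all

/-! ### Rational reciprocity -/

/-- The statement of rational quartic reciprocity for `n` and `γ`. -/
def RationalReciprocity (n : ℤ) (γ : GaussianInt) : Prop :=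
  qlog n γ = qlog γ n + ((n - 1) / 2 : ℤ) * ((γ.norm - 1) / 2 : ℤ) + γ.im * ((n ^ 2 - 1) / 4 : ℤ)

/-- Both correction terms are additive modulo 4. Since (n² - 1)/4 is even, only the parity of the
imaginary part counts, and that parity is additive on elements of odd norm. -/
lemma RationalReciprocity.mul_right {n : ℤ} {γ δ : GaussianInt} (hn : Odd n) (hγ : Odd γ.norm)
    (hδ : Odd δ.norm) (hc : IsCoprime (n : GaussianInt) (γ * δ)) (h1 : RationalReciprocity n γ)
    (h2 : RationalReciprocity n δ) : RationalReciprocity n (γ * δ) := by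
  unfold RationalReciprocity at *
  rw [qlog_mul_right hγ hδ hc, qlog_mul_left (odd_norm_intCast.mpr hn) hc.of_mul_right_left.symm
    hc.of_mul_right_right.symm, h1, h2]
  obtain ⟨j, hj⟩ : ∃ j, γ.norm = 4 * j + 1 := ⟨γ.norm / 4, by have := norm_mod_four hγ; omega⟩
  obtain ⟨k, hk⟩ : ∃ k, δ.norm = 4 * k + 1 := ⟨δ.norm / 4, by have := norm_mod_four hδ; omega⟩
  obtain ⟨e, he⟩ := sq_sub_one_div_four hn
  obtain ⟨i, hi⟩ : ∃ i, (γ * δ).im = γ.im + δ.im + 2 * i := by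
    have h3 : (γ * δ).im = γ.re * δ.im + γ.im * δ.re := Zsqrtd.im_mul _ _
    have h4 : Even ((γ * δ).im - (γ.im + δ.im)) := by
      rw [h3]
      rw [norm_eq_sq] at hγ hδ
      simp only [Int.even_sub, Int.even_add, Int.even_mul, Int.even_pow,
        ← Int.not_even_iff_odd] at *
      tauto
    obtain ⟨i, hi⟩ := h4
    exact ⟨i, by omega⟩
  rw [Zsqrtd.norm_mul, hj, hk, hi, he,
    show (4 * j + 1 - 1) / 2 = 2 * j by omega, show (4 * k + 1 - 1) / 2 = 2 * k by omega,
    show ((4 * j + 1) * (4 * k + 1) - 1) / 2 = 8 * (j * k) + 2 * j + 2 * k by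
      rw [show (4 * j + 1) * (4 * k + 1) - 1 = 2 * (8 * (j * k) + 2 * j + 2 * k) by ring]; omega,
    show (8 * e + 1 - 1) / 4 = 2 * e by omega]
  push_cast
  linear_combination (-2 * ((n - 1) / 2 : ℤ) * j * k - i * e : ZMod 4) * four_eq_zero

lemma RationalReciprocity.mul_left {m n : ℤ} {γ : GaussianInt} (hm : Odd m) (hn : Odd n)
    (hγ : Odd γ.norm) (hc : IsCoprime ((m * n : ℤ) : GaussianInt) γ)
    (h1 : RationalReciprocity m γ) (h2 : RationalReciprocity n γ) :
    RationalReciprocity (m * n) γ := by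
  unfold RationalReciprocity at *
  push_cast at hc ⊢
  rw [qlog_mul_left hγ hc.of_mul_left_left hc.of_mul_left_right,
    qlog_mul_right (odd_norm_intCast.mpr hm) (odd_norm_intCast.mpr hn) hc.symm, h1, h2]
  obtain ⟨l, hl⟩ : ∃ l, γ.norm = 4 * l + 1 := ⟨γ.norm / 4, by have := norm_mod_four hγ; omega⟩
  obtain ⟨e, he⟩ := sq_sub_one_div_four hm
  obtain ⟨f, hf⟩ := sq_sub_one_div_four hn
  rw [mul_pow, he, hf, hl]
  obtain ⟨j, rfl⟩ := hm
  obtain ⟨k, rfl⟩ := hn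
  rw [show (4 * l + 1 - 1) / 2 = 2 * l by omega, show (2 * j + 1 - 1) / 2 = j by omega,
    show (2 * k + 1 - 1) / 2 = k by omega,
    show ((2 * j + 1) * (2 * k + 1) - 1) / 2 = 2 * (j * k) + j + k by
      rw [show (2 * j + 1) * (2 * k + 1) - 1 = 2 * (2 * (j * k) + j + k) by ring]; omega,
    show (8 * e + 1 - 1) / 4 = 2 * e by omega, show (8 * f + 1 - 1) / 4 = 2 * f by omega,
    show ((8 * e + 1) * (8 * f + 1) - 1) / 4 = 16 * (e * f) + 2 * e + 2 * f by
      rw [show (8 * e + 1) * (8 * f + 1) - 1 = 4 * (16 * (e * f) + 2 * e + 2 * f) by ring]; omega]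
  push_cast
  linear_combination (-j * k * l - 4 * γ.im * e * f : ZMod 4) * four_eq_zero

lemma RationalReciprocity.of_isUnit {n : ℤ} {u : GaussianInt} (hn : Odd n) (hu : IsUnit u) :
    RationalReciprocity n u := by
  have hn' := odd_norm_intCast.mpr hn
  have h1 : qlog (-1) (n : GaussianInt) = 0 := by
    have := qlog_intCast_intCast hn (m := -1) isCoprime_one_left.neg_left
    simpa using this
  unfold RationalReciprocity
  rw [qlog_unit_right _ hu, (Zsqrtd.norm_eq_one_iff' (by norm_num) u).mpr hu]
  obtain ⟨e, he⟩ := sq_sub_one_div_four hn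
  have h2 := qlog_I_intCast hn
  have h3 : qlog (-I) (n : GaussianInt) = qlog I (n : GaussianInt) := by
    rw [← neg_one_mul, qlog_mul_left hn' isCoprime_one_left.neg_left (isCoprime_I _), h1, zero_add]
  rw [he, show (8 * e + 1 - 1) / 4 = 2 * e by omega] at h2 ⊢
  rcases isUnit_cases hu with rfl | rfl | rfl | rfl
  · simp [qlog_one_left _ hn']
  · simp [h1]
  · rw [h2]; simp [I]; linear_combination (-e : ZMod 4) * four_eq_zero
  · rw [h3, h2]; simp [I]

lemma RationalReciprocity.intCast {m n : ℤ} (hm : Odd m) (hn : Odd n) (hc : IsCoprime m n) :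
    RationalReciprocity n (m : GaussianInt) := by
  unfold RationalReciprocity
  rw [qlog_intCast_intCast hn hc, qlog_intCast_intCast hm hc.symm, Zsqrtd.norm_intCast]
  obtain ⟨e, he⟩ := sq_sub_one_div_four hm
  rw [← sq, he, show (8 * e + 1 - 1) / 2 = 4 * e by omega]
  simp
  linear_combination (-e * ((n - 1) / 2 : ℤ) : ZMod 4) * four_eq_zero

lemma even_im_or_even_im_I_mul {γ : GaussianInt} (h : Odd γ.norm) :
    Even γ.im ∨ Even (I * γ).im := by
  rw [norm_eq_sq] at h
  simp only [I, Zsqrtd.im_mul, Int.even_add, Int.even_pow, ← Int.not_even_iff_odd, zero_mul,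
     one_mul, zero_add] at *
  tauto

/-- Build n from -1 and odd primes. For l ≡ 3 (mod 4) the Gauss sum treats -l, and the symbol of -1
accounts for the correction term. -/
lemma rationalReciprocity_of_norm_eq {p : ℕ} [Fact p.Prime] {π : GaussianInt} (hp : π.norm = p)
    (ho : Odd π.norm) (him : Even π.im) {n : ℤ} (hn : Odd n) (hc : IsCoprime (n : GaussianInt) π) :
    RationalReciprocity n π := by
  obtain ⟨w, hw⟩ : ∃ l, π.norm = 4 * l + 1 := ⟨π.norm / 4, by have := norm_mod_four ho; omega⟩
  have hneg : RationalReciprocity (-1) π := by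
    unfold RationalReciprocity
    push_cast
    rw [qlog_neg_one ho, hw, show (4 * w + 1 - 1) / 4 = w by omega,
      show (4 * w + 1 - 1) / 2 = 2 * w by omega, qlog_unit_right _ isUnit_one.neg]
    norm_num
    linear_combination (w : ZMod 4) * four_eq_zero
  revert hc
  refine odd_int_induction (P := fun n => IsCoprime (n : GaussianInt) π →
    RationalReciprocity n π) ?_ ?_ ?_ hn
  · intro _
    unfold RationalReciprocity
    simp [qlog_one_left _ ho, qlog_unit_right]
  · intro n hn ih hc
    have := RationalReciprocity.mul_left (odd_neg_one) hn ho (by simpa using hc) hneg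
      (ih (by simpa using hc.neg_left))
    simpa using this
  · intro l n hl hol hon ih hc
    have : Fact l.Prime := ⟨hl⟩
    have hcl : IsCoprime (l : GaussianInt) π := by
      push_cast at hc; exact hc.of_mul_left_left
    refine RationalReciprocity.mul_left hol hon ho hc ?_
      (ih (by push_cast at hc; exact hc.of_mul_left_right))
    have hlp : l ≠ p := by
      rintro rfl
      exact not_dvd_of_isCoprime (prime_of_norm_eq hp) hcl (natCast_dvd_of_norm_eq hp)
    obtain ⟨i, hi⟩ := him
    obtain ⟨e, he⟩ := sq_sub_one_div_four hol
    unfold RationalReciprocity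
    rw [he, hi, hw, show (4 * w + 1 - 1) / 2 = 2 * w by omega,
      show (8 * e + 1 - 1) / 4 = 2 * e by omega]
    rcases odd_prime_mod_four hol with h1 | h3
    · obtain ⟨j, hj⟩ : ∃ j, (l : ℤ) = 4 * j + 1 := ⟨l / 4, by omega⟩
      rw [Int.cast_natCast, qlog_split_eq hp ho ⟨i, hi⟩ h1 hlp, hj,
        show (4 * j + 1 - 1) / 2 = 2 * j by omega]
      push_cast
      linear_combination (-j * w - i * e : ZMod 4) * four_eq_zero
    · have h4 := qlog_neg_inert_eq hp ho ⟨i, hi⟩ h3 hlp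
      obtain ⟨j, hj⟩ : ∃ j, (l : ℤ) = 4 * j + 3 := ⟨l / 4, by omega⟩
      push_cast at h4 ⊢
      rw [← neg_one_mul, qlog_mul_left ho isCoprime_one_left.neg_left hcl, qlog_neg_one ho, hw,
        show (4 * w + 1 - 1) / 4 = w by omega] at h4
      rw [← h4, hj, show (4 * j + 3 - 1) / 2 = 2 * j + 1 by omega]
      push_cast
      linear_combination (-j * w - w - i * e : ZMod 4) * four_eq_zero

/-- A Gaussian prime divides some rational prime p, so its norm divides p²; if the norm is p², the
cofactor is a unit. -/
lemma prime_cases {π : GaussianInt} (hπ : Prime π) (ho : Odd π.norm) :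
    (∃ p : ℕ, p.Prime ∧ π.norm = p) ∨ ∃ (l : ℕ), Odd (l : ℤ) ∧ Associated (l : GaussianInt) π := by
  have h1 : π ∣ ((π.norm.natAbs : ℕ) : GaussianInt) := by
    refine ⟨star π, ?_⟩
    rw [← Zsqrtd.norm_eq_mul_conj, ← Int.cast_natCast, GaussianInt.abs_natCast_norm]
  obtain ⟨p, hp, hd⟩ : ∃ p : ℕ, p.Prime ∧ π ∣ (p : GaussianInt) := by
    have key : ∀ n : ℕ, n ≠ 0 → π ∣ (n : GaussianInt) →
        ∃ p : ℕ, p.Prime ∧ π ∣ (p : GaussianInt) := by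
      intro n
      induction n using Nat.recOnMul with
      | zero => intro h; exact absurd rfl h
      | one => intro _ h; exact absurd (isUnit_of_dvd_one (by simpa using h)) hπ.not_isUnit
      | prime l hl => intro _ h; exact ⟨l, hl, h⟩
      | mul a b iha ihb =>
        intro h0 h
        push_cast at h
        rcases hπ.dvd_or_dvd h with h | h
        · exact iha (left_ne_zero_of_mul h0) h
        · exact ihb (right_ne_zero_of_mul h0) h
    refine key _ ?_ h1
    have := (GaussianInt.norm_pos).mpr hπ.ne_zero
    omega
  have h2 := norm_dvd_norm hd
  rw [Zsqrtd.norm_natCast, ← sq] at h2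
  obtain ⟨δ, hδ⟩ := hd
  have hpi := Nat.prime_iff_prime_int.mp hp
  obtain ⟨i, hi, hass⟩ := (dvd_prime_pow hpi 2).mp h2
  have hN : π.norm = (p : ℤ) ^ i := Int.eq_of_associated_of_nonneg hass (GaussianInt.norm_nonneg _)
    (by positivity)
  interval_cases i
  · exact absurd (isUnit_of_norm_eq_one (by simpa using hN)) hπ.not_isUnit
  · left; exact ⟨p, hp, by simpa using hN⟩
  · right
    refine ⟨p, ?_, ?_⟩
    · rw [hN] at ho; exact (Int.odd_pow.mp ho).resolve_right two_ne_zero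
    · have h3 : (p : GaussianInt).norm = π.norm * δ.norm := by rw [hδ, Zsqrtd.norm_mul]
      rw [Zsqrtd.norm_natCast, hN] at h3
      have h4 : δ.norm = 1 := by
        have h5 : (p : ℤ) ^ 2 ≠ 0 := pow_ne_zero _ hpi.ne_zero
        apply mul_left_cancel₀ h5
        rw [← h3]; ring
      obtain ⟨u, hu⟩ := isUnit_of_norm_eq_one h4
      rw [hδ, ← hu]
      exact (associated_mul_unit_right π _ u.isUnit).symm

/-- Quartic reciprocity between a rational integer and an element of odd norm. -/
theorem rationalReciprocity {n : ℤ} {γ : GaussianInt} (hn : Odd n) (hγ : Odd γ.norm)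
    (hc : IsCoprime (n : GaussianInt) γ) : RationalReciprocity n γ := by
  revert hc
  refine odd_induction (P := fun γ => IsCoprime (n : GaussianInt) γ → RationalReciprocity n γ)
    ?_ ?_ hγ
  · intro u hu _; exact .of_isUnit hn hu
  · intro π γ hπ ho hγ ih hc
    refine .mul_right hn ho hγ hc ?_ (ih hc.of_mul_right_right)
    replace hc := hc.of_mul_right_left
    rcases prime_cases hπ ho with ⟨p, hp, hpn⟩ | ⟨l, hl, u, rfl⟩
    · have : Fact p.Prime := ⟨hp⟩
      -- The Gauss sum argument needs even imaginary part; otherwise treat iπ and multiply back by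
      -- the unit -i.
      rcases even_im_or_even_im_I_mul ho with him | him
      · exact rationalReciprocity_of_norm_eq hpn ho him hn hc
      · have hN : (I * π).norm = p := by rw [Zsqrtd.norm_mul, norm_I, one_mul, hpn]
        have hc' : IsCoprime (n : GaussianInt) (I * π) := (isCoprime_I _).symm.mul_right hc
        have h1 := rationalReciprocity_of_norm_eq hN (by rw [hN, ← hpn]; exact ho) him hn hc'
        have h2 : π = -I * (I * π) := by rw [← mul_assoc, neg_mul, I_mul_I]; simp
        rw [h2]
        have hI : Odd (-I).norm := by rw [Zsqrtd.norm_neg, norm_I]; exact odd_one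
        exact .mul_right hn hI (by rw [hN, ← hpn]; exact ho) (by rwa [← h2])
          (.of_isUnit hn isUnit_I.neg) h1
    · have hu : Odd (u : GaussianInt).norm := by
        rw [(Zsqrtd.norm_eq_one_iff' (by norm_num) _).mpr u.isUnit]; exact odd_one
      have h1 : (l : GaussianInt) = ((l : ℤ) : GaussianInt) := by simp
      rw [h1] at hc ho ⊢
      exact .mul_right hn (odd_norm_intCast.mpr hl) hu hc
        (.intCast hl hn (isCoprime_intCast.mp hc.of_mul_right_left).symm) (.of_isUnit hn u.isUnit)

lemma odd_norm_of_odd_re {γ : GaussianInt} (hre : Odd γ.re) (him : Even γ.im) : Odd γ.norm := by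
  rw [norm_eq_sq]
  simp only [Int.even_add, Int.even_pow, ← Int.not_even_iff_odd] at *
  tauto

/-- Rational quartic reciprocity for normalized arguments. -/
lemma qlog_intCast_comm {n : ℤ} {γ : GaussianInt} (hn : n % 4 = 1) (hγ : Odd γ.norm)
    (him : Even γ.im) (hc : IsCoprime (n : GaussianInt) γ) : qlog n γ = qlog γ n := by
  have ho : Odd n := by rw [Int.odd_iff]; omega
  have h := rationalReciprocity ho hγ hc
  unfold RationalReciprocity at h
  obtain ⟨w, hw⟩ : ∃ l, γ.norm = 4 * l + 1 := ⟨γ.norm / 4, by have := norm_mod_four hγ; omega⟩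
  obtain ⟨e, he⟩ := sq_sub_one_div_four ho
  obtain ⟨i, hi⟩ := him
  obtain ⟨j, hj⟩ : ∃ j, (n - 1) / 2 = 2 * j := ⟨n / 4, by omega⟩
  rw [h, he, hw, hi, hj, show (4 * w + 1 - 1) / 2 = 2 * w by omega,
    show (8 * e + 1 - 1) / 4 = 2 * e by omega]
  push_cast
  linear_combination (j * w + i * e : ZMod 4) * four_eq_zero

/-- Both correction terms are even, so doubling kills them and no normalization is required. -/
lemma two_mul_qlog_intCast_comm {n : ℤ} {γ : GaussianInt} (hn : Odd n) (hγ : Odd γ.norm)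
    (hc : IsCoprime (n : GaussianInt) γ) : 2 * qlog n γ = 2 * qlog γ n := by
  have h := rationalReciprocity hn hγ hc
  unfold RationalReciprocity at h
  obtain ⟨w, hw⟩ : ∃ l, γ.norm = 4 * l + 1 := ⟨γ.norm / 4, by have := norm_mod_four hγ; omega⟩
  obtain ⟨e, he⟩ := sq_sub_one_div_four hn
  rw [h, he, hw, show (4 * w + 1 - 1) / 2 = 2 * w by omega,
    show (8 * e + 1 - 1) / 4 = 2 * e by omega]
  push_cast
  linear_combination (((n - 1) / 2 : ℤ) * w + γ.im * e : ZMod 4) * four_eq_zero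

/-! ### Supplementary laws -/

lemma isCoprime_of_mul_eq_two {x y : GaussianInt} (h : x * y = 2) {n : ℤ} (hn : Odd n) :
    IsCoprime x (n : GaussianInt) := by
  obtain ⟨k, rfl⟩ := hn
  exact ⟨-(k : GaussianInt) * y, 1, by push_cast; linear_combination -(k : GaussianInt) * h⟩

lemma one_add_I_mul : (1 + I) * (1 - I) = 2 := by linear_combination -I_mul_I

lemma isCoprime_two {γ : GaussianInt} (h : Odd γ.norm) : IsCoprime 2 γ := by
  have h1 : IsCoprime (2 : GaussianInt) (γ.norm : ℤ) := isCoprime_of_mul_eq_two (mul_one 2) h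
  rw [Zsqrtd.norm_eq_mul_conj] at h1
  exact h1.of_mul_right_left

lemma isCoprime_one_add_I {γ : GaussianInt} (h : Odd γ.norm) : IsCoprime (1 + I) γ := by
  have := isCoprime_two h
  rw [← one_add_I_mul] at this
  exact this.of_mul_left_left

lemma qlog_two_intCast {n : ℤ} (hn : Odd n) : qlog 2 (n : GaussianInt) = 0 := by
  have : IsCoprime (2 : ℤ) n := by
    rw [Int.isCoprime_iff_gcd_eq_one]
    obtain ⟨k, rfl⟩ := hn
    simp
  simpa using qlog_intCast_intCast (m := 2) hn this

/-- For split l the symbol is that of (1 + i)/(1 - i) = i modulo a prime factor; for inert l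
Frobenius computes (1 + i)^(l-1). Both classes modulo 4 are carried along because the factors of n
may lie in either. -/
lemma qlog_one_add_I_aux {n : ℤ} (hn : Odd n) :
    (n % 4 = 1 → qlog (1 + I) n = ((n - 1) / 4 : ℤ)) ∧
      (n % 4 = 3 → qlog (1 + I) n = ((-n - 1) / 4 : ℤ)) := by
  refine odd_int_induction (P := fun n => (n % 4 = 1 → qlog (1 + I) n = ((n - 1) / 4 : ℤ)) ∧
      (n % 4 = 3 → qlog (1 + I) n = ((-n - 1) / 4 : ℤ))) ?_ ?_ ?_ hn
  · refine ⟨fun _ => ?_, fun h => by norm_num at h⟩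
    rw [qlog_unit_right _ (by simp)]; simp
  · intro n hn ih
    rw [qlog_associated (associated_neg_intCast n), neg_neg]
    exact ⟨fun h => ih.2 (by omega), fun h => ih.1 (by omega)⟩
  · intro l n hl hol hon ih
    have : Fact l.Prime := ⟨hl⟩
    have hol' : Odd (l : GaussianInt).norm := by
      have := odd_norm_intCast.mpr hol
      rwa [Int.cast_natCast] at this
    have hcl : IsCoprime (1 + I) (l : GaussianInt) := isCoprime_one_add_I hol'
    have hln : Odd ((l : GaussianInt) * n).norm :=
      odd_norm_mul.mpr ⟨hol', odd_norm_intCast.mpr hon⟩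
    have hq : (l % 4 = 1 → qlog (1 + I) l = ((l - 1) / 4 : ℤ)) ∧
      (l % 4 = 3 → qlog (1 + I) l = ((-l - 1) / 4 : ℤ)) := by
      constructor
      · intro h1
        obtain ⟨ρ, hρn, -, hoρ, hρ⟩ := exists_split h1
        have h2 : IsCoprime (1 + I) ρ := isCoprime_one_add_I hoρ
        have h3 : star (1 + I) * I = 1 + I := by
          rw [star_add, star_one, star_I]; linear_combination -I_mul_I
        have h4 : IsCoprime (star (1 + I)) ρ := by
          have h5 := isCoprime_two hoρ
          rw [← one_add_I_mul] at h5
          rw [star_add, star_one, star_I, ← sub_eq_add_neg]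
          exact h5.of_mul_left_right
        have h5 := qlog_mul_left hoρ h4 (isCoprime_I ρ)
        rw [h3, qlog_I hoρ, hρn] at h5
        rw [hρ, qlog_self_add_star hoρ (hρ ▸ hcl), h5]; ring
      · intro h3
        have hlP : Prime (l : GaussianInt) := prime_of_nat_prime_of_mod_four_eq_three l h3
        obtain ⟨j, hj⟩ : ∃ j, l = 4 * j + 3 := ⟨l / 4, by omega⟩
        have h4 := qlog_eq_of_dvd hlP hol' (not_dvd_of_isCoprime hlP hcl) (k := 3 * (j + 1)) ?_
        · rw [h4, hj, show (-((4 * j + 3 : ℕ) : ℤ) - 1) / 4 = -(j + 1) by push_cast; omega]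
          push_cast
          linear_combination (j + 1 : ZMod 4) * four_eq_zero
        · have h5 : ((l : GaussianInt).norm.natAbs - 1) / 4 = (l - 1) * (j + 1) := by
            rw [Zsqrtd.norm_natCast, Int.natAbs_mul, Int.natAbs_natCast, hj,
              show (4 * j + 3) * (4 * j + 3) - 1 = 4 * (4 * j * j + 6 * j + 2) by
                rw [Nat.sub_eq_iff_eq_add (by nlinarith)]; ring,
              Nat.mul_div_cancel_left _ (by norm_num), show 4 * j + 3 - 1 = 4 * j + 2 by omega]
            ring
          rw [h5, pow_mul, pow_mul]
          refine Dvd.dvd.trans ?_ (sub_dvd_pow_sub_pow _ _ _)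
          -- Modulo l, (1 + i)^l ≡ 1 - i = i³(1 + i).
          obtain ⟨r, hr⟩ := exists_add_pow_prime_eq hl (1 : GaussianInt) I
          rw [one_pow, I_pow_mod l, h3, I_pow_three] at hr
          have h6 : l = (l - 1) + 1 := by omega
          have h7 : (1 + I) * ((1 + I) ^ (l - 1) - I ^ 3) = l * (I * r) := by
            rw [h6, pow_succ] at hr
            have : ((l - 1 + 1 : ℕ) : GaussianInt) = (l : GaussianInt) := by rw [← h6]
            rw [this] at hr
            rw [I_pow_three]
            linear_combination hr + I_mul_I
          exact hcl.symm.dvd_of_dvd_mul_left (h7 ▸ dvd_mul_right _ _)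
    push_cast
    rw [qlog_mul_right hol' (odd_norm_intCast.mpr hon) (isCoprime_one_add_I hln)]
    have key : ∀ s t : ℤ, s % 4 = 1 → t % 4 = 1 → qlog (1 + I) l = ((s - 1) / 4 : ℤ) →
        qlog (1 + I) n = ((t - 1) / 4 : ℤ) →
        qlog (1 + I) l + qlog (1 + I) n = ((s * t - 1) / 4 : ℤ) := by
      intro s t hs ht h1 h2
      rw [h1, h2, mul_sub_one_div_four hs ht]
    have hn4 : n % 4 = 1 ∨ n % 4 = 3 := by rw [Int.odd_iff] at hon; omega
    have hl4 := odd_prime_mod_four hol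
    rcases hl4 with h1 | h1 <;> rcases hn4 with h2 | h2
    · refine ⟨fun _ => key l n (by omega) h2 (hq.1 h1) (ih.1 h2), fun h => ?_⟩
      rw [Int.mul_emod, show (l : ℤ) % 4 = 1 by omega, h2] at h; norm_num at h
    · refine ⟨fun h => ?_, fun _ => ?_⟩
      · rw [Int.mul_emod, show (l : ℤ) % 4 = 1 by omega, h2] at h; norm_num at h
      · rw [← mul_neg]; exact key l (-n) (by omega) (by omega) (hq.1 h1) (ih.2 h2)
    · refine ⟨fun h => ?_, fun _ => ?_⟩
      · rw [Int.mul_emod, show (l : ℤ) % 4 = 3 by omega, h2] at h; norm_num at h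
      · rw [← neg_mul]; exact key (-l) n (by omega) (by omega) (hq.2 h1) (ih.1 h2)
    · refine ⟨fun _ => ?_, fun h => ?_⟩
      · rw [← neg_mul_neg]; exact key (-l) (-n) (by omega) (by omega) (hq.2 h1) (ih.2 h2)
      · rw [Int.mul_emod, show (l : ℤ) % 4 = 3 by omega, h2] at h; norm_num at h

/-- The supplementary law for `1 + i` and a rational modulus. -/
lemma qlog_one_add_I {n : ℤ} (hn : n % 4 = 1) : qlog (1 + I) n = ((n - 1) / 4 : ℤ) :=
  (qlog_one_add_I_aux (by rw [Int.odd_iff]; omega)).1 hn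

lemma isCoprime_re {γ : GaussianInt} (h : IsCoprime γ.re γ.im) :
    IsCoprime (γ.re : GaussianInt) γ := by
  have h1 : IsCoprime (γ.re : GaussianInt) (γ.im : GaussianInt) := isCoprime_intCast.mpr h
  have h2 : γ = γ.im * I + γ.re * 1 := by ext <;> simp [I]
  have h3 : IsCoprime (γ.re : GaussianInt) (γ.im * I) := h1.mul_right (isCoprime_I _).symm
  have h4 := h3.add_mul_left_right 1
  rwa [← h2] at h4

lemma two_mul_qlog_I_intCast {n : ℤ} (hn : Odd n) : 2 * qlog I (n : GaussianInt) = 0 := by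
  rw [qlog_I_intCast hn]
  obtain ⟨e, he⟩ := sq_sub_one_div_four hn
  rw [he, show (8 * e + 1 - 1) / 4 = 2 * e by omega]
  push_cast
  linear_combination (e : ZMod 4) * four_eq_zero

/-- The supplementary law for `2`. -/
lemma qlog_two {γ : GaussianInt} (hre : Odd γ.re) (him : Even γ.im)
    (hc : IsCoprime γ.re γ.im) : qlog 2 γ = (γ.re * γ.im / 2 : ℤ) := by
  have ho := odd_norm_of_odd_re hre him
  set A := γ.re with hA
  set B := γ.im with hB
  have hγ : γ = A + B * I := by ext <;> simp [I, hA, hB]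
  have hAB : Odd (A + B) := hre.add_even him
  have hA1 : IsCoprime (A : GaussianInt) γ := isCoprime_re hc
  have hB1 : IsCoprime (B : GaussianInt) (A + B : ℤ) := by
    rw [isCoprime_intCast]
    simpa using hc.symm.add_mul_left_right 1
  have h1I : (I - 1) * (-1 - I) = 2 := by linear_combination -I_mul_I
  have hI1 : IsCoprime (I - 1) ((A + B : ℤ) : GaussianInt) := isCoprime_of_mul_eq_two h1I hAB
  have hAB1 : IsCoprime ((A + B : ℤ) : GaussianInt) γ := by
    have h2 := (hB1.mul_left hI1).symm.add_mul_left_right 1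
    have h3 : (B : GaussianInt) * (I - 1) + ((A + B : ℤ) : GaussianInt) * 1 = γ := by
      rw [hγ]; push_cast; ring
    rwa [h3] at h2
  have hoAB := odd_norm_intCast.mpr hAB
  have hoA := odd_norm_intCast.mpr hre
  -- the square of `A + B`
  have e1 : qlog (((A + B : ℤ) : GaussianInt) ^ 2) γ = qlog (2 * A ^ 2 * I) γ := by
    apply qlog_congr ho
    refine ⟨(A : GaussianInt) - B * I - 2 * A * I, ?_⟩
    rw [hγ]; push_cast
    linear_combination (B ^ 2 + 2 * A * B : GaussianInt) * I_mul_I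
  rw [qlog_pow_left ho hAB1, qlog_mul_left ho ((isCoprime_two ho).mul_left hA1.pow_left)
    (isCoprime_I _), qlog_mul_left ho (isCoprime_two ho) hA1.pow_left, qlog_pow_left ho hA1] at e1
  push_cast at e1
  -- From (A + B)² ≡ 2iA² (mod γ) the symbol of 2 is found in terms of doubled rational symbols.
  -- These are flipped and reduced: γ ≡ B(i - 1) modulo A + B and γ ≡ Bi modulo A.
  have e2 := two_mul_qlog_intCast_comm hAB ho hAB1
  have e3 := two_mul_qlog_intCast_comm hre ho hA1
  have e4 : qlog γ ((A + B : ℤ) : GaussianInt) = qlog (I - 1) ((A + B : ℤ) : GaussianInt) := by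
    rw [qlog_congr hoAB (β := B * (I - 1)) ⟨1, by rw [hγ]; push_cast; ring⟩,
      qlog_mul_left hoAB hB1 hI1, qlog_intCast_intCast hAB (isCoprime_intCast.mp hB1), zero_add]
  have e5 : 2 * qlog (I - 1) ((A + B : ℤ) : GaussianInt) = qlog I ((A + B : ℤ) : GaussianInt) := by
    have h5 : (I - 1) ^ 2 = ((-2 : ℤ) : GaussianInt) * I := by
      push_cast; linear_combination I_mul_I
    have h6 : IsCoprime (-2 : ℤ) (A + B) := by
      obtain ⟨k, hk⟩ := hAB
      rw [hk]; exact ⟨k, 1, by ring⟩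
    have h7 := qlog_pow_left hoAB hI1 2
    rw [h5, qlog_mul_left hoAB (isCoprime_intCast.mpr h6) (isCoprime_I _),
      qlog_intCast_intCast hAB h6, zero_add] at h7
    rw [h7]; rfl
  have e6 : 2 * qlog γ (A : GaussianInt) = 0 := by
    have h8 : IsCoprime (B : GaussianInt) (A : GaussianInt) := isCoprime_intCast.mpr hc.symm
    rw [qlog_congr hoA (β := B * I) ⟨1, by rw [hγ]; ring⟩, qlog_mul_left hoA h8 (isCoprime_I _),
      qlog_intCast_intCast hre hc.symm, zero_add, two_mul_qlog_I_intCast hre]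
  rw [qlog_I ho, e3, e6] at e1
  push_cast at e2 e4 e5 e1
  rw [e2, e4, e5] at e1
  have e7 := qlog_I_intCast hAB
  push_cast at e7
  rw [e7] at e1
  -- The cross term 2AB is the whole difference between the symbols of i modulo A + B and modulo γ.
  have e8 : ((A + B) ^ 2 - 1) / 4 = (γ.norm - 1) / 4 + A * B / 2 := by
    have h9 := norm_mod_four ho
    have h10 : γ.norm = A ^ 2 + B ^ 2 := norm_eq_sq γ
    obtain ⟨j, hj⟩ := him
    have h11 : (A + B) ^ 2 - 1 = γ.norm - 1 + 4 * (A * j) := by rw [h10, hj]; ring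
    have h12 : A * B = 2 * (A * j) := by rw [hj]; ring
    rw [h11, h12]
    omega
  rw [e8] at e1
  push_cast at e1 ⊢
  linear_combination -e1

/-! ### The comparison of symbols through κ -/

lemma isCoprime_two_pow {γ : GaussianInt} (h : Odd γ.norm) (n : ℕ) : IsCoprime (2 ^ n) γ :=
  (isCoprime_two h).pow_left

lemma isCoprime_sign {s : ℤ} (h : s = 1 ∨ s = -1) (γ : GaussianInt) :
    IsCoprime (s : GaussianInt) γ := by
  apply isCoprime_of_isUnit
  rcases h with rfl | rfl <;> simp

/-- The comparison of quartic symbols obtained from `κ = π + ε x`, `ε` a unit, when `κ²` and the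
norm of `κ` have the shape that results from `N π = x² + q y²`. -/
lemma qlog_comparison {π κ κ' ω ε β : GaussianInt} {x y E q s s' x₀ y₀ e₀ : ℤ} {t u k : ℕ}
    (hπ : Odd π.norm) (hπim : Even π.im) (hκ' : Odd κ'.norm) (hκ'im : Even κ'.im)
    (hβ : Odd β.norm) (hβq : β.norm = q)
    (hω : ∀ γ : GaussianInt, Odd γ.norm → IsCoprime ω γ) (hε : IsUnit ε)
    (hκω : κ = ω * κ') (hκπ : κ = π + ε * x)
    (hsq : κ ^ 2 = 2 * ε * E * π - ε ^ 2 * q * y ^ 2)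
    (hnorm : κ.norm = 2 * x * E + q * y ^ 2)
    (hN : π.norm = x ^ 2 + q * y ^ 2) (hxN : IsCoprime x π.norm) (hyN : IsCoprime y π.norm)
    (hE : IsCoprime (E : GaussianInt) κ')
    (hx : x = s * 2 ^ u * x₀) (hy : y = 2 ^ t * y₀) (he : E = s' * 2 ^ k * e₀)
    (hs : s = 1 ∨ s = -1) (hs' : s' = 1 ∨ s' = -1)
    (hx₀ : x₀ % 4 = 1) (hy₀ : y₀ % 4 = 1) (he₀ : e₀ % 4 = 1) :
    qlog x π - qlog y π + qlog x β - qlog π β =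
      qlog ε β + qlog s π + (u - t) * qlog 2 π + qlog (-1) κ' - qlog s κ' - qlog s' κ'
        + (2 * t - 1 - k - u) * qlog 2 κ' + qlog ω x₀ + qlog ω e₀ - qlog ω q - 2 * qlog ω y₀
        - qlog κ e₀ + qlog ε y₀ := by
  have hox : Odd x₀ := by rw [Int.odd_iff]; omega
  have hoy : Odd y₀ := by rw [Int.odd_iff]; omega
  have hoe : Odd e₀ := by rw [Int.odd_iff]; omega
  have hnx := odd_norm_intCast.mpr hox
  have hny := odd_norm_intCast.mpr hoy
  have hne := odd_norm_intCast.mpr hoe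
  have hq4 : q % 4 = 1 := by rw [← hβq]; exact norm_mod_four hβ
  have hoq : Odd q := by rw [Int.odd_iff]; omega
  have hnq := odd_norm_intCast.mpr hoq
  have hqβ : (q : GaussianInt) = β * star β := by rw [← hβq, Zsqrtd.norm_eq_mul_conj]
  have hκs : κ * star κ = 2 * x * E + q * y ^ 2 := by
    rw [← Zsqrtd.norm_eq_mul_conj, hnorm]; push_cast; ring
  have hπs : π * star π = x ^ 2 + q * y ^ 2 := by
    rw [← Zsqrtd.norm_eq_mul_conj, hN]; push_cast; ring
  have hxG : (x : GaussianInt) = s * 2 ^ u * x₀ := by rw [hx]; push_cast; ring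
  have hyG : (y : GaussianInt) = 2 ^ t * y₀ := by rw [hy]; push_cast; ring
  have heG : (E : GaussianInt) = s' * 2 ^ k * e₀ := by rw [he]; push_cast; ring
  -- coprimality
  have cxp : IsCoprime (x : GaussianInt) π := by
    have := isCoprime_intCast.mpr hxN
    rw [Zsqrtd.norm_eq_mul_conj] at this
    exact this.of_mul_right_left
  have cyp : IsCoprime (y : GaussianInt) π := by
    have := isCoprime_intCast.mpr hyN
    rw [Zsqrtd.norm_eq_mul_conj] at this
    exact this.of_mul_right_left
  have cx0p : IsCoprime (x₀ : GaussianInt) π := by rw [hxG] at cxp; exact cxp.of_mul_left_right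
  have cy0p : IsCoprime (y₀ : GaussianInt) π := by rw [hyG] at cyp; exact cyp.of_mul_left_right
  have cxk : IsCoprime (x : GaussianInt) κ := by
    rw [hκπ, mul_comm ε]; exact cxp.add_mul_left_right ε
  have cxk' : IsCoprime (x : GaussianInt) κ' := by rw [hκω] at cxk; exact cxk.of_mul_right_right
  have cx0k' : IsCoprime (x₀ : GaussianInt) κ' := by
    rw [hxG] at cxk'; exact cxk'.of_mul_left_right
  have c2k' := isCoprime_two hκ'
  have ce0k' : IsCoprime (e₀ : GaussianInt) κ' := by rw [heG] at hE; exact hE.of_mul_left_right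
  have cqyk' : IsCoprime ((q : GaussianInt) * y ^ 2) κ' := by
    have h1 : IsCoprime (-(2 * (x : GaussianInt) * E)) κ' := ((c2k'.mul_left cxk').mul_left hE).neg_left
    have h2 := h1.add_mul_left_left (ω * star κ)
    have h3 : -(2 * (x : GaussianInt) * E) + κ' * (ω * star κ) = q * y ^ 2 := by
      linear_combination hκs - star κ * hκω
    rwa [h3] at h2
  have cqk' : IsCoprime (q : GaussianInt) κ' := cqyk'.of_mul_left_left
  have cyk' : IsCoprime (y : GaussianInt) κ' :=
    (IsCoprime.pow_left_iff (by norm_num)).mp cqyk'.of_mul_left_right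
  have cy0k' : IsCoprime (y₀ : GaussianInt) κ' := by
    rw [hyG] at cyk'; exact cyk'.of_mul_left_right
  have cβk' : IsCoprime β κ' := by rw [hqβ] at cqk'; exact cqk'.of_mul_left_left
  have cκβ : IsCoprime κ β := by rw [hκω]; exact (hω _ hβ).mul_left cβk'.symm
  have cκy0 : IsCoprime κ y₀ := by rw [hκω]; exact (hω _ hny).mul_left cy0k'.symm
  have cxq : IsCoprime x q := by
    have h1 := hxN.add_mul_left_right (-x)
    have h2 : π.norm + x * -x = q * y ^ 2 := by rw [hN]; ring
    rw [h2] at h1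
    exact h1.of_mul_right_left
  have cxqG := isCoprime_intCast.mpr cxq
  have cxβ : IsCoprime (x : GaussianInt) β := by rw [hqβ] at cxqG; exact cxqG.of_mul_right_left
  -- Modulo a divisor m of ε²qy² the element 2εEπ is the square κ².
  have key2 : ∀ {m : GaussianInt} (z : GaussianInt), m * z = ε ^ 2 * q * y ^ 2 → IsCoprime κ m →
      IsCoprime (2 * ε * E * π) m := by
    intro m z hz hc
    have h1 := (hc.pow_left (m := 2)).add_mul_left_left z
    rwa [show κ ^ 2 + m * z = 2 * ε * E * π by rw [hz, hsq]; ring] at h1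
  have cPβ : IsCoprime (2 * ε * E * π) β :=
    key2 (star β * ε ^ 2 * y ^ 2) (by rw [hqβ]; ring) cκβ
  have cPy : IsCoprime (2 * ε * E * π) (y₀ : GaussianInt) :=
    key2 (ε ^ 2 * q * y * 2 ^ t) (by rw [hyG]; ring) cκy0
  have cπβ := cPβ.of_mul_left_right
  have cEβ := cPβ.of_mul_left_left.of_mul_left_right
  have cEy := cPy.of_mul_left_left.of_mul_left_right
  have cπy := cPy.of_mul_left_right
  have c2 : ∀ γ : GaussianInt, Odd γ.norm → IsCoprime (2 : GaussianInt) γ := fun γ h => isCoprime_two h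
  have cε := isCoprime_of_isUnit hε
  -- expansion of `x`, `y`, `E`
  have expand : ∀ {γ : GaussianInt} {z w v : ℤ} {n : ℕ}, Odd γ.norm → (w = 1 ∨ w = -1) →
      (z : GaussianInt) = w * 2 ^ n * v → IsCoprime (z : GaussianInt) γ →
      qlog z γ = qlog w γ + n * qlog 2 γ + qlog v γ := by
    intro γ z w v n hγ hw hz hc
    rw [hz] at hc ⊢
    rw [qlog_mul_left hγ hc.of_mul_left_left hc.of_mul_left_right,
      qlog_mul_left hγ (isCoprime_sign hw γ) (isCoprime_two_pow hγ n),
      qlog_pow_left hγ (c2 _ hγ)]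
  have X1 := expand hπ hs hxG cxp
  have X2 := expand hκ' hs hxG cxk'
  have E1 := expand hκ' hs' heG hE
  have hyG' : (y : GaussianInt) = ((1 : ℤ) : GaussianInt) * 2 ^ t * y₀ := by rw [hyG]; simp
  have Y1 := expand hπ (Or.inl rfl) hyG' cyp
  have Y2 := expand hκ' (Or.inl rfl) hyG' cyk'
  rw [Int.cast_one, qlog_one_left _ hπ] at Y1
  rw [Int.cast_one, qlog_one_left _ hκ'] at Y2
  -- reciprocity
  have R1 := qlog_intCast_comm hx₀ hπ hπim cx0p
  have R2 := qlog_intCast_comm hy₀ hπ hπim cy0p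
  have R3 := qlog_intCast_comm hx₀ hκ' hκ'im cx0k'
  have R4 := qlog_intCast_comm hy₀ hκ' hκ'im cy0k'
  have R5 := qlog_intCast_comm he₀ hκ' hκ'im ce0k'
  have R6 := qlog_intCast_comm hq4 hκ' hκ'im cqk'
  -- congruences
  have C1 : qlog π x₀ = qlog ω x₀ + qlog κ' x₀ := by
    rw [← qlog_mul_left hnx (hω _ hnx) cx0k'.symm, ← hκω]
    apply qlog_congr hnx
    exact ⟨-(ε * s * 2 ^ u), by rw [hκπ, hxG]; ring⟩
  have C2 : qlog κ e₀ = qlog ω e₀ + qlog κ' e₀ := by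
    rw [hκω, qlog_mul_left hne (hω _ hne) ce0k'.symm]
  -- Nκ ≡ 0 (mod κ') reads 2xE ≡ -qy².
  have C3 : qlog 2 κ' + qlog x κ' + qlog E κ' = qlog (-1) κ' + qlog q κ' + 2 * qlog y κ' := by
    have h1 : qlog (2 * x * E) κ' = qlog (-1 * q * y ^ 2) κ' := by
      apply qlog_congr hκ'
      exact ⟨ω * star κ, by linear_combination star κ * hκω - hκs⟩
    rw [qlog_mul_left hκ' (c2k'.mul_left cxk') hE, qlog_mul_left hκ' c2k' cxk',
      qlog_mul_left hκ' (isCoprime_one_left.neg_left.mul_left cqk') cyk'.pow_left,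
      qlog_mul_left hκ' isCoprime_one_left.neg_left cqk', qlog_pow_left hκ' cyk'] at h1
    exact_mod_cast h1
  -- κ² ≡ 2εEπ (mod y₀), where the rational factors 2 and E have trivial symbol.
  have C4 : 2 * qlog ω y₀ + 2 * qlog κ' y₀ = qlog ε y₀ + qlog π y₀ := by
    have h1 : qlog (κ ^ 2) y₀ = qlog (2 * ε * E * π) y₀ := by
      apply qlog_congr hny
      exact ⟨-(ε ^ 2 * q * y * 2 ^ t), by rw [hsq, hyG]; ring⟩
    rw [qlog_pow_left hny cκy0, hκω, qlog_mul_left hny (hω _ hny) cy0k'.symm,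
      qlog_mul_left hny cPy.of_mul_left_left cπy,
      qlog_mul_left hny cPy.of_mul_left_left.of_mul_left_left cEy,
      qlog_mul_left hny (c2 _ hny) (cε _), qlog_two_intCast hoy,
      qlog_intCast_intCast hoy (isCoprime_intCast.mp cEy)] at h1
    push_cast at h1
    linear_combination h1
  -- Since q = ββ̄, the symbol of κ modulo q is that of κ/κ̄ = κ²/(κκ̄) modulo β, which is ≡
  -- 2εEπ/(2xE) = επ/x.
  have C5 : qlog ω q + qlog κ' q = qlog ε β + qlog π β - qlog x β := by
    have cκq : IsCoprime κ (q : GaussianInt) := by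
      rw [hκω]; exact (hω _ hnq).mul_left cqk'.symm
    have csκβ : IsCoprime (star κ) β := by
      rw [hqβ] at cκq
      have := isCoprime_star cκq.of_mul_right_right
      rwa [star_star] at this
    rw [← qlog_mul_left hnq (hω _ hnq) cqk'.symm, ← hκω]
    have h0 : qlog κ q = qlog κ β - qlog (star κ) β := by
      rw [hqβ] at cκq ⊢
      exact qlog_self_add_star hβ cκq
    have h1 : qlog (κ ^ 2) β = qlog (2 * ε * E * π) β := by
      apply qlog_congr hβ
      exact ⟨-(star β * ε ^ 2 * y ^ 2), by rw [hsq, hqβ]; ring⟩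
    have h2 : qlog (κ * star κ) β = qlog (2 * x * E) β := by
      apply qlog_congr hβ
      exact ⟨star β * y ^ 2, by rw [hκs, hqβ]; ring⟩
    rw [qlog_pow_left hβ cκβ, qlog_mul_left hβ cPβ.of_mul_left_left cπβ,
      qlog_mul_left hβ cPβ.of_mul_left_left.of_mul_left_left cEβ,
      qlog_mul_left hβ (c2 _ hβ) (cε _)] at h1
    rw [qlog_mul_left hβ cκβ csκβ, qlog_mul_left hβ ((c2 _ hβ).mul_left cxβ) cEβ,
      qlog_mul_left hβ (c2 _ hβ) cxβ] at h2
    push_cast at h1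
    rw [h0]
    linear_combination h1 - h2
  linear_combination X1 - Y1 + R1 - R2 + C1 - R3 + C3 - X2 - E1 + 2 * Y2 + 2 * R4 + R6 - R5
    + C5 + C4 + C2

/-! ### Explicit symbols modulo a Gaussian integer with even imaginary part -/

lemma qlog_neg_one_of_even_im {γ : GaussianInt} (hre : Odd γ.re) {η : ℤ} (him : γ.im = 2 * η) :
    qlog (-1) γ = 2 * η := by
  have ho := odd_norm_of_odd_re hre ⟨η, by rw [him]; ring⟩
  rw [qlog_neg_one ho, norm_eq_sq, him]
  obtain ⟨e, he⟩ := sq_sub_one_div_four hre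
  obtain ⟨k, hk⟩ := Int.even_mul_pred_self η
  rw [he, show (8 * e + 1 + (2 * η) ^ 2 - 1) / 4 = 2 * e + η ^ 2 by
    rw [show 8 * e + 1 + (2 * η) ^ 2 - 1 = 4 * (2 * e + η ^ 2) by ring]; omega,
    show η ^ 2 = 2 * k + η by linear_combination hk]
  push_cast
  linear_combination (e + k : ZMod 4) * four_eq_zero

lemma qlog_sign {γ : GaussianInt} (hre : Odd γ.re) {η σ : ℤ} (him : γ.im = 2 * η)
    (hσ : σ = 0 ∨ σ = 1) : qlog ((1 - 2 * σ : ℤ) : GaussianInt) γ = 2 * σ * η := by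
  have ho := odd_norm_of_odd_re hre ⟨η, by rw [him]; ring⟩
  rcases hσ with rfl | rfl
  · simp [qlog_one_left _ ho]
  · have := qlog_neg_one_of_even_im hre him
    norm_num
    exact this

lemma qlog_two_of_even_im {γ : GaussianInt} (hre : Odd γ.re) {η : ℤ} (him : γ.im = 2 * η)
    (hc : IsCoprime γ.re γ.im) : qlog 2 γ = γ.re * η := by
  rw [qlog_two hre ⟨η, by rw [him]; ring⟩ hc, him, show γ.re * (2 * η) = 2 * (γ.re * η) by ring,
    Int.mul_ediv_cancel_left _ (by norm_num)]
  push_cast; rfl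

lemma qlog_I_four_mul_add_one (n : ℤ) : qlog I ((4 * n + 1 : ℤ) : GaussianInt) = 2 * n := by
  rw [qlog_I_intCast ⟨2 * n, by ring⟩, show (4 * n + 1) ^ 2 - 1 = 4 * (4 * n ^ 2 + 2 * n) by ring,
    Int.mul_ediv_cancel_left _ (by norm_num)]
  push_cast
  linear_combination (n ^ 2 : ZMod 4) * four_eq_zero

/-- The gcd of the coordinates of κ' is odd and divides those of κ. Only odd common divisors of the
latter are excluded, because ω may absorb powers of 2. -/
lemma isCoprime_of_factor {κ ω κ' : GaussianInt} (hκ : κ = ω * κ') (hre : Odd κ'.re)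
    (h : ∀ g : ℤ, Odd g → g ∣ κ.re → g ∣ κ.im → IsUnit g) : IsCoprime κ'.re κ'.im := by
  rw [Int.isCoprime_iff_gcd_eq_one]
  have h1 : ((Int.gcd κ'.re κ'.im : ℤ) : GaussianInt) ∣ κ' :=
    (Zsqrtd.intCast_dvd _ _).mpr ⟨Int.gcd_dvd_left _ _, Int.gcd_dvd_right _ _⟩
  have h2 := (Zsqrtd.intCast_dvd _ _).mp (h1.trans (hκ ▸ dvd_mul_left κ' ω))
  have h3 : Odd (Int.gcd κ'.re κ'.im : ℤ) := by
    obtain ⟨z, hz⟩ := Int.gcd_dvd_left κ'.re κ'.im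
    rw [hz, Int.odd_mul] at hre
    exact hre.1
  have h4 := h _ h3 h2.1 h2.2
  rw [Int.isUnit_iff] at h4
  omega

/-! ### The two representations of p and the sum of symbols -/

/-- The integers `p = c² + d² = x² + q y²`, with `q = a² + b²`, and their parities. -/
structure Representation (p c d x y a b q : ℤ) : Prop where
  prime : Prime p
  sum_sq : p = c ^ 2 + d ^ 2
  form : p = x ^ 2 + q * y ^ 2
  q_eq : q = a ^ 2 + b ^ 2
  one_lt_q : 1 < q
  odd_b : Odd b
  even_a : Even a
  x_ne_zero : x ≠ 0
  y_ne_zero : y ≠ 0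
  c_mod : c % 4 = 1
  even_d : Even d

namespace Representation

variable {p c d x y a b q : ℤ}

lemma norm_π (h : Representation p c d x y a b q) : (⟨c, d⟩ : GaussianInt).norm = p := by
  rw [norm_eq_sq, h.sum_sq]

lemma odd_c (h : Representation p c d x y a b q) : Odd c := by
  have := h.c_mod
  rw [Int.odd_iff]; omega

lemma odd_π (h : Representation p c d x y a b q) : Odd (⟨c, d⟩ : GaussianInt).norm :=
  odd_norm_of_odd_re h.odd_c h.even_d

lemma odd_β (h : Representation p c d x y a b q) : Odd (⟨b, a⟩ : GaussianInt).norm :=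
  odd_norm_of_odd_re h.odd_b h.even_a

lemma norm_β (h : Representation p c d x y a b q) : (⟨b, a⟩ : GaussianInt).norm = q := by
  rw [norm_eq_sq, h.q_eq]; ring

lemma sq_lt_p (h : Representation p c d x y a b q) : x ^ 2 < p ∧ y ^ 2 < p := by
  have h0 : ∀ {z : ℤ}, z ≠ 0 → 0 < z ^ 2 := fun hz => by positivity
  have h1 := h0 h.x_ne_zero
  have h2 := h0 h.y_ne_zero
  have h3 := h.form
  have h4 := h.one_lt_q
  constructor <;> nlinarith

/-- A nonzero multiple of p has square at least p². -/
lemma isCoprime_of_sq_lt (h : Representation p c d x y a b q) {z : ℤ} (hz : z ≠ 0)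
    (hlt : z ^ 2 < p) : IsCoprime z p := by
  refine (h.prime.irreducible.coprime_iff_not_dvd.mpr fun hd => ?_).symm
  have h1 : 0 < z ^ 2 := by positivity
  have h4 := Int.le_of_dvd h1 (pow_dvd_pow_of_dvd hd 2)
  nlinarith

lemma isCoprime_x (h : Representation p c d x y a b q) : IsCoprime x p :=
  h.isCoprime_of_sq_lt h.x_ne_zero h.sq_lt_p.1

lemma isCoprime_y (h : Representation p c d x y a b q) : IsCoprime y p :=
  h.isCoprime_of_sq_lt h.y_ne_zero h.sq_lt_p.2

lemma isCoprime_c_d (h : Representation p c d x y a b q) : IsCoprime c d := by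
  have hd0 : IsCoprime c p := by
    have h0 := h.odd_c
    have hc0 : c ≠ 0 := by rintro rfl; simp at h0
    refine h.isCoprime_of_sq_lt hc0 (lt_of_le_of_ne ?_ fun h2 => ?_)
    · have := h.sum_sq
      nlinarith [sq_nonneg d]
    · exact h.prime.not_isSquare ⟨c, by rw [← h2, sq]⟩
  have h1 := hd0.add_mul_left_right (-c)
  rw [show p + c * -c = d ^ 2 by rw [h.sum_sq]; ring] at h1
  exact (IsCoprime.pow_right_iff (by norm_num)).mp h1

/-- The combination of symbols that is to be evaluated. -/
noncomputable def symbolSum (c d x y a b : ℤ) : ZMod 4 :=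
  qlog x ⟨c, d⟩ + qlog I ⟨c, d⟩ - qlog y ⟨c, d⟩ + qlog x ⟨b, a⟩ - qlog ⟨c, d⟩ ⟨b, a⟩

/-- The comparison with ε = i, κ = c + (x + d)i and E = x + d. Here l records the symbol of ω modulo
integers 4n + 1, σ and σ' the signs of the odd parts of x and E, and u, t, k the powers of 2 in x,
y, E. -/
lemma symbolSum_eq_of_isCoprime_c (h : Representation p c d x y a b q)
    {P Q δ η σ σ' w z e A : ℤ} {l : ZMod 4} {t u k : ℕ} {ω : GaussianInt}
    (hcop : IsCoprime c (x + d)) (hω : ∀ γ : GaussianInt, Odd γ.norm → IsCoprime ω γ)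
    (hl : ∀ n : ℤ, qlog ω ((4 * n + 1 : ℤ) : GaussianInt) = l * n)
    (hκ : (⟨c, x + d⟩ : GaussianInt) = ω * ⟨A, 2 * η⟩) (hA : Odd A)
    (hP : p = 4 * P + 1) (hQ : q = 4 * Q + 1) (hδ : d = 2 * δ)
    (hσ : σ = 0 ∨ σ = 1) (hσ' : σ' = 0 ∨ σ' = 1)
    (hx : x = (1 - 2 * σ) * 2 ^ u * (4 * w + 1)) (hy : y = 2 ^ t * (4 * z + 1))
    (hE : x + d = (1 - 2 * σ') * 2 ^ k * (4 * e + 1)) :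
    symbolSum c d x y a b = P + Q + 2 * z + 2 * σ * δ + (u - t) * δ + 2 * η * (1 - σ - σ')
      + (2 * t - 1 - k - u) * A * η + l * (w + e - Q - 2 * z) := by
  have hc4 : (c : ZMod 4) = 1 := by
    have := (ZMod.intCast_eq_intCast_iff' c 1 4).mpr (by simpa using h.c_mod)
    simpa using this
  have hs : ∀ {σ : ℤ}, (σ = 0 ∨ σ = 1) → ((1 - 2 * σ : ℤ) = 1 ∨ (1 - 2 * σ : ℤ) = -1) := by
    rintro σ (rfl | rfl) <;> simp
  have hcE : IsCoprime ((x + d : ℤ) : GaussianInt) ⟨c, x + d⟩ := by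
    have h1 := (isCoprime_intCast.mpr hcop.symm).add_mul_left_right I
    have h2 : (c : GaussianInt) + ((x + d : ℤ) : GaussianInt) * I = ⟨c, x + d⟩ := by
      ext <;> simp [I]
    rwa [h2] at h1
  have hκ'o : Odd (⟨A, 2 * η⟩ : GaussianInt).norm := odd_norm_of_odd_re hA ⟨η, by simp; ring⟩
  have hκ'c : IsCoprime A (2 * η) := isCoprime_of_factor (κ' := ⟨A, 2 * η⟩) hκ hA
    (fun g _ h1 h2 => hcop.isUnit_of_dvd' h1 h2)
  have main := qlog_comparison (π := ⟨c, d⟩) (κ := ⟨c, x + d⟩) (κ' := ⟨A, 2 * η⟩) (ω := ω) (ε := I)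
    (β := ⟨b, a⟩) (x := x) (y := y) (E := x + d) (q := q) (s := 1 - 2 * σ) (s' := 1 - 2 * σ')
    (x₀ := 4 * w + 1) (y₀ := 4 * z + 1) (e₀ := 4 * e + 1) (t := t) (u := u) (k := k)
    h.odd_π h.even_d hκ'o ⟨η, by simp; ring⟩ h.odd_β h.norm_β hω isUnit_I hκ
    (by ext <;> simp [I]; ring)
    (by
      have hpp := h.form
      rw [h.sum_sq] at hpp
      ext
      · simp [I, pow_two]; linear_combination hpp
      · simp [I, pow_two]; ring)
    (by
      have hpp := h.form
      rw [h.sum_sq] at hpp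
      rw [norm_eq_sq]; simp only; linear_combination hpp)
    (by rw [h.norm_π, h.form]) (by rw [h.norm_π]; exact h.isCoprime_x)
    (by rw [h.norm_π]; exact h.isCoprime_y) (by rw [hκ] at hcE; exact hcE.of_mul_right_right)
    hx hy hE (hs hσ) (hs hσ') (by omega) (by omega) (by omega)
  -- κ ≡ c modulo E, and rational symbols are trivial.
  have e1 : qlog ⟨c, x + d⟩ ((4 * e + 1 : ℤ) : GaussianInt) = 0 := by
    have hoe : Odd (4 * e + 1) := ⟨2 * e, by ring⟩
    rw [qlog_congr (odd_norm_intCast.mpr hoe) (β := (c : GaussianInt)),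
      qlog_intCast_intCast hoe]
    · rw [hE] at hcop; exact hcop.of_mul_right_right
    · refine ⟨((1 - 2 * σ' : ℤ) : GaussianInt) * 2 ^ k * I, ?_⟩
      have h2 : (⟨c, x + d⟩ : GaussianInt) - c = ((x + d : ℤ) : GaussianInt) * I := by
        ext <;> simp [I]
      rw [h2, hE]; push_cast; ring
  have e2 : qlog I (⟨b, a⟩ : GaussianInt) = Q := by
    rw [qlog_I h.odd_β, h.norm_β, hQ, show (4 * Q + 1 - 1) / 4 = Q by omega]
  have e3 : qlog I (⟨c, d⟩ : GaussianInt) = P := by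
    rw [qlog_I h.odd_π, h.norm_π, hP, show (4 * P + 1 - 1) / 4 = P by omega]
  have e4 := qlog_sign (γ := ⟨c, d⟩) h.odd_c hδ hσ
  have e5 := qlog_two_of_even_im (γ := ⟨c, d⟩) h.odd_c hδ h.isCoprime_c_d
  have e6 := qlog_neg_one_of_even_im (γ := ⟨A, 2 * η⟩) hA rfl
  have e7 := qlog_sign (γ := ⟨A, 2 * η⟩) hA rfl hσ
  have e8 := qlog_sign (γ := ⟨A, 2 * η⟩) hA rfl hσ'
  have e9 := qlog_two_of_even_im (γ := ⟨A, 2 * η⟩) hA rfl hκ'c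
  have e10 : qlog ω (q : GaussianInt) = l * Q := by rw [hQ, hl]
  rw [hl, hl, hl, e1, e2, e4, e5, e6, e7, e8, e9, e10, qlog_I_four_mul_add_one] at main
  simp only at main
  rw [hc4] at main
  unfold symbolSum
  rw [e3]
  linear_combination main

/-- The comparison with ε = 1, κ = (x + c) + di and E = x + c. Coprimality with d₀ alone suffices,
as common powers of 2 go into ω. -/
lemma symbolSum_eq_of_isCoprime_d (h : Representation p c d x y a b q)
    {P Q δ η σ σ' w z e A d₀ : ℤ} {l : ZMod 4} {t u k r : ℕ} {ω : GaussianInt}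
    (hd : d = 2 ^ r * d₀)
    (hcop : IsCoprime d₀ (x + c)) (hω : ∀ γ : GaussianInt, Odd γ.norm → IsCoprime ω γ)
    (hl : ∀ n : ℤ, qlog ω ((4 * n + 1 : ℤ) : GaussianInt) = l * n)
    (hκ : (⟨x + c, d⟩ : GaussianInt) = ω * ⟨A, 2 * η⟩) (hA : Odd A)
    (hP : p = 4 * P + 1) (hQ : q = 4 * Q + 1) (hδ : d = 2 * δ)
    (hσ : σ = 0 ∨ σ = 1) (hσ' : σ' = 0 ∨ σ' = 1)
    (hx : x = (1 - 2 * σ) * 2 ^ u * (4 * w + 1)) (hy : y = 2 ^ t * (4 * z + 1))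
    (hE : x + c = (1 - 2 * σ') * 2 ^ k * (4 * e + 1)) :
    symbolSum c d x y a b = P + 2 * σ * δ + (u - t) * δ + 2 * η * (1 - σ - σ')
      + (2 * t - 1 - k - u) * A * η + l * (w + e - Q - 2 * z) - 2 * e := by
  have hc4 : (c : ZMod 4) = 1 := by
    have := (ZMod.intCast_eq_intCast_iff' c 1 4).mpr (by simpa using h.c_mod)
    simpa using this
  have hs : ∀ {σ : ℤ}, (σ = 0 ∨ σ = 1) → ((1 - 2 * σ : ℤ) = 1 ∨ (1 - 2 * σ : ℤ) = -1) := by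
    rintro σ (rfl | rfl) <;> simp
  have hκ'o : Odd (⟨A, 2 * η⟩ : GaussianInt).norm := odd_norm_of_odd_re hA ⟨η, by simp; ring⟩
  -- A common prime factor has odd norm and divides κ - E = di, hence divides d₀ as well as x + c.
  have hcE : IsCoprime ((x + c : ℤ) : GaussianInt) ⟨A, 2 * η⟩ := by
    refine isCoprime_of_prime_dvd (fun h0 => ne_zero_of_odd hκ'o h0.2) fun l hlp h1 h2 => ?_
    have hol := odd_norm_of_dvd h2 hκ'o
    have h3 : l ∣ (⟨x + c, d⟩ : GaussianInt) := hκ ▸ h2.mul_left ω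
    have h4 : l ∣ (d : GaussianInt) * I := by
      have h5 : (d : GaussianInt) * I = ⟨x + c, d⟩ - ((x + c : ℤ) : GaussianInt) := by
        ext <;> simp [I]
      rw [h5]; exact dvd_sub h3 h1
    have h5 : l ∣ (d : GaussianInt) := (hlp.dvd_or_dvd h4).resolve_right
      (not_dvd_of_isCoprime hlp (isCoprime_I l))
    rw [hd] at h5
    push_cast at h5
    rcases hlp.dvd_or_dvd h5 with h6 | h6
    · exact hlp.not_isUnit (isUnit_of_dvd_two_pow hol h6)
    · exact hlp.not_isUnit ((isCoprime_intCast.mpr hcop).isUnit_of_dvd' h6 h1)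
  have hκ'c : IsCoprime A (2 * η) := isCoprime_of_factor (κ' := ⟨A, 2 * η⟩) hκ hA
    (fun g hg h1 h2 => by
      obtain ⟨j, rfl⟩ := hg
      have h3 : IsCoprime (2 * j + 1) (2 ^ r) := IsCoprime.pow_right ⟨1, -j, by ring⟩
      exact hcop.isUnit_of_dvd' (h3.dvd_of_dvd_mul_left (hd ▸ h2)) h1)
  have main := qlog_comparison (π := ⟨c, d⟩) (κ := ⟨x + c, d⟩) (κ' := ⟨A, 2 * η⟩) (ω := ω) (ε := 1)
    (β := ⟨b, a⟩) (x := x) (y := y) (E := x + c) (q := q) (s := 1 - 2 * σ) (s' := 1 - 2 * σ')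
    (x₀ := 4 * w + 1) (y₀ := 4 * z + 1) (e₀ := 4 * e + 1) (t := t) (u := u) (k := k)
    h.odd_π h.even_d hκ'o ⟨η, by simp; ring⟩ h.odd_β h.norm_β hω isUnit_one hκ
    (by ext <;> simp; ring)
    (by
      have hpp := h.form
      rw [h.sum_sq] at hpp
      ext
      · simp [pow_two]; linear_combination -hpp
      · simp [pow_two]; ring)
    (by
      have hpp := h.form
      rw [h.sum_sq] at hpp
      rw [norm_eq_sq]; simp only; linear_combination hpp)
    (by rw [h.norm_π, h.form]) (by rw [h.norm_π]; exact h.isCoprime_x)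
    (by rw [h.norm_π]; exact h.isCoprime_y) hcE
    hx hy hE (hs hσ) (hs hσ') (by omega) (by omega) (by omega)
  -- Now κ ≡ di modulo E; d is rational, and the factor i contributes 2e.
  have e1 : qlog ⟨x + c, d⟩ ((4 * e + 1 : ℤ) : GaussianInt) = 2 * e := by
    have hoe : Odd (4 * e + 1) := ⟨2 * e, by ring⟩
    have hon := odd_norm_intCast.mpr hoe
    have h3 : IsCoprime d (4 * e + 1) := by
      rw [hd]
      rw [hE] at hcop
      refine IsCoprime.mul_left (IsCoprime.pow_left ⟨-2 * e, 1, by ring⟩) hcop.of_mul_right_right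
    rw [qlog_congr hon (β := (d : GaussianInt) * I),
      qlog_mul_left hon (isCoprime_intCast.mpr h3) (isCoprime_I _),
      qlog_intCast_intCast hoe h3, qlog_I_four_mul_add_one, zero_add]
    refine ⟨((1 - 2 * σ' : ℤ) : GaussianInt) * 2 ^ k, ?_⟩
    have h2 : (⟨x + c, d⟩ : GaussianInt) - d * I = ((x + c : ℤ) : GaussianInt) := by
      ext <;> simp [I]
    rw [h2, hE]; push_cast; ring
  have e3 : qlog I (⟨c, d⟩ : GaussianInt) = P := by
    rw [qlog_I h.odd_π, h.norm_π, hP, show (4 * P + 1 - 1) / 4 = P by omega]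
  have e4 := qlog_sign (γ := ⟨c, d⟩) h.odd_c hδ hσ
  have e5 := qlog_two_of_even_im (γ := ⟨c, d⟩) h.odd_c hδ h.isCoprime_c_d
  have e6 := qlog_neg_one_of_even_im (γ := ⟨A, 2 * η⟩) hA rfl
  have e7 := qlog_sign (γ := ⟨A, 2 * η⟩) hA rfl hσ
  have e8 := qlog_sign (γ := ⟨A, 2 * η⟩) hA rfl hσ'
  have e9 := qlog_two_of_even_im (γ := ⟨A, 2 * η⟩) hA rfl hκ'c
  have e10 : qlog ω (q : GaussianInt) = l * Q := by rw [hQ, hl]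
  have e11 := qlog_one_left _ h.odd_β
  have e12 := qlog_one_left ((4 * z + 1 : ℤ) : GaussianInt)
    (odd_norm_intCast.mpr ⟨2 * z, by ring⟩)
  rw [hl, hl, hl, e1, e11, e4, e5, e6, e7, e8, e9, e10, e12] at main
  simp only at main
  rw [hc4] at main
  unfold symbolSum
  rw [e3]
  linear_combination main

end Representation

/-! ### Two-adic parametrizations -/

lemma exists_two_pow_mul {n : ℤ} (hn : n ≠ 0) :
    ∃ (σ : ℤ) (u : ℕ) (m : ℤ), (σ = 0 ∨ σ = 1) ∧ n = (1 - 2 * σ) * 2 ^ u * (4 * m + 1) := by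
  obtain ⟨u, n', hodd, rfl⟩ : ∃ (u : ℕ) (n' : ℤ), Odd n' ∧ n = 2 ^ u * n' := by
    obtain ⟨u, n', hodd, h⟩ := Nat.exists_eq_two_pow_mul_odd (Int.natAbs_ne_zero.mpr hn)
    have hodd' : Odd (n' : ℤ) := by exact_mod_cast hodd
    rcases Int.natAbs_eq n with h' | h'
    · exact ⟨u, n', hodd', by rw [h', h]; push_cast; ring⟩
    · exact ⟨u, -n', hodd'.neg, by rw [h', h]; push_cast; ring⟩
  rw [Int.odd_iff] at hodd
  rcases (by omega : n' % 4 = 1 ∨ n' % 4 = 3) with h | h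
  · obtain ⟨m, rfl⟩ : ∃ m, n' = 4 * m + 1 := ⟨n' / 4, by omega⟩
    exact ⟨0, u, m, Or.inl rfl, by ring⟩
  · obtain ⟨m, rfl⟩ : ∃ m, n' = -(4 * m + 1) := ⟨(-n' - 1) / 4, by omega⟩
    exact ⟨1, u, m, Or.inr rfl, by ring⟩

/-- When a power of 2 is known only to be at least 4, either its exponent is 2 or e is even. This
removes undetermined exponents from the formula for `symbolSum`. -/
lemma exists_mul_eq_two_mul {s o e : ℤ} {k : ℕ} (hs : Odd (s * o))
    (h : s * 2 ^ k * o = 4 * e) : ∃ f, k * e = 2 * f := by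
  match k with
  | 0 => exact ⟨0, by simp⟩
  | 1 =>
    exfalso
    obtain ⟨j, hj⟩ := hs
    have : s * 2 ^ 1 * o = 4 * j + 2 := by linear_combination 2 * hj
    omega
  | 2 => exact ⟨e, by push_cast; ring⟩
  | k + 3 =>
    have : e = 2 * (2 ^ k * (s * o)) := by
      have h1 : 4 * e = 4 * (2 * (2 ^ k * (s * o))) := by rw [← h, pow_add]; ring
      linarith
    exact ⟨((k + 3 : ℕ) : ℤ) * (2 ^ k * (s * o)), by rw [this]; ring⟩

lemma eq_one_of_two_pow_mul {s o e : ℤ} {k : ℕ} (hs : Odd (s * o))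
    (h : s * 2 ^ k * o = 2 * e) (he : Odd e) : k = 1 := by
  match k with
  | 0 =>
    exfalso
    obtain ⟨j, hj⟩ := hs
    have : s * 2 ^ 0 * o = 2 * j + 1 := by linear_combination hj
    omega
  | 1 => rfl
  | k + 2 =>
    exfalso
    have : e = 2 * (2 ^ k * (s * o)) := by
      have h1 : 2 * e = 2 * (2 * (2 ^ k * (s * o))) := by rw [← h, pow_add]; ring
      linarith
    rw [Int.odd_iff] at he
    omega

lemma odd_sign_mul {σ m : ℤ} : Odd ((1 - 2 * σ) * (4 * m + 1)) :=
  Odd.mul ⟨-σ, by ring⟩ ⟨2 * m, by ring⟩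

/-! ### The symbols of `2 ^ n i ^ k (1 + i) ^ l` modulo rational integers -/

lemma odd_norm_four_mul_add_one (m : ℤ) : Odd ((4 * m + 1 : ℤ) : GaussianInt).norm :=
  odd_norm_intCast.mpr ⟨2 * m, by ring⟩

lemma qlog_two_pow (n : ℕ) (m : ℤ) : qlog (2 ^ n) ((4 * m + 1 : ℤ) : GaussianInt) = 0 * m := by
  have h := odd_norm_four_mul_add_one m
  rw [qlog_pow_left h (isCoprime_two h), qlog_two_intCast ⟨2 * m, by ring⟩]; ring

lemma qlog_two_pow_mul (n : ℕ) (m : ℤ) {α : GaussianInt}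
    (hα : ∀ γ : GaussianInt, Odd γ.norm → IsCoprime α γ) :
    qlog (2 ^ n * α) ((4 * m + 1 : ℤ) : GaussianInt) =
      qlog α ((4 * m + 1 : ℤ) : GaussianInt) := by
  have h := odd_norm_four_mul_add_one m
  rw [qlog_mul_left h (isCoprime_two_pow h n) (hα _ h), qlog_two_pow]; ring

lemma isCoprime_two_pow_mul (n : ℕ) {α : GaussianInt}
    (hα : ∀ γ : GaussianInt, Odd γ.norm → IsCoprime α γ) (γ : GaussianInt) (h : Odd γ.norm) :
    IsCoprime (2 ^ n * α) γ :=
  (isCoprime_two_pow h n).mul_left (hα γ h)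

lemma isCoprime_one_sub_I {γ : GaussianInt} (h : Odd γ.norm) : IsCoprime (1 - I) γ := by
  have := isCoprime_two h
  rw [← one_add_I_mul] at this
  exact this.of_mul_left_right

lemma qlog_one_add_I' (m : ℤ) : qlog (1 + I) ((4 * m + 1 : ℤ) : GaussianInt) = 1 * m := by
  rw [qlog_one_add_I (by omega), show (4 * m + 1 - 1) / 4 = m by omega, one_mul]

lemma qlog_one_sub_I (m : ℤ) : qlog (1 - I) ((4 * m + 1 : ℤ) : GaussianInt) = -1 * m := by
  have h := odd_norm_four_mul_add_one m
  have h1 : qlog ((1 + I) * (1 - I)) ((4 * m + 1 : ℤ) : GaussianInt) = 0 := by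
    rw [one_add_I_mul, qlog_two_intCast ⟨2 * m, by ring⟩]
  rw [qlog_mul_left h (isCoprime_one_add_I h) (isCoprime_one_sub_I h), qlog_one_add_I'] at h1
  linear_combination h1

namespace Representation

variable {p c d x y a b q : ℤ} {t : ℕ} {z : ℤ}

lemma exists_params (h : Representation p c d x y a b q) :
    ∃ v δ Q P : ℤ, c = 4 * v + 1 ∧ d = 2 * δ ∧ q = 4 * Q + 1 ∧ p = 4 * P + 1 ∧
      P = 4 * v ^ 2 + 2 * v + δ ^ 2 := by
  have hc := h.c_mod
  obtain ⟨δ, hδ⟩ := h.even_d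
  have hq : q % 4 = 1 := by rw [← h.norm_β]; exact norm_mod_four h.odd_β
  obtain ⟨v, rfl⟩ : ∃ v, c = 4 * v + 1 := ⟨c / 4, by omega⟩
  refine ⟨v, δ, q / 4, 4 * v ^ 2 + 2 * v + δ ^ 2, rfl, by omega, by omega, ?_, rfl⟩
  rw [h.sum_sq, hδ]; ring

lemma even_or_odd_δ {p P v δ : ℤ} (hp : p = 4 * P + 1) (hP : P = 4 * v ^ 2 + 2 * v + δ ^ 2) :
    (p % 8 = 1 → ∃ D, δ = 2 * D) ∧ (p % 8 = 5 → ∃ D, δ = 2 * D + 1) := by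
  rcases Int.even_or_odd' δ with ⟨D, hD | hD⟩
  · refine ⟨fun _ => ⟨D, hD⟩, fun h => ?_⟩
    have : p = 8 * (2 * v ^ 2 + v + 2 * D ^ 2) + 1 := by rw [hp, hP, hD]; ring
    omega
  · refine ⟨fun h => ?_, fun _ => ⟨D, hD⟩⟩
    have : p = 8 * (2 * v ^ 2 + v + 2 * D ^ 2 + 2 * D) + 5 := by rw [hp, hP, hD]; ring
    omega

lemma params_of_even_x (h : Representation p c d x y a b q) (hy : y = 2 ^ t * (4 * z + 1))
    {P Q x' : ℤ} (hp : p = 4 * P + 1) (hQ : q = 4 * Q + 1) (hx : x = 2 * x') :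
    t = 0 ∧ P = x' ^ 2 + (4 * Q + 1) * (4 * z ^ 2 + 2 * z) + Q := by
  have hf := h.form
  have ht : t = 0 := by
    by_contra hk
    obtain ⟨j, rfl⟩ := Nat.exists_eq_succ_of_ne_zero hk
    rw [Nat.succ_eq_add_one, pow_succ] at hy
    rw [hp, hx, hQ, hy] at hf
    have : 2 * (2 * P) + 1 = 2 * (2 * x' ^ 2 + (4 * Q + 1) * (2 * (2 ^ j * (4 * z + 1)) ^ 2)) := by
      linear_combination hf
    omega
  refine ⟨ht, ?_⟩
  rw [hp, hx, hQ, hy, ht] at hf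
  have : 4 * P = 4 * (x' ^ 2 + (4 * Q + 1) * (4 * z ^ 2 + 2 * z) + Q) := by
    linear_combination hf
  linarith

lemma params_of_odd_x (h : Representation p c d x y a b q) (hy : y = 2 ^ t * (4 * z + 1))
    {P Q σ w : ℤ} (hp : p = 4 * P + 1) (hQ : q = 4 * Q + 1) (hσ : σ = 0 ∨ σ = 1)
    (hx : x = (1 - 2 * σ) * (4 * w + 1)) :
    ∃ j, t = j + 1 ∧
      P = 4 * w ^ 2 + 2 * w + (4 * Q + 1) * (2 ^ j * (4 * z + 1)) ^ 2 := by
  have hf := h.form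
  have hx2 : x ^ 2 = 16 * w ^ 2 + 8 * w + 1 := by
    rcases hσ with rfl | rfl <;> rw [hx] <;> ring
  have ht : t ≠ 0 := by
    rintro rfl
    rw [hp, hx2, hQ, hy] at hf
    have : 4 * P + 1 = 2 * (8 * w ^ 2 + 4 * w + 1 + 2 * Q + 4 * (4 * Q + 1) * (2 * z ^ 2 + z)) := by
      linear_combination hf
    omega
  obtain ⟨j, rfl⟩ := Nat.exists_eq_succ_of_ne_zero ht
  refine ⟨j, rfl, ?_⟩
  rw [Nat.succ_eq_add_one, pow_succ] at hy
  rw [hp, hx2, hQ, hy] at hf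
  have : 4 * P = 4 * (4 * w ^ 2 + 2 * w + (4 * Q + 1) * (2 ^ j * (4 * z + 1)) ^ 2) := by
    linear_combination hf
  linarith

/-! ### Evaluation when `c` is prime to `x + d` -/

lemma add_ne_zero_of_isCoprime_c (h : Representation p c d x y a b q)
    (hcop : IsCoprime c (x + d)) : x + d ≠ 0 := by
  intro h0
  rw [h0, isCoprime_zero_right, Int.isUnit_iff] at hcop
  have h1 : c ^ 2 = 1 := by rcases hcop with h | h <;> rw [h] <;> norm_num
  have h2 := h.form
  rw [h.sum_sq, h1, show x = -d by linarith] at h2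
  have h3 : 0 < y ^ 2 := by have := h.y_ne_zero; positivity
  have := h.one_lt_q
  nlinarith

/-- κ has odd real and even imaginary part, so ω = 1. Comparing the two forms of p modulo 8 shows
that x/2 has the parity of (q - 1)/4. -/
lemma eval_c_one_even (h : Representation p c d x y a b q) (hy : y = 2 ^ t * (4 * z + 1))
    (hcop : IsCoprime c (x + d)) (hp8 : p % 8 = 1) (hxe : Even x) :
    (q % 8 = 1 → symbolSum c d x y a b = 2 * (d / 4 + x / 4 : ℤ)) ∧
      (q % 8 = 5 → symbolSum c d x y a b = 2 + 2 * (d / 4 + (x - 2) / 4 : ℤ)) := by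
  obtain ⟨v, δ, Q, P, rfl, rfl, hQ, hP, hPv⟩ := h.exists_params
  obtain ⟨D, rfl⟩ := (even_or_odd_δ hP hPv).1 hp8
  obtain ⟨x', hx'⟩ := hxe
  rw [← two_mul] at hx'
  obtain ⟨rfl, hPx⟩ := h.params_of_even_x hy hP hQ hx'
  obtain ⟨σ, u, w, hσ, hx⟩ := exists_two_pow_mul h.x_ne_zero
  obtain ⟨σ', k, e, hσ', hE⟩ := exists_two_pow_mul (h.add_ne_zero_of_isCoprime_c hcop)
  have main := h.symbolSum_eq_of_isCoprime_c (ω := 1) (l := 0) (η := x' + 2 * D) hcop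
    (fun γ _ => isCoprime_one_left)
    (fun n => by simpa using qlog_two_pow 0 n)
    (by rw [one_mul]; ext <;> simp; rw [hx']; ring) h.odd_c hP hQ rfl hσ hσ' hx hy hE
  have hPc := congrArg (Int.cast (R := ZMod 4)) hPx
  push_cast at main hPc
  constructor
  · intro hq
    obtain ⟨Q', rfl⟩ : ∃ Q', Q = 2 * Q' := ⟨Q / 2, by omega⟩
    obtain ⟨x₁, rfl⟩ : ∃ x₁, x' = 2 * x₁ := by
      rcases Int.even_or_odd' x' with ⟨j, hj | hj⟩
      · exact ⟨j, hj⟩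
      · exfalso
        rw [hPv, hj] at hPx
        have : 2 * (2 * v ^ 2 + v + 2 * D ^ 2) = 2 * (2 * j ^ 2 + 2 * j +
          (8 * Q' + 1) * (2 * z ^ 2 + z) + Q') + 1 := by linear_combination hPx
        omega
    obtain ⟨f, hf⟩ := exists_mul_eq_two_mul (e := x₁ + D) odd_sign_mul
      (hE.symm.trans (by rw [hx']; ring))
    obtain ⟨g, hg⟩ := exists_mul_eq_two_mul (e := x₁) odd_sign_mul
      (hx.symm.trans (by rw [hx']; ring))
    rw [show 2 * (2 * D) / 4 = D by omega, show x / 4 = x₁ by omega]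
    have hf' := congrArg (Int.cast (R := ZMod 4)) hf
    have hg' := congrArg (Int.cast (R := ZMod 4)) hg
    push_cast at main hPc hf' hg' ⊢
    linear_combination (norm := (ring_nf; reduce_mod_char)) main + hPc - 2 * hf' - 2 * hg'
  · intro hq
    obtain ⟨Q', rfl⟩ : ∃ Q', Q = 2 * Q' + 1 := ⟨Q / 2, by omega⟩
    obtain ⟨x₂, rfl⟩ : ∃ x₂, x' = 2 * x₂ + 1 := by
      rcases Int.even_or_odd' x' with ⟨j, hj | hj⟩
      · exfalso
        rw [hPv, hj] at hPx
        have : 2 * (2 * v ^ 2 + v + 2 * D ^ 2) = 2 * (2 * j ^ 2 +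
          (8 * Q' + 5) * (2 * z ^ 2 + z) + Q') + 1 := by linear_combination hPx
        omega
      · exact ⟨j, hj⟩
    -- Both x and x + d are twice an odd number, so u = k = 1, and their odd parts determine the
    -- signs σ and σ'.
    have hu := eq_one_of_two_pow_mul (e := 2 * x₂ + 1) odd_sign_mul (hx.symm.trans hx') ⟨x₂, rfl⟩
    have hk := eq_one_of_two_pow_mul (e := 2 * (x₂ + D) + 1) odd_sign_mul
      (hE.symm.trans (by rw [hx']; ring)) ⟨_, rfl⟩
    subst hu hk
    have h1 : x₂ = 2 * w - σ - 4 * σ * w := by linarith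
    have h2 : x₂ + D = 2 * e - σ' - 4 * σ' * e := by linarith
    rw [show 2 * (2 * D) / 4 = D by omega, show (x - 2) / 4 = x₂ by omega]
    have h1' := congrArg (Int.cast (R := ZMod 4)) h1
    have h2' := congrArg (Int.cast (R := ZMod 4)) h2
    push_cast at main hPc h1' h2' ⊢
    linear_combination (norm := (ring_nf; reduce_mod_char)) main + hPc + 2 * h1' + 2 * h2'

end Representation

lemma two_mul_sq_zmod_four (n : ℤ) : 2 * (n : ZMod 4) ^ 2 = 2 * n := by
  generalize (n : ZMod 4) = m
  revert m; decide

lemma eq_of_two_pow_mul_odd {r : ℕ} {d₀ δ : ℤ} (hd₀ : Odd d₀) (h : 2 ^ r * d₀ = 2 * δ)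
    (hδ : Odd δ) : r = 1 ∧ d₀ = δ := by
  have hr := eq_one_of_two_pow_mul (s := 1) (by simpa using hd₀) (by simpa using h) hδ
  subst hr
  exact ⟨rfl, by linarith⟩

lemma exists_of_odd {n : ℤ} (hn : Odd n) :
    ∃ σ m : ℤ, (σ = 0 ∨ σ = 1) ∧ n = (1 - 2 * σ) * (4 * m + 1) := by
  rw [Int.odd_iff] at hn
  rcases (by omega : n % 4 = 1 ∨ n % 4 = 3) with h | h
  · exact ⟨0, n / 4, Or.inl rfl, by omega⟩
  · exact ⟨1, (-n - 1) / 4, Or.inr rfl, by omega⟩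

lemma qlog_one_add_sign_mul_I {σ : ℤ} (hσ : σ = 0 ∨ σ = 1) (n : ℤ) :
    qlog (1 + ((1 - 2 * σ : ℤ) : GaussianInt) * I) ((4 * n + 1 : ℤ) : GaussianInt) =
      (1 - 2 * σ : ℤ) * n := by
  rcases hσ with rfl | rfl
  · have := qlog_one_add_I' n
    norm_num at this ⊢
    exact this
  · have := qlog_one_sub_I n
    norm_num at this ⊢
    rw [← this, sub_eq_add_neg]

lemma isCoprime_one_add_sign_mul_I {σ : ℤ} (hσ : σ = 0 ∨ σ = 1) (γ : GaussianInt)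
    (h : Odd γ.norm) : IsCoprime (1 + ((1 - 2 * σ : ℤ) : GaussianInt) * I) γ := by
  rcases hσ with rfl | rfl
  · have := isCoprime_one_add_I h
    norm_num
    exact this
  · have := isCoprime_one_sub_I h
    norm_num
    rwa [← sub_eq_add_neg]

namespace Representation

variable {p c d x y a b q : ℤ} {t r : ℕ} {z d₀ : ℤ}

/-- Both coordinates of κ are odd, so ω = 1 ± i; the sign is that of the class of E modulo 4, which
makes the imaginary part of κ' even. As 4 ∣ d, this is also the class of x. -/
lemma eval_c_one_odd (h : Representation p c d x y a b q) (hy : y = 2 ^ t * (4 * z + 1))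
    (hcop : IsCoprime c (x + d)) (hp8 : p % 8 = 1) (hxo : Odd x) :
    (q % 8 = 1 → symbolSum c d x y a b = 2 * (d / 4 + y / 4 : ℤ)) ∧
      (q % 8 = 5 → symbolSum c d x y a b = 2 * (d / 4 + y / 4 : ℤ) + (x - 1)) := by
  obtain ⟨v, δ, Q, P, rfl, rfl, hQ, hP, hPv⟩ := h.exists_params
  obtain ⟨D, rfl⟩ := (even_or_odd_δ hP hPv).1 hp8
  obtain ⟨σ, w, hσ, hx⟩ := exists_of_odd hxo
  obtain ⟨j, rfl, hPx⟩ := h.params_of_odd_x hy hP hQ hσ hx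
  obtain ⟨e, he⟩ : ∃ e, e = w + (1 - 2 * σ) * D := ⟨_, rfl⟩
  obtain ⟨Y, hY⟩ : ∃ Y, 2 ^ j * (4 * z + 1) = 2 * Y := by
    rcases Int.even_or_odd' (2 ^ j * (4 * z + 1)) with ⟨Y, hY | hY⟩
    · exact ⟨Y, hY⟩
    · exfalso
      rw [hPv, hY] at hPx
      have : 2 * (2 * v ^ 2 + v + 2 * D ^ 2) = 2 * (2 * w ^ 2 + w + 2 * Q +
        (4 * Q + 1) * (2 * Y ^ 2 + 2 * Y)) + 1 := by linear_combination hPx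
      omega
  have hy4 : y / 4 = Y := by
    rw [hy, pow_succ, show (2 : ℤ) ^ j * 2 * (4 * z + 1) = 4 * Y by linear_combination 2 * hY]
    omega
  -- Equating the two expressions for P forces v ≡ w (mod 2); `hg2` is the same equation after
  -- division.
  obtain ⟨g, hg⟩ : ∃ g, v - w = 2 * g := by
    refine ⟨w ^ 2 + (4 * Q + 1) * Y ^ 2 - v ^ 2 - D ^ 2, ?_⟩
    rw [hPv, hY] at hPx
    linarith
  have hg2 : 4 * w * g + 4 * g ^ 2 + g + D ^ 2 = (4 * Q + 1) * Y ^ 2 := by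
    rw [hPv, hY, show v = w + 2 * g by linarith] at hPx
    linarith
  have hE : x + 2 * (2 * D) = (1 - 2 * σ) * 2 ^ 0 * (4 * e + 1) := by
    rw [hx, he]
    rcases hσ with rfl | rfl <;> ring
  obtain rfl : v = w + 2 * g := by linarith
  rw [hY] at hPx
  have main := h.symbolSum_eq_of_isCoprime_c (ω := 1 + ((1 - 2 * σ : ℤ) : GaussianInt) * I)
    (l := (1 - 2 * σ : ℤ)) (η := (1 - 2 * σ) * (e - (w + 2 * g))) (A := 2 * (w + 2 * g) + 2 * e + 1) (u := 0) (w := w) hcop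
    (isCoprime_one_add_sign_mul_I hσ) (qlog_one_add_sign_mul_I hσ)
    (by
      rcases hσ with rfl | rfl <;> ext <;> simp [I, hE] <;> ring)
    ⟨w + 2 * g + e, by ring⟩ hP hQ rfl hσ hσ (by rw [hx]; ring) hy hE
  have hPc := congrArg (Int.cast (R := ZMod 4)) hPx
  have hg2c := congrArg (Int.cast (R := ZMod 4)) hg2
  have hxc := congrArg (Int.cast (R := ZMod 4)) hx
  have hY2 := two_mul_sq_zmod_four Y
  rw [hy4, show 2 * (2 * D) / 4 = D by omega]
  constructor
  · intro hq
    obtain ⟨Q', rfl⟩ : ∃ Q', Q = 2 * Q' := ⟨Q / 2, by omega⟩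
    rcases hσ with rfl | rfl <;> subst he <;> push_cast at main hPc hg2c hxc ⊢ <;>
      linear_combination (norm := (ring_nf; reduce_mod_char)) main + hPc + 2 * hg2c + hY2
  · intro hq
    obtain ⟨Q', rfl⟩ : ∃ Q', Q = 2 * Q' + 1 := ⟨Q / 2, by omega⟩
    rcases hσ with rfl | rfl <;> subst he <;> push_cast at main hPc hg2c hxc ⊢ <;>
      linear_combination (norm := (ring_nf; reduce_mod_char)) main + hPc + 2 * hg2c + hY2 - hxc

/-- Again ω = 1, but d ≡ 2 (mod 4): exactly one of x and x + d is divisible by 4, and q modulo 8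
decides which. -/
lemma eval_c_five_even (h : Representation p c d x y a b q) (hy : y = 2 ^ t * (4 * z + 1))
    (hd : d = 2 ^ r * d₀) (hd₀ : d₀ % 4 = 1)
    (hcop : IsCoprime c (x + d)) (hp8 : p % 8 = 5) (hxe : Even x) :
    (q % 8 = 1 → symbolSum c d x y a b = 2 * ((x - 2) / 4 : ℤ) + 2) ∧
      (q % 8 = 5 → symbolSum c d x y a b = 2 * (x / 4 : ℤ) + 2) := by
  obtain ⟨v, δ, Q, P, rfl, hδ, hQ, hP, hPv⟩ := h.exists_params
  obtain ⟨-, rfl⟩ := eq_of_two_pow_mul_odd (Int.odd_iff.mpr (by omega)) (hd.symm.trans hδ)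
    ((even_or_odd_δ hP hPv).2 hp8)
  obtain ⟨D, rfl⟩ : ∃ D, d₀ = 4 * D + 1 := ⟨d₀ / 4, by omega⟩
  clear hd hd₀
  obtain rfl := hδ
  obtain ⟨x', hx'⟩ := hxe
  rw [← two_mul] at hx'
  obtain ⟨rfl, hPx⟩ := h.params_of_even_x hy hP hQ hx'
  obtain ⟨σ, u, w, hσ, hx⟩ := exists_two_pow_mul h.x_ne_zero
  obtain ⟨σ', k, e, hσ', hE⟩ := exists_two_pow_mul (h.add_ne_zero_of_isCoprime_c hcop)
  have main := h.symbolSum_eq_of_isCoprime_c (ω := 1) (l := 0) (η := x' + (4 * D + 1)) hcop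
    (fun γ _ => isCoprime_one_left)
    (fun n => by simpa using qlog_two_pow 0 n)
    (by rw [one_mul]; ext <;> simp; rw [hx']; ring) h.odd_c hP hQ rfl hσ hσ' hx hy hE
  have hPc := congrArg (Int.cast (R := ZMod 4)) hPx
  have hPc' := congrArg (Int.cast (R := ZMod 4)) hPv
  push_cast at main hPc
  constructor
  · intro hq
    obtain ⟨Q', rfl⟩ : ∃ Q', Q = 2 * Q' := ⟨Q / 2, by omega⟩
    obtain ⟨x₁, rfl⟩ : ∃ x₁, x' = 2 * x₁ + 1 := by
      rcases Int.even_or_odd' x' with ⟨j, hj | hj⟩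
      · exfalso
        rw [hPv, hj] at hPx
        have : 2 * (2 * v ^ 2 + v + 8 * D ^ 2 + 4 * D) + 1 = 2 * (2 * j ^ 2 +
          (8 * Q' + 1) * (2 * z ^ 2 + z) + Q') := by linear_combination hPx
        omega
      · exact ⟨j, hj⟩
    have hu := eq_one_of_two_pow_mul (e := 2 * x₁ + 1) odd_sign_mul (hx.symm.trans hx') ⟨x₁, rfl⟩
    obtain ⟨f, hf⟩ := exists_mul_eq_two_mul (e := x₁ + 2 * D + 1) odd_sign_mul
      (hE.symm.trans (by rw [hx']; ring))
    subst hu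
    rw [show (x - 2) / 4 = x₁ by omega]
    have h1 : x₁ = 2 * w - σ - 4 * σ * w := by linarith
    have hf' := congrArg (Int.cast (R := ZMod 4)) hf
    have h1' := congrArg (Int.cast (R := ZMod 4)) h1
    push_cast at main hPc hPc' hf' h1' ⊢
    linear_combination (norm := (ring_nf; reduce_mod_char)) main + hPc + 2 * h1' - 2 * hf'
  · intro hq
    obtain ⟨Q', rfl⟩ : ∃ Q', Q = 2 * Q' + 1 := ⟨Q / 2, by omega⟩
    obtain ⟨x₁, rfl⟩ : ∃ x₁, x' = 2 * x₁ := by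
      rcases Int.even_or_odd' x' with ⟨j, hj | hj⟩
      · exact ⟨j, hj⟩
      · exfalso
        rw [hPv, hj] at hPx
        have : 2 * (2 * v ^ 2 + v + 8 * D ^ 2 + 4 * D) + 1 = 2 * (2 * j ^ 2 + 2 * j + 1 +
          (8 * Q' + 5) * (2 * z ^ 2 + z) + Q') := by linear_combination hPx
        omega
    have hk := eq_one_of_two_pow_mul (e := 2 * (x₁ + 2 * D) + 1) odd_sign_mul
      (hE.symm.trans (by rw [hx']; ring)) ⟨_, rfl⟩
    obtain ⟨f, hf⟩ := exists_mul_eq_two_mul (e := x₁) odd_sign_mul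
      (hx.symm.trans (by rw [hx']; ring))
    subst hk
    rw [show x / 4 = x₁ by omega]
    have h1 : x₁ + 2 * D = 2 * e - σ' - 4 * σ' * e := by linarith
    have hf' := congrArg (Int.cast (R := ZMod 4)) hf
    have h1' := congrArg (Int.cast (R := ZMod 4)) h1
    push_cast at main hPc hPc' hf' h1' ⊢
    linear_combination (norm := (ring_nf; reduce_mod_char)) main + hPc - 2 * h1' - 2 * hf'

/-- Since d/2 is odd, so is y/2; equating the two forms of p then relates c to the normalized odd
part of x. -/
lemma params_five_odd {P Q v w D z : ℤ} {j : ℕ} (hP : P = 4 * v ^ 2 + 2 * v + (4 * D + 1) ^ 2)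
    (hPx : P = 4 * w ^ 2 + 2 * w + (4 * Q + 1) * (2 ^ j * (4 * z + 1)) ^ 2) :
    j = 0 ∧ ∃ g, v - w = 2 * g ∧
      g + 4 * w * g + 4 * g ^ 2 + 4 * D ^ 2 + 2 * D = Q + (4 * Q + 1) * (4 * z ^ 2 + 2 * z) := by
  have hj : j = 0 := by
    by_contra hj
    obtain ⟨i, rfl⟩ := Nat.exists_eq_succ_of_ne_zero hj
    rw [Nat.succ_eq_add_one, pow_succ, hP] at hPx
    have : 2 * (2 * v ^ 2 + v + 8 * D ^ 2 + 4 * D) + 1 =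
        2 * (2 * w ^ 2 + w + 2 * ((4 * Q + 1) * (2 ^ i * (4 * z + 1)) ^ 2)) := by
      linear_combination hPx
    omega
  subst hj
  rw [hP] at hPx
  obtain ⟨g, hg⟩ : ∃ g, v - w = 2 * g :=
    ⟨w ^ 2 + Q + (4 * Q + 1) * (4 * z ^ 2 + 2 * z) - v ^ 2 - 4 * D ^ 2 - 2 * D, by linarith⟩
  refine ⟨rfl, g, hg, ?_⟩
  rw [show v = w + 2 * g by linarith] at hPx
  linarith

lemma eval_c_five_odd (h : Representation p c d x y a b q) (hy : y = 2 ^ t * (4 * z + 1))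
    (hd : d = 2 ^ r * d₀) (hd₀ : d₀ % 4 = 1)
    (hcop : IsCoprime c (x + d)) (hp8 : p % 8 = 5) (hxo : Odd x) :
    (q % 8 = 1 → symbolSum c d x y a b = x - 1) ∧ (q % 8 = 5 → symbolSum c d x y a b = 0) := by
  obtain ⟨v, δ, Q, P, rfl, hδ, hQ, hP, hPv⟩ := h.exists_params
  obtain ⟨-, rfl⟩ := eq_of_two_pow_mul_odd (Int.odd_iff.mpr (by omega)) (hd.symm.trans hδ)
    ((even_or_odd_δ hP hPv).2 hp8)
  obtain ⟨D, rfl⟩ : ∃ D, d₀ = 4 * D + 1 := ⟨d₀ / 4, by omega⟩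
  clear hd hd₀
  obtain rfl := hδ
  obtain ⟨σ, w, hσ, hx⟩ := exists_of_odd hxo
  obtain ⟨j, rfl, hPx⟩ := h.params_of_odd_x hy hP hQ hσ hx
  obtain ⟨rfl, g, hg, hg2⟩ := params_five_odd hPv hPx
  -- Adding d ≡ 2 (mod 4) interchanges the classes 1 and 3 modulo 4, so E and x have opposite signs.
  obtain ⟨σ', hσ''⟩ : ∃ σ', σ' = 1 - σ := ⟨_, rfl⟩
  have hσ' : σ' = 0 ∨ σ' = 1 := by omega
  obtain ⟨e, he⟩ : ∃ e, e = -w + (1 - 2 * σ') * (2 * D) - σ' := ⟨_, rfl⟩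
  have hE : x + 2 * (4 * D + 1) = (1 - 2 * σ') * 2 ^ 0 * (4 * e + 1) := by
    rw [hx, he, hσ'']
    rcases hσ with rfl | rfl <;> ring
  obtain rfl : v = w + 2 * g := by linarith
  have main := h.symbolSum_eq_of_isCoprime_c (ω := 1 + ((1 - 2 * σ' : ℤ) : GaussianInt) * I)
    (l := (1 - 2 * σ' : ℤ)) (η := (1 - 2 * σ') * (e - (w + 2 * g))) (A := 2 * (w + 2 * g) + 2 * e + 1) (u := 0) (w := w) hcop
    (isCoprime_one_add_sign_mul_I hσ') (qlog_one_add_sign_mul_I hσ')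
    (by
      rcases hσ' with h | h <;> ext <;> simp [I, hE, h] <;> ring)
    ⟨w + 2 * g + e, by ring⟩ hP hQ rfl hσ hσ' (by rw [hx]; ring) hy hE
  have hPc := congrArg (Int.cast (R := ZMod 4)) hPx
  have hg2c := congrArg (Int.cast (R := ZMod 4)) hg2
  have hxc := congrArg (Int.cast (R := ZMod 4)) hx
  constructor
  · intro hq
    obtain ⟨Q', rfl⟩ : ∃ Q', Q = 2 * Q' := ⟨Q / 2, by omega⟩
    rcases hσ with rfl | rfl <;> subst hσ'' he <;>
      push_cast at main hPc hg2c hxc ⊢ <;>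
      linear_combination (norm := (ring_nf; reduce_mod_char)) main + hPc + 2 * hg2c - hxc
  · intro hq
    obtain ⟨Q', rfl⟩ : ∃ Q', Q = 2 * Q' + 1 := ⟨Q / 2, by omega⟩
    rcases hσ with rfl | rfl <;> subst hσ'' he <;>
      push_cast at main hPc hg2c hxc ⊢ <;>
      linear_combination (norm := (ring_nf; reduce_mod_char)) main + hPc + 2 * hg2c

end Representation

/-! ### Evaluation when d₀ is prime to x + c -/

lemma two_pow_mul_mk (n : ℕ) (A B : ℤ) :
    (2 ^ n : GaussianInt) * ⟨A, B⟩ = ⟨2 ^ n * A, 2 ^ n * B⟩ := by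
  have : (2 ^ n : GaussianInt) = ((2 ^ n : ℤ) : GaussianInt) := by push_cast; rfl
  rw [this]
  generalize (2 : ℤ) ^ n = m
  ext <;> simp

lemma I_mul_mk (A B : ℤ) : I * ⟨A, B⟩ = ⟨-B, A⟩ := by ext <;> simp [I]

lemma one_add_I_mul_mk (A B : ℤ) : (1 + I) * ⟨A, B⟩ = ⟨A - B, A + B⟩ := by
  ext <;> simp [I] <;> ring

lemma qlog_two_pow_mul_I (n : ℕ) (m : ℤ) :
    qlog (2 ^ n * I) ((4 * m + 1 : ℤ) : GaussianInt) = 2 * m := by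
  rw [qlog_two_pow_mul n m fun γ _ => isCoprime_I γ, qlog_I_four_mul_add_one]

lemma qlog_two_pow_mul_one_add_I (n : ℕ) (m : ℤ) :
    qlog (2 ^ n * (1 + I)) ((4 * m + 1 : ℤ) : GaussianInt) = 1 * m := by
  rw [qlog_two_pow_mul n m fun γ => isCoprime_one_add_I, qlog_one_add_I']

lemma le_of_two_pow_mul_eq {k n : ℕ} {s e : ℤ} (hs : Odd s) (h : s * 2 ^ k = 2 ^ n * e) :
    n ≤ k := by
  by_contra hk
  obtain ⟨j, rfl⟩ := Nat.exists_eq_add_of_lt (not_le.mp hk)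
  rw [pow_add, pow_add] at h
  have h1 : s = 2 * (2 ^ j * e) := by
    have h2 : (2 : ℤ) ^ k ≠ 0 := by positivity
    refine mul_right_cancel₀ h2 (h.trans ?_)
    ring
  rw [h1, Int.odd_iff] at hs
  omega

lemma eq_of_two_pow_mul_eq {k n : ℕ} {s e : ℤ} (hs : Odd s) (he : Odd e)
    (h : s * 2 ^ k = 2 ^ n * e) : k = n :=
  le_antisymm (le_of_two_pow_mul_eq (s := e) (e := s) he (by linarith))
    (le_of_two_pow_mul_eq hs h)

lemma dvd_of_mul_odd_eq {n : ℕ} {g o m : ℤ} (ho : Odd o) (h : g * o = 2 ^ n * m) :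
    ∃ G, g = 2 ^ n * G ∧ G * o = m := by
  have h1 : IsCoprime ((2 : ℤ) ^ n) o := by
    obtain ⟨j, rfl⟩ := ho
    exact IsCoprime.pow_left ⟨-j, 1, by ring⟩
  obtain ⟨G, rfl⟩ := h1.dvd_of_dvd_mul_right ⟨m, h⟩
  refine ⟨G, rfl, mul_left_cancel₀ (pow_ne_zero n (two_ne_zero (α := ℤ))) ?_⟩
  linarith

lemma two_mul_two_pow_mul_exponent (i : ℕ) : (2 * i * 2 ^ i : ZMod 4) = 0 := by
  cases i with
  | zero => simp
  | succ i => rw [pow_succ]; linear_combination ((i + 1 : ℕ) * 2 ^ i : ZMod 4) * four_eq_zero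

lemma two_mul_four_pow (j : ℕ) : (2 * 4 ^ j : ZMod 4) = 2 * 2 ^ j := by
  cases j with
  | zero => simp
  | succ j =>
    rw [pow_succ, pow_succ]; linear_combination (2 * 4 ^ j - 2 ^ j : ZMod 4) * four_eq_zero

namespace Representation

variable {p c d x y a b q : ℤ} {t r : ℕ} {z d₀ : ℤ}

lemma add_ne_zero_of_isCoprime_d (h : Representation p c d x y a b q) (hd : d = 2 ^ r * d₀)
    (hcop : IsCoprime d₀ (x + c)) : x + c ≠ 0 := by
  intro h0
  rw [h0, isCoprime_zero_right, Int.isUnit_iff] at hcop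
  have h1 : d₀ ^ 2 = 1 := by rcases hcop with h | h <;> rw [h] <;> norm_num
  have h2 := h.form
  rw [h.sum_sq, show x = -c by linarith, hd] at h2
  have h3 : q ∣ (2 ^ r) ^ 2 := ⟨y ^ 2, by linear_combination h2 - (2 ^ r) ^ 2 * h1⟩
  have h4 : IsCoprime q ((2 ^ r) ^ 2) := by
    have hq : Odd q := by rw [← h.norm_β]; exact h.odd_β
    obtain ⟨j, hj⟩ := hq
    exact IsCoprime.pow_right (IsCoprime.pow_right ⟨1, -j, by rw [hj]; ring⟩)
  have h5 := h4.isUnit_of_dvd' dvd_rfl h3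
  rw [Int.isUnit_iff] at h5
  have := h.one_lt_q
  omega

lemma even_add_of_even_x (h : Representation p c d x y a b q) (hy : y = 2 ^ t * (4 * z + 1))
    {P Q x' v δ : ℤ} (hp : p = 4 * P + 1) (hQ : q = 4 * Q + 1) (hx : x = 2 * x')
    (hP : P = 4 * v ^ 2 + 2 * v + δ ^ 2) :
    t = 0 ∧ Even (x' + Q + δ) := by
  obtain ⟨rfl, hPx⟩ := h.params_of_even_x hy hp hQ hx
  refine ⟨rfl, ?_⟩
  have : Even (x' ^ 2 + Q + δ ^ 2) :=
    ⟨2 * v ^ 2 + v + δ ^ 2 - (4 * Q + 1) * (2 * z ^ 2 + z), by linarith⟩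
  simpa [Int.even_add, Int.even_pow] using this

/-- Here E = x + c is odd, so ω = 1 and k = 0; the sign of E is read off from the parity of x/2. -/
lemma eval_d_one_even (h : Representation p c d x y a b q) (hy : y = 2 ^ t * (4 * z + 1))
    (hd : d = 2 ^ r * d₀) (hcop : IsCoprime d₀ (x + c)) (hp8 : p % 8 = 1) (hxe : Even x) :
    (q % 8 = 1 → symbolSum c d x y a b = 2 * (d / 4 + x / 4 : ℤ)) ∧
      (q % 8 = 5 → symbolSum c d x y a b = 2 + 2 * (d / 4 + (x - 2) / 4 : ℤ)) := by
  obtain ⟨v, δ, Q, P, rfl, rfl, hQ, hP, hPv⟩ := h.exists_params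
  obtain ⟨D, rfl⟩ := (even_or_odd_δ hP hPv).1 hp8
  obtain ⟨x', hx'⟩ := hxe
  rw [← two_mul] at hx'
  obtain ⟨rfl, hpar⟩ := h.even_add_of_even_x hy hP hQ hx' hPv
  rw [Int.even_iff] at hpar
  obtain ⟨σ, u, w, hσ, hx⟩ := exists_two_pow_mul h.x_ne_zero
  have main := fun {σ' e : ℤ} (hσ' : σ' = 0 ∨ σ' = 1)
      (hE : x + (4 * v + 1) = (1 - 2 * σ') * 2 ^ 0 * (4 * e + 1)) =>
    h.symbolSum_eq_of_isCoprime_d (ω := 1) (l := 0) (η := 2 * D) hd hcop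
    (fun γ _ => isCoprime_one_left)
    (fun n => by simpa using qlog_two_pow 0 n)
    (one_mul _).symm ⟨x' + 2 * v, by rw [hx']; ring⟩ hP hQ rfl hσ hσ' hx hy hE
  have hPc := congrArg (Int.cast (R := ZMod 4)) hPv
  rw [show 2 * (2 * D) / 4 = D by omega]
  constructor
  · intro hq
    obtain ⟨x₁, rfl⟩ : ∃ x₁, x' = 2 * x₁ := ⟨x' / 2, by omega⟩
    specialize main (σ' := 0) (e := x₁ + v) (Or.inl rfl) (by rw [hx']; ring)
    rw [show x / 4 = x₁ by omega]
    have hxc := congrArg (Int.cast (R := ZMod 4)) hx'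
    push_cast at main hPc hxc ⊢
    rw [hxc] at main
    linear_combination (norm := (ring_nf; reduce_mod_char)) main + hPc
  · intro hq
    obtain ⟨x₁, rfl⟩ : ∃ x₁, x' = 2 * x₁ + 1 := ⟨x' / 2, by omega⟩
    specialize main (σ' := 1) (e := -(x₁ + v) - 1) (Or.inr rfl) (by rw [hx']; ring)
    rw [show (x - 2) / 4 = x₁ by omega]
    have hxc := congrArg (Int.cast (R := ZMod 4)) hx'
    push_cast at main hPc hxc ⊢
    rw [hxc] at main
    linear_combination (norm := (ring_nf; reduce_mod_char)) main + hPc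

lemma eval_d_five_even (h : Representation p c d x y a b q) (hy : y = 2 ^ t * (4 * z + 1))
    (hd : d = 2 ^ r * d₀) (hd₀ : d₀ % 4 = 1)
    (hcop : IsCoprime d₀ (x + c)) (hp8 : p % 8 = 5) (hxe : Even x) :
    (q % 8 = 1 → symbolSum c d x y a b = 2 * ((x - 2) / 4 : ℤ) + 2) ∧
      (q % 8 = 5 → symbolSum c d x y a b = 2 * (x / 4 : ℤ) + 2) := by
  obtain ⟨v, δ, Q, P, rfl, hδ, hQ, hP, hPv⟩ := h.exists_params
  obtain ⟨-, rfl⟩ := eq_of_two_pow_mul_odd (Int.odd_iff.mpr (by omega)) (hd.symm.trans hδ)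
    ((even_or_odd_δ hP hPv).2 hp8)
  obtain ⟨D, rfl⟩ : ∃ D, d₀ = 4 * D + 1 := ⟨d₀ / 4, by omega⟩
  obtain ⟨x', hx'⟩ := hxe
  rw [← two_mul] at hx'
  obtain ⟨rfl, hpar⟩ := h.even_add_of_even_x hy hP hQ hx' hPv
  rw [Int.even_iff] at hpar
  obtain ⟨σ, u, w, hσ, hx⟩ := exists_two_pow_mul h.x_ne_zero
  have main := fun {σ' e : ℤ} (hσ' : σ' = 0 ∨ σ' = 1)
      (hE : x + (4 * v + 1) = (1 - 2 * σ') * 2 ^ 0 * (4 * e + 1)) =>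
    h.symbolSum_eq_of_isCoprime_d (ω := 1) (l := 0) (η := 4 * D + 1) hd hcop
    (fun γ _ => isCoprime_one_left)
    (fun n => by simpa using qlog_two_pow 0 n)
    (by rw [one_mul, hδ]) ⟨x' + 2 * v, by rw [hx']; ring⟩ hP hQ hδ hσ hσ' hx hy hE
  have hPc := congrArg (Int.cast (R := ZMod 4)) hPv
  constructor
  · intro hq
    obtain ⟨x₁, rfl⟩ : ∃ x₁, x' = 2 * x₁ + 1 := ⟨x' / 2, by omega⟩
    have hu := eq_one_of_two_pow_mul (e := 2 * x₁ + 1) odd_sign_mul (hx.symm.trans hx') ⟨x₁, rfl⟩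
    subst hu
    specialize main (σ' := 1) (e := -(x₁ + v) - 1) (Or.inr rfl) (by rw [hx']; ring)
    rw [show (x - 2) / 4 = x₁ by omega]
    have hxc := congrArg (Int.cast (R := ZMod 4)) hx'
    push_cast at main hPc hxc ⊢
    rw [hxc] at main
    linear_combination (norm := (ring_nf; reduce_mod_char)) main + hPc
  · intro hq
    obtain ⟨x₁, rfl⟩ : ∃ x₁, x' = 2 * x₁ := ⟨x' / 2, by omega⟩
    specialize main (σ' := 0) (e := x₁ + v) (Or.inl rfl) (by rw [hx']; ring)
    rw [show x / 4 = x₁ by omega]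
    have hxc := congrArg (Int.cast (R := ZMod 4)) hx'
    push_cast at main hPc hxc ⊢
    rw [hxc] at main
    linear_combination (norm := (ring_nf; reduce_mod_char)) main + hPc

/-- d is twice an odd number. For x ≡ 1 (mod 4) so is x + c, and ω = 2(1 + i); for x ≡ 3 (mod 4) one
has x + c = 8g, and ω = 2i. -/
lemma eval_d_five_odd (h : Representation p c d x y a b q) (hy : y = 2 ^ t * (4 * z + 1))
    (hd : d = 2 ^ r * d₀) (hd₀ : d₀ % 4 = 1)
    (hcop : IsCoprime d₀ (x + c)) (hp8 : p % 8 = 5) (hxo : Odd x) :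
    (q % 8 = 1 → symbolSum c d x y a b = x - 1) ∧ (q % 8 = 5 → symbolSum c d x y a b = 0) := by
  obtain ⟨v, δ, Q, P, rfl, hδ, hQ, hP, hPv⟩ := h.exists_params
  obtain ⟨-, rfl⟩ := eq_of_two_pow_mul_odd (Int.odd_iff.mpr (by omega)) (hd.symm.trans hδ)
    ((even_or_odd_δ hP hPv).2 hp8)
  obtain ⟨D, rfl⟩ : ∃ D, d₀ = 4 * D + 1 := ⟨d₀ / 4, by omega⟩
  obtain ⟨σ, w, hσ, hx⟩ := exists_of_odd hxo
  obtain ⟨j, rfl, hPx⟩ := h.params_of_odd_x hy hP hQ hσ hx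
  obtain ⟨rfl, g, hg, hg2⟩ := params_five_odd hPv hPx
  obtain rfl : v = w + 2 * g := by linarith
  have hPc := congrArg (Int.cast (R := ZMod 4)) hPv
  have hg2c := congrArg (Int.cast (R := ZMod 4)) hg2
  have hxc := congrArg (Int.cast (R := ZMod 4)) hx
  rcases hσ with rfl | rfl
  · have main := h.symbolSum_eq_of_isCoprime_d (ω := 2 ^ 1 * (1 + I)) (l := 1)
      (A := 2 * (w + g + D) + 1) (η := D - w - g) (e := w + g) (u := 0) (w := w) (k := 1)
      (σ' := 0) hd hcop
      (isCoprime_two_pow_mul 1 fun γ => isCoprime_one_add_I) (qlog_two_pow_mul_one_add_I 1)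
      (by rw [mul_assoc, one_add_I_mul_mk, two_pow_mul_mk, hx, hδ]; ext <;> ring)
      ⟨_, rfl⟩ hP hQ hδ (Or.inl rfl) (Or.inl rfl) (by rw [hx]; ring) hy (by rw [hx]; ring)
    constructor <;> intro hq <;> push_cast at main hPc hg2c hxc ⊢
    · linear_combination (norm := (ring_nf; reduce_mod_char)) main + hPc + hg2c - hxc
    · linear_combination (norm := (ring_nf; reduce_mod_char)) main + hPc + hg2c
  · obtain ⟨σ', k, e, hσ', hE⟩ := exists_two_pow_mul (h.add_ne_zero_of_isCoprime_d hd hcop)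
    have main := h.symbolSum_eq_of_isCoprime_d (ω := 2 ^ 1 * I) (l := 2)
      (A := 4 * D + 1) (η := -(2 * g)) (u := 0) (w := w) hd hcop
      (isCoprime_two_pow_mul 1 fun γ _ => isCoprime_I γ) (qlog_two_pow_mul_I 1)
      (by rw [mul_assoc, I_mul_mk, two_pow_mul_mk, hx, hδ]; ext <;> ring)
      ⟨2 * D, by ring⟩ hP hQ hδ (Or.inr rfl) hσ' (by rw [hx]; ring) hy hE
    have hEg : (1 - 2 * σ') * (4 * e + 1) * 2 ^ k = 2 ^ 3 * g := by
      rw [hx] at hE; linarith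
    constructor
    · intro hq
      obtain ⟨Q', rfl⟩ : ∃ Q', Q = 2 * Q' := ⟨Q / 2, by omega⟩
      obtain ⟨G, rfl⟩ : ∃ G, g = 2 * G := ⟨Q' + (8 * Q' + 1) * (2 * z ^ 2 + z) - 2 * w * g -
        2 * g ^ 2 - 2 * D ^ 2 - D, by linarith⟩
      push_cast at main hPc hxc ⊢
      linear_combination (norm := (ring_nf; reduce_mod_char)) main + hPc - hxc
    -- For q ≡ 5 (mod 8) g is odd, which pins down k = 3; in the other case g is even and k drops
    -- out.
    · intro hq
      obtain ⟨Q', rfl⟩ : ∃ Q', Q = 2 * Q' + 1 := ⟨Q / 2, by omega⟩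
      obtain ⟨G, rfl⟩ : ∃ G, g = 2 * G + 1 := ⟨Q' + (8 * Q' + 5) * (2 * z ^ 2 + z) - 2 * w * g -
        2 * g ^ 2 - 2 * D ^ 2 - D, by linarith⟩
      obtain rfl := eq_of_two_pow_mul_eq odd_sign_mul ⟨G, rfl⟩ hEg
      push_cast at main hPc hxc ⊢
      linear_combination (norm := (ring_nf; reduce_mod_char)) main + hPc

end Representation

/-! ### The case p ≡ 1 (mod 8), x odd, with d₀ prime to x + c -/

namespace Representation

variable {p c d x y a b q : ℤ}

/-- The case `x ≡ 3 (mod 4)`, with the power of `2` in `d` at most twice that in `y`. -/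
lemma eval_d_one_neg_of_le {v w g z D P Q : ℤ} {i j : ℕ}
    (h : Representation p (4 * v + 1) (2 ^ (i + 2) * (4 * D + 1)) x y a b q)
    (hcop : IsCoprime (4 * D + 1) (x + (4 * v + 1)))
    (hx : x = -(4 * w + 1)) (hv : v = w + 2 * g) (hy : y = 2 ^ (j + 2) * (4 * z + 1))
    (hQ : q = 4 * Q + 1) (hP : p = 4 * P + 1)
    (hPv : P = 4 * v ^ 2 + 2 * v + (2 * (2 ^ i * (4 * D + 1))) ^ 2)
    (hrel : g * (4 * w + 4 * g + 1) =
      (4 * Q + 1) * (2 ^ j * (4 * z + 1)) ^ 2 - (2 ^ i * (4 * D + 1)) ^ 2)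
    (hij : i ≤ j) :
    symbolSum (4 * v + 1) (2 ^ (i + 2) * (4 * D + 1)) x y a b =
      2 * Q + 2 * (2 ^ i + 2 ^ j) := by
  obtain ⟨n, rfl⟩ := Nat.exists_eq_add_of_le hij
  -- By `hrel`, 2^(2i) divides g, so x + c = 8g is divisible by a higher power of 2 than d, and κ =
  -- 2^(i+2)·i·κ'.
  obtain ⟨G, rfl, hG⟩ : ∃ G, g = 2 ^ (2 * i) * G ∧ G * (4 * w + 4 * g + 1) =
      (4 * Q + 1) * (4 ^ n * (4 * z + 1) ^ 2) - (4 * D + 1) ^ 2 := by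
    refine dvd_of_mul_odd_eq ⟨2 * w + 2 * g, by ring⟩ (hrel.trans ?_)
    rw [pow_mul', pow_add, show (4 : ℤ) ^ n = (2 ^ n) ^ 2 by rw [← pow_mul', pow_mul]; norm_num]
    ring
  obtain ⟨σ', k, e, hσ', hE⟩ := exists_two_pow_mul (h.add_ne_zero_of_isCoprime_d rfl hcop)
  have main := h.symbolSum_eq_of_isCoprime_d (ω := 2 ^ (i + 2) * I) (l := 2)
    (A := 4 * D + 1) (η := -(2 ^ i * G)) (u := 0) (w := w) (σ := 1)
    (δ := 2 * (2 ^ i * (4 * D + 1))) rfl hcop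
    (isCoprime_two_pow_mul _ fun γ _ => isCoprime_I γ) (qlog_two_pow_mul_I _)
    (by rw [mul_assoc, I_mul_mk, two_pow_mul_mk, hx, hv]; ext <;> ring)
    ⟨2 * D, by ring⟩ hP hQ (by ring) (Or.inr rfl) hσ' (by rw [hx]; ring) hy hE
  have hEg : (1 - 2 * σ') * (4 * e + 1) * 2 ^ k = 2 ^ (2 * i + 3) * G := by
    rw [hx, hv] at hE; rw [pow_add]; linarith
  have hPc := congrArg (Int.cast (R := ZMod 4)) hPv
  have hvc := congrArg (Int.cast (R := ZMod 4)) hv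
  have hi := two_mul_two_pow_mul_exponent i
  cases n with
  -- For i = j, G is divisible by 4, so k is irrelevant.
  | zero =>
    obtain ⟨G', rfl⟩ : ∃ G', G = 4 * G' := ⟨Q * (4 * z + 1) ^ 2 + 4 * z ^ 2 + 2 * z -
      4 * D ^ 2 - 2 * D - G * (w + 2 ^ (2 * i) * G), by linarith⟩
    push_cast at main hPc hvc ⊢
    linear_combination (norm := (ring_nf; reduce_mod_char)) main + hPc + hi + 2 * hvc
  -- For i < j, G ≡ 3 (mod 4), which determines k and the sign σ'.
  | succ n =>
    obtain ⟨G', rfl⟩ : ∃ G', G = 4 * G' - 1 := ⟨(4 * Q + 1) * (4 ^ n * (4 * z + 1) ^ 2) -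
      4 * D ^ 2 - 2 * D - G * (w + 2 ^ (2 * i) * G), by rw [pow_succ] at hG; linarith⟩
    obtain rfl := eq_of_two_pow_mul_eq odd_sign_mul ⟨2 * G' - 1, by ring⟩ hEg
    have hσe : (1 - 2 * σ') * (4 * e + 1) = 4 * G' - 1 := by
      have : (2 : ℤ) ^ (2 * i + 3) ≠ 0 := by positivity
      exact mul_left_cancel₀ this (by linarith)
    obtain rfl : σ' = 1 := by
      rcases hσ' with rfl | rfl
      · exfalso; omega
      · rfl
    push_cast at main hPc hvc ⊢
    linear_combination (norm := (ring_nf; reduce_mod_char)) main + hPc + hi + 2 * hvc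

/-- The case `x ≡ 3 (mod 4)`, with the power of `2` in `d` greater than that in `y`. -/
lemma eval_d_one_neg_of_lt {v w g z D P Q : ℤ} {i j : ℕ}
    (h : Representation p (4 * v + 1) (2 ^ (i + 2) * (4 * D + 1)) x y a b q)
    (hcop : IsCoprime (4 * D + 1) (x + (4 * v + 1)))
    (hx : x = -(4 * w + 1)) (hv : v = w + 2 * g) (hy : y = 2 ^ (j + 2) * (4 * z + 1))
    (hQ : q = 4 * Q + 1) (hP : p = 4 * P + 1)
    (hPv : P = 4 * v ^ 2 + 2 * v + (2 * (2 ^ i * (4 * D + 1))) ^ 2)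
    (hrel : g * (4 * w + 4 * g + 1) =
      (4 * Q + 1) * (2 ^ j * (4 * z + 1)) ^ 2 - (2 ^ i * (4 * D + 1)) ^ 2)
    (hij : j < i) :
    symbolSum (4 * v + 1) (2 ^ (i + 2) * (4 * D + 1)) x y a b =
      2 * Q + 2 * (2 ^ i + 2 ^ j) := by
  obtain ⟨n, rfl⟩ := Nat.exists_eq_add_of_lt hij
  obtain ⟨G, rfl, hG⟩ : ∃ G, g = 2 ^ (2 * j) * G ∧ G * (4 * w + 4 * g + 1) =
      (4 * Q + 1) * (4 * z + 1) ^ 2 - 4 * 4 ^ n * (4 * D + 1) ^ 2 := by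
    refine dvd_of_mul_odd_eq ⟨2 * w + 2 * g, by ring⟩ (hrel.trans ?_)
    rw [pow_mul', pow_add, pow_add,
      show (4 : ℤ) ^ n = (2 ^ n) ^ 2 by rw [← pow_mul', pow_mul]; norm_num]
    ring
  -- Now the y-term dominates 2-adically: G ≡ 1 (mod 4) and x + c is exactly divisible by 2^(2j+3).
  obtain ⟨e, rfl⟩ : ∃ e, G = 4 * e + 1 := ⟨Q * (4 * z + 1) ^ 2 + 4 * z ^ 2 + 2 * z -
      4 ^ n * (4 * D + 1) ^ 2 - G * (w + 2 ^ (2 * j) * G), by linarith⟩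
  have hrel' : e + w + 4 ^ j * (4 * e + 1) + 4 * e * (w + 4 ^ j * (4 * e + 1)) =
      4 * Q * (4 * z ^ 2 + 2 * z) + 4 * z ^ 2 + 2 * z + Q - 4 ^ n * (4 * D + 1) ^ 2 := by
    rw [pow_mul, show (2 : ℤ) ^ 2 = 4 by norm_num] at hG
    linarith
  have hrelc := congrArg (Int.cast (R := ZMod 4)) hrel'
  have hE : x + (4 * v + 1) = (1 - 2 * 0) * 2 ^ (2 * j + 3) * (4 * e + 1) := by
    rw [hx, hv, pow_add]; ring
  have hPc := congrArg (Int.cast (R := ZMod 4)) hPv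
  have hvc := congrArg (Int.cast (R := ZMod 4)) hv
  have hj := two_mul_four_pow j
  -- The power of 2 in d has exponent j + n + 3, that in x + c has exponent 2j + 3. Their order
  -- decides whether the factor of ω besides the power of 2 is i, 1 + i or 1.
  rcases lt_trichotomy n j with hn | rfl | hn
  · obtain ⟨m, rfl⟩ := Nat.exists_eq_add_of_lt hn
    have main := h.symbolSum_eq_of_isCoprime_d (ω := 2 ^ (n + m + 1 + n + 1 + 2) * I) (l := 2)
      (A := 4 * D + 1) (η := -(2 ^ m * (4 * e + 1))) (u := 0) (w := w) (σ := 1) (σ' := 0)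
      (δ := 2 * (2 ^ (n + m + 1 + n + 1) * (4 * D + 1))) rfl hcop
      (isCoprime_two_pow_mul _ fun γ _ => isCoprime_I γ) (qlog_two_pow_mul_I _)
      (by rw [mul_assoc, I_mul_mk, two_pow_mul_mk, hx, hv]; ext <;> ring)
      ⟨2 * D, by ring⟩ hP hQ (by ring) (Or.inr rfl) (Or.inl rfl) (by rw [hx]; ring) hy hE
    push_cast at main hPc hvc ⊢
    linear_combination (norm := (ring_nf; reduce_mod_char)) main + hPc + 2 * hvc
  · have main := h.symbolSum_eq_of_isCoprime_d (ω := 2 ^ (2 * n + 3) * (1 + I)) (l := 1)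
      (A := 2 * (D + e) + 1) (η := D - e) (u := 0) (w := w) (σ := 1) (σ' := 0)
      (δ := 2 * (2 ^ (n + n + 1) * (4 * D + 1))) rfl hcop
      (isCoprime_two_pow_mul _ fun γ => isCoprime_one_add_I) (qlog_two_pow_mul_one_add_I _)
      (by rw [mul_assoc, one_add_I_mul_mk, two_pow_mul_mk, hx, hv]; ext <;> ring)
      ⟨_, rfl⟩ hP hQ (by ring) (Or.inr rfl) (Or.inl rfl) (by rw [hx]; ring) hy hE
    push_cast at main hPc hvc hrelc ⊢
    linear_combination (norm := (ring_nf; reduce_mod_char)) main + hPc - hrelc + 2 * hvc + hj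
  · obtain ⟨m, rfl⟩ := Nat.exists_eq_add_of_lt hn
    have main := h.symbolSum_eq_of_isCoprime_d (ω := 2 ^ (2 * j + 3) * 1) (l := 0)
      (A := 4 * e + 1) (η := 2 ^ m * (4 * D + 1)) (u := 0) (w := w) (σ := 1) (σ' := 0)
      (δ := 2 * (2 ^ (j + (j + m + 1) + 1) * (4 * D + 1))) rfl hcop
      (isCoprime_two_pow_mul _ fun γ _ => isCoprime_one_left)
      (fun n => by rw [mul_one, qlog_two_pow])
      (by rw [mul_one, two_pow_mul_mk, hx, hv]; ext <;> ring)
      ⟨2 * e, by ring⟩ hP hQ (by ring) (Or.inr rfl) (Or.inl rfl) (by rw [hx]; ring) hy hE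
    push_cast at main hPc hvc hrelc ⊢
    linear_combination (norm := (ring_nf; reduce_mod_char)) main + hPc + 2 * hrelc + 2 * hvc + hj

/-- For x ≡ 1 (mod 4), x + c is twice an odd number and 4 ∣ d, so ω = 2. For x ≡ 3 (mod 4), the two
forms of p give `hrel`, from which the power of 2 in x + c = 8g is found by comparing d/4 with y/4.
-/
lemma eval_d_one_odd {t r : ℕ} {z d₀ : ℤ} (h : Representation p c d x y a b q)
    (hy : y = 2 ^ t * (4 * z + 1)) (hd : d = 2 ^ r * d₀) (hd₀ : d₀ % 4 = 1)
    (hcop : IsCoprime d₀ (x + c)) (hp8 : p % 8 = 1) (hxo : Odd x) :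
    (q % 8 = 1 → symbolSum c d x y a b = 2 * (d / 4 + y / 4 : ℤ)) ∧
      (q % 8 = 5 → symbolSum c d x y a b = 2 * (d / 4 + y / 4 : ℤ) + (x - 1)) := by
  obtain ⟨v, δ, Q, P, rfl, hδ, hQ, hP, hPv⟩ := h.exists_params
  obtain ⟨D, rfl⟩ := (even_or_odd_δ hP hPv).1 hp8
  obtain ⟨D', rfl⟩ : ∃ D, d₀ = 4 * D + 1 := ⟨d₀ / 4, by omega⟩
  have hr := le_of_two_pow_mul_eq (k := r) (n := 2) (s := 4 * D' + 1) (e := D) ⟨2 * D', by ring⟩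
    (by linarith)
  obtain ⟨i, rfl⟩ := Nat.exists_eq_add_of_le' hr
  obtain rfl : D = 2 ^ i * (4 * D' + 1) := by rw [pow_add] at hd; linarith
  obtain ⟨σ, w, hσ, hx⟩ := exists_of_odd hxo
  obtain ⟨t, rfl, hPx⟩ := h.params_of_odd_x hy hP hQ hσ hx
  obtain ⟨j, rfl⟩ : ∃ j, t = j + 1 := by
    refine Nat.exists_eq_succ_of_ne_zero ?_
    rintro rfl
    rw [hPv] at hPx
    have : 2 * (2 * v ^ 2 + v + 2 * (2 ^ i * (4 * D' + 1)) ^ 2) = 2 * (2 * w ^ 2 + w + 2 * Q +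
      (4 * Q + 1) * (8 * z ^ 2 + 4 * z)) + 1 := by linear_combination hPx
    omega
  have hPx' : P = 4 * w ^ 2 + 2 * w + (4 * Q + 1) * (2 * (2 ^ j * (4 * z + 1))) ^ 2 := by
    rw [hPx, pow_succ]; ring
  obtain ⟨g, hg⟩ : ∃ g, v - w = 2 * g :=
    ⟨w ^ 2 + (4 * Q + 1) * (2 ^ j * (4 * z + 1)) ^ 2 - v ^ 2 -
      (2 ^ i * (4 * D' + 1)) ^ 2, by linarith⟩
  have hv : v = w + 2 * g := by linarith
  have hrel : g * (4 * w + 4 * g + 1) =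
      (4 * Q + 1) * (2 ^ j * (4 * z + 1)) ^ 2 - (2 ^ i * (4 * D' + 1)) ^ 2 := by
    rw [hPv, hv] at hPx'
    linarith
  have hd4 : d / 4 = 2 ^ i * (4 * D' + 1) := by omega
  have hy4 : y / 4 = 2 ^ j * (4 * z + 1) := by
    rw [hy, show (2 : ℤ) ^ (j + 1 + 1) * (4 * z + 1) = 4 * (2 ^ j * (4 * z + 1)) by ring]
    omega
  have hxc := congrArg (Int.cast (R := ZMod 4)) hx
  rw [hd4, hy4]
  rcases hσ with rfl | rfl
  · have main := h.symbolSum_eq_of_isCoprime_d (ω := 2 ^ 1 * 1) (l := 0)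
      (A := 4 * (w + g) + 1) (η := 2 ^ i * (4 * D' + 1)) (e := w + g) (u := 0) (w := w) (k := 1)
      (σ' := 0) hd hcop
      (isCoprime_two_pow_mul 1 fun γ _ => isCoprime_one_left)
      (fun n => by rw [mul_one, qlog_two_pow])
      (by rw [mul_one, two_pow_mul_mk, hx, hδ, hv]; ext <;> ring)
      ⟨2 * (w + g), by ring⟩ hP hQ hδ (Or.inl rfl) (Or.inl rfl) (by rw [hx]; ring) hy
      (by rw [hx, hv]; ring)
    have hPc := congrArg (Int.cast (R := ZMod 4)) hPx'
    have hrelc := congrArg (Int.cast (R := ZMod 4)) hrel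
    have hi := two_mul_sq_zmod_four (2 ^ i)
    have hj := two_mul_sq_zmod_four (2 ^ j)
    constructor <;> intro hq <;> push_cast at main hPc hxc hrelc hi hj ⊢
    · linear_combination (norm := (ring_nf; reduce_mod_char)) main + hPc + 2 * hrelc + hi + hj
    · linear_combination (norm := (ring_nf; reduce_mod_char)) main + hPc + 2 * hrelc + hi + hj - hxc
  · have key : symbolSum (4 * v + 1) d x y a b = 2 * Q + 2 * (2 ^ i + 2 ^ j) := by
      subst hd
      rcases le_or_gt i j with hij | hij
      · exact h.eval_d_one_neg_of_le hcop (by rw [hx]; ring) hv hy hQ hP hPv hrel hij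
      · exact h.eval_d_one_neg_of_lt hcop (by rw [hx]; ring) hv hy hQ hP hPv hrel hij
    rw [key]
    constructor <;> intro hq
    · obtain ⟨Q', rfl⟩ : ∃ Q', Q = 2 * Q' := ⟨Q / 2, by omega⟩
      push_cast at hxc ⊢
      linear_combination (norm := (ring_nf; reduce_mod_char))
    · obtain ⟨Q', rfl⟩ : ∃ Q', Q = 2 * Q' + 1 := ⟨Q / 2, by omega⟩
      push_cast at hxc ⊢
      linear_combination (norm := (ring_nf; reduce_mod_char)) -hxc

end Representation

/-! ### Powers of a primitive fourth root of unity -/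

lemma zpow_eq_zpow_iff {K : Type*} [Field K] {ζ : K} (h : IsPrimitiveRoot ζ 4) (j k : ℤ) :
    ζ ^ j = ζ ^ k ↔ (j : ZMod 4) = k := by
  have h0 : ζ ≠ 0 := h.ne_zero (by norm_num)
  rw [← div_eq_one_iff_eq (zpow_ne_zero k h0), ← zpow_sub₀ h0, h.zpow_eq_one_iff_dvd,
    ← sub_eq_zero, ← Int.cast_sub]
  exact (ZMod.intCast_zmod_eq_zero_iff_dvd _ 4).symm

lemma isPrimitiveRoot_four {K : Type*} [Field K] {ζ : K} (h2 : (2 : K) ≠ 0) (h : ζ ^ 2 = -1) :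
    IsPrimitiveRoot ζ 4 := by
  rw [IsPrimitiveRoot.iff_orderOf]
  refine orderOf_eq_prime_pow (p := 2) (n := 1) (x := ζ) ?_ ?_
  · rw [pow_one, h]
    intro h1
    exact h2 (by linear_combination -h1)
  · rw [show 2 ^ (1 + 1) = 2 * 2 by norm_num, pow_mul, h]; norm_num

lemma neg_one_zpow_mul_inv_zpow {K : Type*} [Field K] {ζ : K} (h : IsPrimitiveRoot ζ 4)
    (hζ : ζ ^ 2 = -1) (e m : ℤ) : (-1) ^ e * ζ⁻¹ ^ m = ζ ^ (2 * e - m) := by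
  have h0 : ζ ≠ 0 := h.ne_zero (by norm_num)
  rw [← hζ, zpow_sub₀ h0, zpow_mul, inv_zpow, div_eq_mul_inv]
  norm_cast

/-! ### The symbol of the imaginary part -/

lemma isCoprime_im {a b : ℤ} (h : IsCoprime a b) : IsCoprime (a : GaussianInt) ⟨b, a⟩ := by
  have h1 := (isCoprime_intCast.mpr h).add_mul_left_right I
  rwa [show (b : GaussianInt) + a * I = ⟨b, a⟩ by ext <;> simp [I]] at h1

/-- The odd part of a, normalized to be ≡ 1 (mod 4), is flipped by reciprocity; modulo it β ≡ b is
rational, so its symbol vanishes. Only the sign and the power of 2 in a contribute. -/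
lemma qlog_im {a b : ℤ} (ha0 : a ≠ 0) (ha : Even a) (hb : Odd b) (hab : IsCoprime a b) :
    (4 ∣ a → qlog (a : GaussianInt) ⟨b, a⟩ = 0) ∧
      (¬ 4 ∣ a → qlog (a : GaussianInt) ⟨b, a⟩ = b) := by
  have ho : Odd (⟨b, a⟩ : GaussianInt).norm := odd_norm_of_odd_re hb ha
  obtain ⟨A, hA⟩ := ha
  rw [← two_mul] at hA
  obtain ⟨σ, u, w, hσ, hu⟩ := exists_two_pow_mul ha0
  have hc := isCoprime_im hab
  have hau : (a : GaussianInt) =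
      ((1 - 2 * σ : ℤ) : GaussianInt) * 2 ^ u * ((4 * w + 1 : ℤ) : GaussianInt) := by
    rw [hu]; push_cast; ring
  have hc0 : IsCoprime ((4 * w + 1 : ℤ) : GaussianInt) ⟨b, a⟩ := by
    rw [hau] at hc; exact hc.of_mul_left_right
  have hw : qlog ((4 * w + 1 : ℤ) : GaussianInt) ⟨b, a⟩ = 0 := by
    have hob : Odd (4 * w + 1) := ⟨2 * w, by ring⟩
    rw [qlog_intCast_comm (by omega) ho ⟨A, by simp only; omega⟩ hc0,
      qlog_congr (odd_norm_intCast.mpr hob) (β := (b : GaussianInt)),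
      qlog_intCast_intCast hob]
    · rw [hu] at hab; exact hab.of_mul_left_right.symm
    · refine ⟨((1 - 2 * σ : ℤ) : GaussianInt) * 2 ^ u * I, ?_⟩
      rw [show (⟨b, a⟩ : GaussianInt) - b = a * I by ext <;> simp [I], hau]
      ring
  have hs : IsCoprime ((1 - 2 * σ : ℤ) : GaussianInt) ⟨b, a⟩ :=
    isCoprime_sign (by rcases hσ with rfl | rfl <;> simp) _
  have main : qlog (a : GaussianInt) ⟨b, a⟩ = 2 * σ * A + u * (b * A) := by
    have e1 := qlog_sign (γ := ⟨b, a⟩) hb hA hσ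
    have e2 := qlog_two_of_even_im (γ := ⟨b, a⟩) hb hA hab.symm
    conv_lhs => rw [hau]
    rw [qlog_mul_left ho (hs.mul_left (isCoprime_two_pow ho u)) hc0,
      qlog_mul_left ho hs (isCoprime_two_pow ho u), qlog_pow_left ho (isCoprime_two ho), hw, e1, e2]
    simp
  rw [main]
  constructor
  · rintro ⟨B, hB⟩
    obtain rfl : A = 2 * B := by omega
    obtain ⟨f, hf⟩ := exists_mul_eq_two_mul (e := B) odd_sign_mul (hu.symm.trans (by omega))
    have hf' := congrArg (Int.cast (R := ZMod 4)) hf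
    push_cast at hf' ⊢
    linear_combination (norm := (ring_nf; reduce_mod_char)) 2 * b * hf'
  · intro h4
    obtain ⟨j, rfl⟩ : Odd A := by
      rw [Int.odd_iff]
      by_contra hA2
      exact h4 (by omega)
    obtain rfl := eq_one_of_two_pow_mul odd_sign_mul (hu.symm.trans hA) ⟨j, rfl⟩
    have hA' : 2 * j + 1 = (1 - 2 * σ) * (4 * w + 1) := by linarith
    obtain ⟨B, rfl⟩ := hb
    have hc := congrArg (Int.cast (R := ZMod 4)) hA'
    push_cast at hc ⊢
    rcases hσ with rfl | rfl
    · push_cast at hc ⊢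
      linear_combination (norm := (ring_nf; reduce_mod_char)) (2 * B + 1) * hc
    · push_cast at hc ⊢
      linear_combination (norm := (ring_nf; reduce_mod_char)) (2 * B + 3) * hc

namespace Representation

variable {p c d x y a b q : ℤ}

lemma p_eq (h : Representation p c d x y a b q) :
    (p : GaussianInt) = x * x + ⟨b, a⟩ * (star ⟨b, a⟩ * y ^ 2) := by
  have h1 := Zsqrtd.norm_eq_mul_conj (⟨b, a⟩ : GaussianInt)
  rw [h.norm_β] at h1
  have h2 := congrArg (Int.cast (R := GaussianInt)) h.form
  push_cast at h2
  rw [h2, h1]; ring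

lemma isCoprime_x_β (h : Representation p c d x y a b q) :
    IsCoprime (x : GaussianInt) ⟨b, a⟩ := by
  have h1 := (isCoprime_intCast.mpr h.isCoprime_x).add_mul_left_right (-(x : GaussianInt))
  rw [h.p_eq, show (x : GaussianInt) * x + ⟨b, a⟩ * (star ⟨b, a⟩ * y ^ 2) + x * -x =
    ⟨b, a⟩ * (star ⟨b, a⟩ * y ^ 2) by ring] at h1
  exact h1.of_mul_right_left

lemma mul_star_π (h : Representation p c d x y a b q) :
    (⟨c, d⟩ : GaussianInt) * star ⟨c, d⟩ = p := by
  rw [← h.norm_π, Zsqrtd.norm_eq_mul_conj]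

lemma isCoprime_p_β (h : Representation p c d x y a b q) :
    IsCoprime (⟨c, d⟩ * star ⟨c, d⟩ : GaussianInt) ⟨b, a⟩ := by
  rw [h.mul_star_π, h.p_eq]
  exact (h.isCoprime_x_β.mul_left h.isCoprime_x_β).add_mul_left_left _

/-- Modulo β, ac + bd ≡ a·π̄ and ππ̄ ≡ x². Hence any admissible z satisfies z ≡ ax/π, whatever
representative is chosen. -/
lemma quarticSymbolFracEq_iff (h : Representation p c d x y a b q) (hab : IsCoprime a b) (m : ℤ) :
    QuarticSymbolFracEq (a * c + b * d) x ⟨b, a⟩ (Complex.I ^ m) ↔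
      (m : ZMod 4) = qlog a ⟨b, a⟩ + qlog x ⟨b, a⟩ - qlog ⟨c, d⟩ ⟨b, a⟩ := by
  have hx := h.isCoprime_x_β
  have hpβ := h.isCoprime_p_β
  have hu : (⟨b, a⟩ : GaussianInt) ∣ (a * c + b * d) - a * star ⟨c, d⟩ := by
    refine ⟨d, ?_⟩
    ext <;> simp
  have hL : ∀ z : GaussianInt, ⟨b, a⟩ ∣ x * z - (a * c + b * d) → IsCoprime z ⟨b, a⟩ ∧
      qlog z ⟨b, a⟩ = qlog a ⟨b, a⟩ + qlog x ⟨b, a⟩ - qlog ⟨c, d⟩ ⟨b, a⟩ := by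
    intro z hz
    have hd : (⟨b, a⟩ : GaussianInt) ∣ x * z - a * star ⟨c, d⟩ := by
      have := dvd_add hz hu
      rwa [sub_add_sub_cancel] at this
    have ha := isCoprime_im hab
    have has := ha.mul_left hpβ.of_mul_left_right
    have hxz : IsCoprime ((x : GaussianInt) * z) ⟨b, a⟩ := by
      obtain ⟨k, hk⟩ := hd
      rw [show (x : GaussianInt) * z = a * star ⟨c, d⟩ + ⟨b, a⟩ * k by rw [← hk]; ring]
      exact has.add_mul_left_left k
    have hz := hxz.of_mul_left_right
    refine ⟨hz, ?_⟩
    have e1 := qlog_congr h.odd_β hd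
    rw [qlog_mul_left h.odd_β hx hz, qlog_mul_left h.odd_β ha hpβ.of_mul_left_right] at e1
    have e2 := qlog_mul_left h.odd_β hpβ.of_mul_left_left hpβ.of_mul_left_right
    rw [h.mul_star_π, qlog_congr h.odd_β (β := (x : GaussianInt) * x),
      qlog_mul_left h.odd_β hx hx] at e2
    · linear_combination e1 - e2
    · exact ⟨star ⟨b, a⟩ * y ^ 2, by rw [h.p_eq]; ring⟩
  have hJ : ∀ z : GaussianInt, IsCoprime z ⟨b, a⟩ →
      (toComplex (quarticJacobiSymbol z ⟨b, a⟩) = Complex.I ^ m ↔ qlog z ⟨b, a⟩ = m) := by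
    intro z hz
    have hI : toComplex I = Complex.I := by simp [toComplex_def, I]
    rw [jacobi_eq_I_pow_qlog h.odd_β hz, map_pow, hI, ← zpow_natCast,
      zpow_eq_zpow_iff (isPrimitiveRoot_four two_ne_zero Complex.I_sq)]
    simp
  constructor
  · rintro ⟨-, z, hz, hzm⟩
    obtain ⟨hzc, hzL⟩ := hL z hz
    rw [← hzL, (hJ z hzc).mp hzm]
  · intro hm
    obtain ⟨s, t, hst⟩ := hx
    have hz : (⟨b, a⟩ : GaussianInt) ∣ x * (s * (a * c + b * d)) - (a * c + b * d) :=
      ⟨-(t * (a * c + b * d)), by linear_combination (a * c + b * d : GaussianInt) * hst⟩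
    obtain ⟨hzc, hzL⟩ := hL _ hz
    exact ⟨h.isCoprime_x_β, _, hz, (hJ _ hzc).mpr (by rw [hzL, hm])⟩

end Representation

/-! ### Reduction modulo `c + d i` -/

namespace Representation

variable {p : ℕ} [Fact p.Prime] {c d x y a b q : ℤ}

lemma cast_d_ne_zero (h : Representation p c d x y a b q) : (d : ZMod p) ≠ 0 := by
  intro hd
  have hc : (c : ZMod p) = 0 := by
    have := congrArg (Int.cast (R := ZMod p)) h.sum_sq
    push_cast at this
    rw [hd, ZMod.natCast_self] at this
    exact pow_eq_zero_iff (two_ne_zero) |>.mp (by linear_combination -this)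
  rw [ZMod.intCast_zmod_eq_zero_iff_dvd] at hc hd
  exact h.prime.not_isUnit (h.isCoprime_c_d.isUnit_of_dvd' hc hd)

/-- Send i to ι = -c/d, the square root of -1 that kills c + di; then c/d = -ι = ι⁻¹. -/
lemma exists_reduction_mod (h : Representation p c d x y a b q) :
    ∃ (ι : ZMod p) (φ : GaussianInt →+* ZMod p), ι ^ 2 = -1 ∧ (c : ZMod p) / d = ι⁻¹ ∧
      φ I = ι ∧ φ ⟨c, d⟩ = 0 := by
  have hd := h.cast_d_ne_zero
  have hcd := congrArg (Int.cast (R := ZMod p)) h.sum_sq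
  push_cast at hcd
  rw [ZMod.natCast_self] at hcd
  have hι : (-(c : ZMod p) / d) * (-(c : ZMod p) / d) = ((-1 : ℤ) : ZMod p) := by
    push_cast
    field_simp
    linear_combination -hcd
  have hc : (c : ZMod p) ≠ 0 := by
    intro hc
    rw [hc] at hcd
    exact hd (pow_eq_zero_iff (two_ne_zero) |>.mp (by linear_combination -hcd))
  refine ⟨-(c : ZMod p) / d, Zsqrtd.lift ⟨_, hι⟩, ?_, ?_, ?_, ?_⟩
  · rw [sq, hι]; push_cast; rfl
  · refine eq_inv_of_mul_eq_one_left ?_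
    push_cast at hι
    linear_combination -hι
  · simp [Zsqrtd.lift, I]
  · simp [Zsqrtd.lift]
    field_simp
    ring

lemma reduction_pow {ι : ZMod p} {φ : GaussianInt →+* ZMod p}
    (h : Representation p c d x y a b q) (hφ : φ I = ι) (h0 : φ ⟨c, d⟩ = 0) {α : GaussianInt}
    (hα : IsCoprime α ⟨c, d⟩) : φ α ^ ((p - 1) / 4) = ι ^ (qlog α ⟨c, d⟩).val := by
  obtain ⟨k, hk⟩ := dvd_pow_sub_I_pow_qlog (prime_of_norm_eq h.norm_π) h.odd_π hα
  rw [h.norm_π, Int.natAbs_natCast] at hk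
  have := congrArg φ hk
  rw [map_sub, map_pow, map_pow, map_mul, h0, zero_mul, hφ] at this
  linear_combination this

/-- The power of `i` to which the power residue of `q` reduces. -/
noncomputable def residueExponent (c d x y : ℤ) : ZMod 4 :=
  qlog x ⟨c, d⟩ + qlog I ⟨c, d⟩ - qlog y ⟨c, d⟩

lemma cast_ne_zero (h : Representation p c d x y a b q) : (x : ZMod p) ≠ 0 ∧ (y : ZMod p) ≠ 0 := by
  constructor <;> intro h0 <;> rw [ZMod.intCast_zmod_eq_zero_iff_dvd] at h0
  · exact h.prime.not_isUnit (h.isCoprime_x.isUnit_of_dvd' h0 dvd_rfl)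
  · exact h.prime.not_isUnit (h.isCoprime_y.isUnit_of_dvd' h0 dvd_rfl)

lemma two_ne_zero_mod (h : Representation p c d x y a b q) : (2 : ZMod p) ≠ 0 := by
  intro h2
  have hodd := h.odd_π
  rw [h.norm_π] at hodd
  have : ((2 : ℕ) : ZMod p) = 0 := by exact_mod_cast h2
  rw [ZMod.natCast_eq_zero_iff, Nat.prime_dvd_prime_iff_eq Fact.out Nat.prime_two] at this
  subst this
  exact absurd hodd (by decide)

lemma pow_mul_pow_eq (h : Representation p c d x y a b q) {ι : ZMod p}
    {φ : GaussianInt →+* ZMod p} (hι : ι ^ 2 = -1) (hφ : φ I = ι) (h0 : φ ⟨c, d⟩ = 0) :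
    ((x : ZMod p) * ι / y) ^ ((p - 1) / 4) = ι ^ ((residueExponent c d x y).val : ℤ) := by
  have hp := isPrimitiveRoot_four h.two_ne_zero_mod hι
  have hco : ∀ {n : ℤ}, IsCoprime n p → IsCoprime (n : GaussianInt) ⟨c, d⟩ := fun hn => by
    have := isCoprime_intCast.mpr hn
    rw [← h.mul_star_π] at this
    exact this.of_mul_right_left
  have e1 := h.reduction_pow hφ h0 (hco h.isCoprime_x)
  have e2 := h.reduction_pow hφ h0 (hco h.isCoprime_y)
  have e3 := h.reduction_pow hφ h0 (isCoprime_I _)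
  rw [map_intCast] at e1 e2
  rw [hφ] at e3
  have hι0 : ι ≠ 0 := hp.ne_zero (by norm_num)
  rw [div_pow, mul_pow, e1, e2, e3, ← pow_add, ← zpow_natCast, ← zpow_natCast, ← zpow_sub₀ hι0,
    zpow_eq_zpow_iff hp]
  simp [residueExponent]

/-- Modulo p, qy² ≡ -x² = (xι)². -/
lemma q_eq_sq (h : Representation p c d x y a b q) {ι : ZMod p} (hι : ι ^ 2 = -1) :
    (a : ZMod p) ^ 2 + (b : ZMod p) ^ 2 = ((x : ZMod p) * ι / y) ^ 2 := by
  have h1 := congrArg (Int.cast (R := ZMod p)) (h.q_eq ▸ h.form)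
  push_cast at h1
  rw [ZMod.natCast_self] at h1
  have := h.cast_ne_zero.2
  field_simp
  linear_combination -h1 - x ^ 2 * hι

lemma pow_eq_of_mod_one (h : Representation p c d x y a b q) (hp8 : p % 8 = 1) {ι : ZMod p}
    {φ : GaussianInt →+* ZMod p} (hι : ι ^ 2 = -1) (hφ : φ I = ι) (h0 : φ ⟨c, d⟩ = 0) :
    ((a : ZMod p) ^ 2 + (b : ZMod p) ^ 2) ^ ((p - 1) / 8) =
      ι ^ ((residueExponent c d x y).val : ℤ) := by
  rw [h.q_eq_sq hι, ← pow_mul, ← h.pow_mul_pow_eq hι hφ h0]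
  congr 1
  omega

/-- Since (p - 1)/4 = 2·(p - 5)/8 + 1, the power of q is one factor xι/y short of the quartic
symbol; its inverse gives ι⁻¹ and y/x. -/
lemma pow_eq_of_mod_five (h : Representation p c d x y a b q) (hp8 : p % 8 = 5) {ι : ZMod p}
    {φ : GaussianInt →+* ZMod p} (hι : ι ^ 2 = -1) (hφ : φ I = ι) (h0 : φ ⟨c, d⟩ = 0) :
    ((a : ZMod p) ^ 2 + (b : ZMod p) ^ 2) ^ ((p - 5) / 8) =
      ι ^ ((residueExponent c d x y).val - 1 : ℤ) * ((y : ZMod p) / x) := by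
  have hι0 : ι ≠ 0 := (isPrimitiveRoot_four h.two_ne_zero_mod hι).ne_zero (by norm_num)
  obtain ⟨hx, hy⟩ := h.cast_ne_zero
  rw [zpow_sub_one₀ hι0, ← h.pow_mul_pow_eq hι hφ h0, h.q_eq_sq hι, ← pow_mul,
    show (p - 1) / 4 = 2 * ((p - 5) / 8) + 1 by omega, pow_succ]
  field_simp

lemma symbolSum_eq_residueExponent_add :
    symbolSum c d x y a b = residueExponent c d x y + qlog x ⟨b, a⟩ - qlog ⟨c, d⟩ ⟨b, a⟩ := rfl

/-- The right-hand side is ι^(2e - m') and the left-hand power is ι to `residueExponent`. As ι has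
order 4, the equivalence is one of congruences modulo 4, which `he` supplies. -/
lemma quarticSymbolFracEq_iff_pow_eq (h : Representation p c d x y a b q) (hab : IsCoprime a b)
    (hp8 : p % 8 = 1) {m m' e : ℤ}
    (he : qlog (a : GaussianInt) ⟨b, a⟩ + symbolSum c d x y a b = (2 * e - m' + m : ℤ)) :
    QuarticSymbolFracEq (a * c + b * d) x ⟨b, a⟩ (Complex.I ^ m) ↔
      ((a : ZMod p) ^ 2 + (b : ZMod p) ^ 2) ^ ((p - 1) / 8) =
        (-1) ^ e * ((c : ZMod p) / (d : ZMod p)) ^ m' := by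
  obtain ⟨ι, φ, hι, hcd, hφ, h0⟩ := h.exists_reduction_mod
  have hp := isPrimitiveRoot_four h.two_ne_zero_mod hι
  rw [h.quarticSymbolFracEq_iff hab, h.pow_eq_of_mod_one hp8 hι hφ h0, hcd,
    neg_one_zpow_mul_inv_zpow hp hι, zpow_eq_zpow_iff hp]
  rw [symbolSum_eq_residueExponent_add] at he
  push_cast at he ⊢
  rw [ZMod.natCast_zmod_val]
  constructor <;> intro h1
  · linear_combination he + h1
  · linear_combination h1 - he

lemma pow_eq_of_quarticSymbolFracEq (h : Representation p c d x y a b q) (hab : IsCoprime a b)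
    (hp8 : p % 8 = 5) {m m' e : ℤ}
    (he : qlog (a : GaussianInt) ⟨b, a⟩ + symbolSum c d x y a b = (2 * e + 1 - m' + m : ℤ))
    (hm : QuarticSymbolFracEq (a * c + b * d) x ⟨b, a⟩ (Complex.I ^ m)) :
    ((a : ZMod p) ^ 2 + (b : ZMod p) ^ 2) ^ ((p - 5) / 8) =
      (-1) ^ e * ((c : ZMod p) / (d : ZMod p)) ^ m' * ((y : ZMod p) / (x : ZMod p)) := by
  obtain ⟨ι, φ, hι, hcd, hφ, h0⟩ := h.exists_reduction_mod
  have hp := isPrimitiveRoot_four h.two_ne_zero_mod hι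
  rw [h.quarticSymbolFracEq_iff hab] at hm
  rw [h.pow_eq_of_mod_five hp8 hι hφ h0, hcd, neg_one_zpow_mul_inv_zpow hp hι]
  congr 1
  rw [zpow_eq_zpow_iff hp]
  rw [symbolSum_eq_residueExponent_add] at he
  push_cast at he ⊢
  rw [ZMod.natCast_zmod_val]
  linear_combination he + hm

end Representation

end GaussianInt

/-! ### Assembly of the cases -/

theorem theorem4p5 (p : ℕ) [Fact p.Prime] (hp : p % 4 = 1)
    (a b c d x y d₀ y₀ : ℤ) (r t : ℕ)
    (hcd : (p : ℤ) = c ^ 2 + d ^ 2)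
    (hxy : (p : ℤ) = x ^ 2 + (a ^ 2 + b ^ 2) * y ^ 2)
    (hne : (p : ℤ) ≠ a ^ 2 + b ^ 2)
    (ha0 : a ≠ 0) (ha2 : 2 ∣ a) (hab : Int.gcd a b = 1)
    (hc : c % 4 = 1)
    (hd : d = 2 ^ r * d₀) (hy : y = 2 ^ t * y₀) (hd₀ : d₀ % 4 = 1) (hy₀ : y₀ % 4 = 1)
    (hcop : Int.gcd c (x + d) = 1 ∨ Int.gcd d₀ (x + c) = 1)
    (m : ℤ) :
    -- (i)
    (p % 8 = 1 →
      (QuarticSymbolFracEq (a * c + b * d) x ⟨b, a⟩ (Complex.I ^ m) ↔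
        ((a : ZMod p) ^ 2 + (b : ZMod p) ^ 2) ^ ((p - 1) / 8) =
          if 4 ∣ a then
            if 2 ∣ x then
              (-1) ^ (d / 4 + x / 4) * ((c : ZMod p) / (d : ZMod p)) ^ m
            else
              (-1) ^ (d / 4 + y / 4) * ((c : ZMod p) / (d : ZMod p)) ^ m
          else
            if 2 ∣ x then
              (-1) ^ ((b + 1) / 2 + d / 4 + (x - 2) / 4) *
                ((c : ZMod p) / (d : ZMod p)) ^ (m - 1)
            else
              (-1) ^ ((b - 1) / 2 + d / 4 + y / 4 + (x - 1) / 2) *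
                ((c : ZMod p) / (d : ZMod p)) ^ (m - 1))) ∧
    -- (ii)
    (p % 8 = 5 →
      QuarticSymbolFracEq (a * c + b * d) x ⟨b, a⟩ (Complex.I ^ m) →
        ((a : ZMod p) ^ 2 + (b : ZMod p) ^ 2) ^ ((p - 5) / 8) =
          if 4 ∣ a then
            if 2 ∣ x then
              (-1) ^ ((x - 2) / 4) * ((c : ZMod p) / (d : ZMod p)) ^ (m - 1) *
                ((y : ZMod p) / (x : ZMod p))
            else
              (-1) ^ ((x + 1) / 2) * ((c : ZMod p) / (d : ZMod p)) ^ (m - 1) *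
                ((y : ZMod p) / (x : ZMod p))
          else
            if 2 ∣ x then
              (-1) ^ (x / 4 + (b + 1) / 2) * ((c : ZMod p) / (d : ZMod p)) ^ m *
                ((y : ZMod p) / (x : ZMod p))
            else
              (-1) ^ ((b - 1) / 2) * ((c : ZMod p) / (d : ZMod p)) ^ m *
                ((y : ZMod p) / (x : ZMod p))) := by
  have hp' := (Fact.out : p.Prime)
  have hq1 : 1 < a ^ 2 + b ^ 2 := by
    obtain ⟨k, rfl⟩ := ha2
    have hk : k ≠ 0 := by rintro rfl; simp at ha0
    have h1 : 0 < k ^ 2 := by positivity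
    nlinarith [sq_nonneg b]
  have hab' : IsCoprime a b := Int.isCoprime_iff_gcd_eq_one.mpr hab
  have hb : Odd b := by
    rw [← Int.not_even_iff_odd, even_iff_two_dvd]
    intro hb2
    exact absurd (hab'.isUnit_of_dvd' ha2 hb2) (by decide)
  have hy0 : y ≠ 0 := by
    rw [hy]
    exact mul_ne_zero (by positivity) (by rintro rfl; simp at hy₀)
  have hprime : Prime (p : ℤ) := Nat.prime_iff_prime_int.mp hp'
  -- If x = 0, then p = qy² with q > 1, so y² = 1 and p = q, which `hne` excludes.
  have hx0 : x ≠ 0 := by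
    rintro rfl
    have hy2 : 0 < y ^ 2 := by positivity
    rcases hprime.irreducible.isUnit_or_isUnit
      (show (p : ℤ) = (a ^ 2 + b ^ 2) * y ^ 2 by rw [hxy]; ring) with h | h <;>
      rw [Int.isUnit_iff] at h
    · omega
    · obtain h | h := h
      · exact hne (by rw [hxy, h]; ring)
      · omega
  have hde : Even d := by
    rcases Int.even_or_odd d with h | ⟨k, rfl⟩
    · exact h
    · obtain ⟨v, rfl⟩ : ∃ v, c = 4 * v + 1 := ⟨c / 4, by omega⟩
      exfalso
      have : (p : ℤ) = 2 * (8 * v ^ 2 + 4 * v + 2 * k ^ 2 + 2 * k + 1) := by rw [hcd]; ring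
      omega
  have hR : GaussianInt.Representation (p : ℤ) c d x y a b (a ^ 2 + b ^ 2) :=
    ⟨hprime, hcd, hxy, rfl, hq1, hb, even_iff_two_dvd.mpr ha2, hx0, hy0, hc, hde⟩
  obtain ⟨z, rfl⟩ : ∃ z, y₀ = 4 * z + 1 := ⟨y₀ / 4, by omega⟩
  rw [← Int.isCoprime_iff_gcd_eq_one, ← Int.isCoprime_iff_gcd_eq_one] at hcop
  obtain ⟨hL0, hLb⟩ := GaussianInt.qlog_im ha0 (even_iff_two_dvd.mpr ha2) hb hab'
  obtain ⟨B, hB⟩ := hb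
  -- This translates the distinction on a into the one on q modulo 8 used in the evaluations.
  have hq8 : (4 ∣ a → (a ^ 2 + b ^ 2) % 8 = 1) ∧ (¬ 4 ∣ a → (a ^ 2 + b ^ 2) % 8 = 5) := by
    obtain ⟨j, hj⟩ := GaussianInt.sq_sub_one_div_four (n := b) ⟨B, hB⟩
    obtain ⟨A, rfl⟩ := ha2
    constructor
    · rintro ⟨k, hk⟩
      rw [hj, hk]; ring_nf; omega
    · intro h4
      obtain ⟨k, rfl⟩ : Odd A := by rw [Int.odd_iff]; by_contra; exact h4 (by omega)
      rw [hj]; ring_nf; omega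
  have hodd : ¬ 2 ∣ x → Odd x := fun h => by rwa [← Int.not_even_iff_odd, even_iff_two_dvd]
  constructor
  · intro hp8
    have hp8' : (p : ℤ) % 8 = 1 := by omega
    split_ifs with h4 h2 h2 <;> refine hR.quarticSymbolFracEq_iff_pow_eq hab' hp8 ?_
    · have := (hcop.elim (fun h => hR.eval_c_one_even hy h hp8' (even_iff_two_dvd.mpr h2))
        (fun h => hR.eval_d_one_even hy hd h hp8' (even_iff_two_dvd.mpr h2))).1 (hq8.1 h4)
      rw [hL0 h4, this]
      push_cast; ring
    · have := (hcop.elim (fun h => hR.eval_c_one_odd hy h hp8' (hodd h2))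
        (fun h => hR.eval_d_one_odd hy hd hd₀ h hp8' (hodd h2))).1 (hq8.1 h4)
      rw [hL0 h4, this]
      push_cast; ring
    · have := (hcop.elim (fun h => hR.eval_c_one_even hy h hp8' (even_iff_two_dvd.mpr h2))
        (fun h => hR.eval_d_one_even hy hd h hp8' (even_iff_two_dvd.mpr h2))).2 (hq8.2 h4)
      rw [hLb h4, this, hB, show (2 * B + 1 + 1) / 2 = B + 1 by omega]
      push_cast; ring
    · have := (hcop.elim (fun h => hR.eval_c_one_odd hy h hp8' (hodd h2))
        (fun h => hR.eval_d_one_odd hy hd hd₀ h hp8' (hodd h2))).2 (hq8.2 h4)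
      obtain ⟨X, rfl⟩ := hodd h2
      rw [hLb h4, this, hB, show (2 * B + 1 - 1) / 2 = B by omega,
        show (2 * X + 1 - 1) / 2 = X by omega]
      push_cast; ring
  · intro hp8
    have hp8' : (p : ℤ) % 8 = 5 := by omega
    split_ifs with h4 h2 h2 <;> refine hR.pow_eq_of_quarticSymbolFracEq hab' hp8 ?_
    · have := (hcop.elim (fun h => hR.eval_c_five_even hy hd hd₀ h hp8' (even_iff_two_dvd.mpr h2))
        (fun h => hR.eval_d_five_even hy hd hd₀ h hp8' (even_iff_two_dvd.mpr h2))).1 (hq8.1 h4)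
      rw [hL0 h4, this]
      push_cast; ring
    · have := (hcop.elim (fun h => hR.eval_c_five_odd hy hd hd₀ h hp8' (hodd h2))
        (fun h => hR.eval_d_five_odd hy hd hd₀ h hp8' (hodd h2))).1 (hq8.1 h4)
      obtain ⟨X, rfl⟩ := hodd h2
      rw [hL0 h4, this, show (2 * X + 1 + 1) / 2 = X + 1 by omega]
      push_cast
      -- The exponent (x + 1)/2 together with the shift m - 1 exceeds x - 1 by exactly 4.
      linear_combination -GaussianInt.four_eq_zero
    · have := (hcop.elim (fun h => hR.eval_c_five_even hy hd hd₀ h hp8' (even_iff_two_dvd.mpr h2))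
        (fun h => hR.eval_d_five_even hy hd hd₀ h hp8' (even_iff_two_dvd.mpr h2))).2 (hq8.2 h4)
      rw [hLb h4, this, hB, show (2 * B + 1 + 1) / 2 = B + 1 by omega]
      push_cast; ring
    · have := (hcop.elim (fun h => hR.eval_c_five_odd hy hd hd₀ h hp8' (hodd h2))
        (fun h => hR.eval_d_five_odd hy hd hd₀ h hp8' (hodd h2))).2 (hq8.2 h4)
      rw [hLb h4, this, hB, show (2 * B + 1 - 1) / 2 = B by omega]
      push_cast; ring
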